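/- Let $p$ be a prime, $S$ a finite $p$-group and $I$ a finite set. **Fusion systems.** A fusion system $\mathcal F$ over $S$ is a category whose objects are the subgroups of $S$, whose morphisms are injective group homomorphisms, such that $\mathrm{Hom}_S(P,Q)\subseteq \mathrm{Hom}_{\mathcal F}(P,Q)$ for all $P,Q\le S$ and every morphism is an $\mathcal F$-isomorphism followed by an inclusion. A subgroup $P\le S$ is *fully centralized* (*fully normalized*) if $|C_S(P)|\ge |C_S(\varphi(P))|$ (resp. $|N_S(P)|\ge|N_S(\varphi(P))|$) for all $\varphi\in \mathrm{Hom}_{\mathcal F}(P,S)$; it is *$\mathcal F$-centric* if $C_S(\varphi(P))=Z(\varphi(P))$ for all such $\varphi$; it is *$\mathcal F$-essential* if it is $\mathcal F$-centric and $\mathrm{Out}_{\mathcal F}(P)=\mathrm{Aut}_{\mathcal F}(P)/\mathrm{Inn}(P)$ has a strongly $p$-embedded subgroup. $\mathcal F$ is *saturated* if (I) every fully normalized $P$ is fully centralized and $\mathrm{Aut}_S(P)\in \mathrm{Syl}_p(\mathrm{Aut}_{\mathcal F}(P))$, and (II) every $\varphi\in \mathrm{Hom}_{\mathcal F}(P,S)$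 with $\varphi(P)$ fully centralized extends to a morphism $N_\varphi\to S$ in $\mathcal F$, where $N_\varphi=\{x\in N_S(P): \varphi c_x\varphi^{-1}\in \mathrm{Aut}_S(\varphi(P))\}$. For $P\trianglelefteq S$, $N_{\mathcal F}(P)$ is the fusion system over $S$ whose morphisms are the homomorphisms $Q\to R$ that extend to an $\mathcal F$-morphism $PQ\to PR$ mapping $P$ onto $P$; $P$ is *normal in* $\mathcal F$ if $P\trianglelefteq S$ and $N_{\mathcal F}(P)=\mathcal F$; $O_p(\mathcal F)$ is the largest subgroup normal in $\mathcal F$; $\mathcal F$ is *constrained* if $O_p(\mathcal F)$ is $\mathcal F$-centric. $\langle\,\cdot\,\rangle$ denotes the smallest fusion system over $S$ containing the given ones. If $S\le G$ for a group $G$, the morphisms of $\mathcal F_S(G)$ are the homomorphisms between subgroups of $S$ induced by conjugation in $G$. **Hypotheses.** Let $\mathcal F$ be a fusion system over $S$ with $O_p(\mathcal F)=1$, put $\mathcal B=N_{\mathcal F}(S)$, and let $(\mathcal F_i)_{i\in I}$ be a family of parabolic subsystems of $\mathcal F$: each $\mathcal F_i$ is a saturated constrained fusion system over $S$ with exactly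 one $\mathcal F_i$-conjugacy class of $\mathcal F_i$-essential subgroups, and - (F1) $\mathcal B$ is properly contained in $\mathcal F_i$ for every $i$; - (F2) $\mathcal F=\langle \mathcal F_i: i\in I\rangle$, and $\langle\mathcal F_j: j\in J\rangle\ne\mathcal F$ for every proper subset $J\subset I$; - (F3) for $i\ne j$, $\mathcal F_i$ and $\mathcal F_j$ intersect in $\mathcal B$, in the sense that every saturated constrained fusion system over $S$ contained in both $\mathcal F_i$ and $\mathcal F_j$ is contained in $\mathcal B$ (this holds in particular if $\mathrm{Hom}_{\mathcal F_i}(P,Q)\cap \mathrm{Hom}_{\mathcal F_j}(P,Q)=\mathrm{Hom}_{\mathcal B}(P,Q)$ for all $P,Q\le S$); - (F4) $\mathcal F_{ij}=\langle\mathcal F_i,\mathcal F_j\rangle$ is saturated and constrained for all $i,j$. Let $B$, $G_i$ $(i\in I)$, $G_{ij}=G_{ji}$ $(i\neq j)$ be finite groups $X$, each with $C_X(O_p(X))\le O_p(X)$ and with $S$ as a Sylow $p$-subgroup, such that $\mathcal F_S(B)=\mathcal B$, $\mathcal F_S(G_i)=\mathcal F_i$, $\mathcal F_S(G_{ij})=\mathcal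 F_{ij}$, and let $B\to G_i\to G_{ij}$ be injective homomorphisms that are the identity on $S$ and such that the two composites $B\to G_i\to G_{ij}$ and $B\to G_j\to G_{ij}$ agree. Let $G$ be a (possibly infinite) group which is a faithful completion of this diagram, i.e. it comes with compatible injective homomorphisms from $B$, $G_i$, $G_{ij}$ to $G$, so that these groups and $S$ are regarded as subgroups of $G$. Let $\mathcal C$ be the chamber system over $I$ whose chambers are the cosets $gB$, $g\in G$, with $gB\sim_i hB$ iff $gG_i=hG_i$; $G$ acts on it by left multiplication. A chamber system is *connected* if it is non-empty and any two chambers are joined by a gallery; fixed-point sets carry the induced adjacency relations, and two orbits in a quotient are $i$-adjacent if they contain $i$-adjacent chambers. Assume that - (a) $\mathcal C^P$ is connected for every finite $p$-subgroup $P$ of $G$; - (b) for every $\mathcal F$-centric subgroup $P\le S$ and every $p$-subgroup $R$ of $\mathrm{Aut}_G(P)=N_G(P)/C_G(P)$, the chamber system $(\mathcal C^P/C_G(P))^R$ is connected. **Conclusion.** $S$ is a Sylow $p$-subgroup of $G$ (every finite $p$-subgroup of $G$ is conjugate to a subgroup of $S$), $\mathcal F=\mathcal F_S(G)$, and $\mathcal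 F$ is a saturated fusion system over $S$. -/

import Mathlib

/-! ## Fusion systems over a group `S` -/

section Image

variable {S : Type*} [Group S]

/-- The image `φ(P)` of a homomorphism between subgroups of `S`, as a subgroup of `S`. -/
def homImage {P Q : Subgroup S} (φ : P →* Q) : Subgroup S :=
  φ.range.map Q.subtype

theorem homImage_le {P Q : Subgroup S} (φ : P →* Q) : homImage φ ≤ Q := by
  rintro _ ⟨x, -, rfl⟩
  exact x.2

theorem mem_homImage {P Q : Subgroup S} (φ : P →* Q) (x : S) :
    x ∈ homImage φ ↔ ∃ u : P, (φ u : S) = x := by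
  constructor
  · rintro ⟨_, ⟨u, rfl⟩, rfl⟩
    exact ⟨u, rfl⟩
  · rintro ⟨u, rfl⟩
    exact ⟨φ u, ⟨u, rfl⟩, rfl⟩

/-- An injective homomorphism is an isomorphism onto its image. -/
noncomputable def homImageEquiv {P Q : Subgroup S} (φ : P →* Q) (h : Function.Injective φ) :
    P ≃* homImage φ :=
  (φ.ofInjective h).trans (φ.range.equivMapOfInjective Q.subtype Q.subtype_injective)

theorem homImageEquiv_coe {P Q : Subgroup S} (φ : P →* Q) (h : Function.Injective φ) (u : P) :
    (homImageEquiv φ h u : S) = φ u := rfl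

theorem homImageEquiv_comp {P Q : Subgroup S} (φ : P →* Q) (h : Function.Injective φ) :
    φ = (Subgroup.inclusion (homImage_le φ)).comp (homImageEquiv φ h).toMonoidHom := by
  ext u
  rfl

end Image

/-- A fusion system over `S`: a category whose objects are the subgroups of `S` and whose
morphisms are injective homomorphisms, containing all homomorphisms induced by conjugation in `S`
(so in particular identities and inclusions), and in which every morphism is an isomorphism of the
category followed by an inclusion. -/
@[ext]
structure FusionSystem (S : Type*) [Group S] where
  Hom : (P Q : Subgroup S) → Set (P →* Q)
  comp_mem : ∀ {P Q R : Subgroup S} {φ : P →* Q} {ψ : Q →* R},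
    φ ∈ Hom P Q → ψ ∈ Hom Q R → ψ.comp φ ∈ Hom P R
  conj_mem : ∀ {P Q : Subgroup S} (g : S) (φ : P →* Q),
    (∀ u : P, (φ u : S) = g * u * g⁻¹) → φ ∈ Hom P Q
  injective : ∀ {P Q : Subgroup S} {φ : P →* Q}, φ ∈ Hom P Q → Function.Injective φ
  factor : ∀ {P Q : Subgroup S} {φ : P →* Q}, φ ∈ Hom P Q →
    ∃ (R : Subgroup S) (hR : R ≤ Q) (e : P ≃* R), e.toMonoidHom ∈ Hom P R ∧
      e.symm.toMonoidHom ∈ Hom R P ∧ φ = (Subgroup.inclusion hR).comp e.toMonoidHom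

namespace FusionSystem

variable {S : Type*} [Group S]

/-- In the factorization of a morphism, the isomorphism is the one onto the image. -/
theorem factor_image (F : FusionSystem S) {P Q : Subgroup S} {φ : P →* Q} (hφ : φ ∈ F.Hom P Q)
    (h : Function.Injective φ) :
    (homImageEquiv φ h).toMonoidHom ∈ F.Hom P (homImage φ) ∧
      (homImageEquiv φ h).symm.toMonoidHom ∈ F.Hom (homImage φ) P := by
  obtain ⟨R, hR, e, he, he', hc⟩ := F.factor hφ
  have hval : ∀ u : P, (φ u : S) = e u := by
    intro u
    rw [hc]
    rfl
  have hRi : R = homImage φ := by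
    ext x
    rw [mem_homImage]
    constructor
    · intro hx
      exact ⟨e.symm ⟨x, hx⟩, by rw [hval]; simp⟩
    · rintro ⟨u, rfl⟩
      rw [hval]
      exact (e u).2
  subst hRi
  have hee : homImageEquiv φ h = e := by
    ext u
    rw [homImageEquiv_coe, hval]
  rw [hee]
  exact ⟨he, he'⟩

/-- `E ⊆ F` for fusion systems over the same group. -/
instance : LE (FusionSystem S) where
  le E F := ∀ P Q : Subgroup S, E.Hom P Q ⊆ F.Hom P Q

/-- The intersection of a set of fusion systems over `S`. -/
def inter (𝓐 : Set (FusionSystem S)) : FusionSystem S where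
  Hom P Q := {φ | Function.Injective φ ∧ ∀ F ∈ 𝓐, φ ∈ F.Hom P Q}
  comp_mem hφ hψ := ⟨hψ.1.comp hφ.1, fun F hF => F.comp_mem (hφ.2 F hF) (hψ.2 F hF)⟩
  conj_mem g φ h := by
    refine ⟨fun u v huv => ?_, fun F _ => F.conj_mem g φ h⟩
    have := h u
    rw [huv, h v] at this
    exact Subtype.ext (by simpa using this.symm)
  injective h := h.1
  factor {P Q φ} h := by
    refine ⟨homImage φ, homImage_le φ, homImageEquiv φ h.1, ⟨(homImageEquiv φ h.1).injective, ?_⟩,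
      ⟨(homImageEquiv φ h.1).symm.injective, ?_⟩, homImageEquiv_comp φ h.1⟩
    · exact fun F hF => (F.factor_image (h.2 F hF) h.1).1
    · exact fun F hF => (F.factor_image (h.2 F hF) h.1).2

/-- The smallest fusion system over `S` containing every member of `𝓔`. -/
def generate (𝓔 : Set (FusionSystem S)) : FusionSystem S :=
  inter {F | ∀ E ∈ 𝓔, E ≤ F}

/-- The fusion system `F_S(G)` of a group `G` into which `S` is embedded by `ι`: the morphisms are
the homomorphisms between subgroups of `S` that are induced by conjugation in `G`. -/
def ofGroup {G : Type*} [Group G] (ι : S →* G) (hι : Function.Injective ι) : FusionSystem S where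
  Hom P Q := {φ | ∃ g : G, ∀ u : P, ι (φ u) = g * ι u * g⁻¹}
  comp_mem := by
    rintro P Q R φ ψ ⟨g, hg⟩ ⟨k, hk⟩
    refine ⟨k * g, fun u => ?_⟩
    simp only [MonoidHom.comp_apply, hk, hg]
    group
  conj_mem g φ h := ⟨ι g, fun u => by rw [h]; simp⟩
  injective := by
    rintro P Q φ ⟨g, hg⟩ u v huv
    have := hg u
    rw [huv, hg v] at this
    exact Subtype.ext (hι (by simpa using this.symm))
  factor := by
    rintro P Q φ ⟨g, hg⟩
    have hinj : Function.Injective φ := by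
      intro u v huv
      have := hg u
      rw [huv, hg v] at this
      exact Subtype.ext (hι (by simpa using this.symm))
    refine ⟨homImage φ, homImage_le φ, homImageEquiv φ hinj, ⟨g, fun u => ?_⟩, ⟨g⁻¹, fun u => ?_⟩,
      homImageEquiv_comp φ hinj⟩
    · exact hg u
    · obtain ⟨v, rfl⟩ := (homImageEquiv φ hinj).surjective u
      have : ((homImageEquiv φ hinj).symm.toMonoidHom (homImageEquiv φ hinj v)) = v :=
        (homImageEquiv φ hinj).symm_apply_apply v
      rw [this, homImageEquiv_coe, hg]
      group

/-- The homomorphisms `Q → R` that extend to a morphism `PQ → PR` of `F` which maps `P` onto `P`: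
these are the morphisms of the normalizer `N_F(P)`. -/
def normalizerHom (F : FusionSystem S) (P Q R : Subgroup S) : Set (Q →* R) :=
  {φ | ∃ ψ ∈ F.Hom (P ⊔ Q) (P ⊔ R),
    (P.subgroupOf (P ⊔ Q)).map ψ = P.subgroupOf (P ⊔ R) ∧
      ∀ u : Q, (ψ (Subgroup.inclusion le_sup_right u) : S) = φ u}

/-- The normalizer `N_F(P)`, for a subgroup `P` with `N_S(P) = S`. -/
def normalizer (F : FusionSystem S) (P : Subgroup S) (hP : P.Normal) : FusionSystem S where
  Hom := F.normalizerHom P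
  comp_mem := by
    rintro Q R T φ φ' ⟨ψ, hψ, hP, he⟩ ⟨ψ', hψ', hP', he'⟩
    refine ⟨ψ'.comp ψ, F.comp_mem hψ hψ', ?_, fun u => ?_⟩
    · rw [← Subgroup.map_map, hP, hP']
    · have h1 : ψ (Subgroup.inclusion le_sup_right u) =
          Subgroup.inclusion le_sup_right (φ u) := Subtype.ext (he u)
      rw [MonoidHom.comp_apply, h1, he' (φ u)]
      rfl
  conj_mem := by
    intro Q R g φ h
    have hmem : ∀ u ∈ P ⊔ Q, g * u * g⁻¹ ∈ P ⊔ R := by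
      intro u hu
      have h1 : (P ⊔ Q).map (MulAut.conj g).toMonoidHom ≤ P ⊔ R := by
        rw [Subgroup.map_sup]
        refine sup_le_sup ?_ ?_
        · rintro _ ⟨x, hx, rfl⟩
          exact hP.conj_mem x hx g
        · rintro _ ⟨x, hx, rfl⟩
          have := h ⟨x, hx⟩
          have h2 : (MulAut.conj g).toMonoidHom x = φ ⟨x, hx⟩ := by
            rw [this]
            rfl
          rw [h2]
          exact (φ ⟨x, hx⟩).2
      exact h1 ⟨u, hu, rfl⟩
    let ψ : ↥(P ⊔ Q) →* ↥(P ⊔ R) :=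
      { toFun := fun u => ⟨g * u * g⁻¹, hmem u u.2⟩
        map_one' := Subtype.ext (by simp)
        map_mul' := fun u v => Subtype.ext (by simp) }
    refine ⟨ψ, F.conj_mem g ψ fun u => rfl, ?_, fun u => (h u).symm⟩
    ext x
    simp only [Subgroup.mem_map, Subgroup.mem_subgroupOf]
    constructor
    · rintro ⟨u, hu, rfl⟩
      exact hP.conj_mem _ hu g
    · intro hx
      have hx' : g⁻¹ * (x : S) * g ∈ P := by
        have := hP.conj_mem _ hx g⁻¹
        simpa using this
      refine ⟨⟨g⁻¹ * x * g, Subgroup.mem_sup_left hx'⟩, hx', Subtype.ext ?_⟩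
      change g * (g⁻¹ * (x : S) * g) * g⁻¹ = x
      group
  injective := by
    rintro Q R φ ⟨ψ, hψ, -, he⟩ u v huv
    have h1 : ψ (Subgroup.inclusion le_sup_right u) = ψ (Subgroup.inclusion le_sup_right v) :=
      Subtype.ext (by rw [he, he, huv])
    exact Subgroup.inclusion_injective _ (F.injective hψ h1)
  factor := by
    rintro Q R φ ⟨ψ, hψ, hPP, he⟩
    have hψi := F.injective hψ
    have hinj : Function.Injective φ := by
      intro u v huv
      have h1 : ψ (Subgroup.inclusion le_sup_right u) = ψ (Subgroup.inclusion le_sup_right v) :=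
        Subtype.ext (by rw [he, he, huv])
      exact Subgroup.inclusion_injective _ (hψi h1)
    have hfac := F.factor_image hψ hψi
    have hmapP : ∀ u : ↥(P ⊔ Q), (u : S) ∈ P → (ψ u : S) ∈ P := fun u hu => by
      have h1 : ψ u ∈ (P.subgroupOf (P ⊔ Q)).map ψ := ⟨u, hu, rfl⟩
      rw [hPP] at h1
      exact h1
    have hsurP : ∀ x ∈ P, ∃ u : ↥(P ⊔ Q), (u : S) ∈ P ∧ (ψ u : S) = x := fun x hx => by
      have h1 : (⟨x, Subgroup.mem_sup_left hx⟩ : ↥(P ⊔ R)) ∈ (P.subgroupOf (P ⊔ Q)).map ψ := by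
        rw [hPP]
        exact hx
      obtain ⟨u, hu, hux⟩ := h1
      exact ⟨u, hu, congrArg Subtype.val hux⟩
    have himg : homImage ψ = P ⊔ homImage φ := by
      refine le_antisymm ?_ (sup_le ?_ ?_)
      · intro x hx
        obtain ⟨⟨u, hu⟩, rfl⟩ := (mem_homImage ψ x).1 hx
        obtain ⟨y, hy, z, hz, rfl⟩ := Subgroup.mem_sup_of_normal_left.1 hu
        have h1 : ψ ⟨y * z, hu⟩ = ψ ⟨y, Subgroup.mem_sup_left hy⟩ *
            ψ (Subgroup.inclusion le_sup_right ⟨z, hz⟩) := by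
          rw [← map_mul]
          rfl
        rw [h1, Subgroup.coe_mul, he]
        exact mul_mem (Subgroup.mem_sup_left (hmapP _ hy))
          (Subgroup.mem_sup_right ((mem_homImage φ _).2 ⟨_, rfl⟩))
      · intro x hx
        obtain ⟨u, -, hu⟩ := hsurP x hx
        exact (mem_homImage ψ x).2 ⟨u, hu⟩
      · intro x hx
        obtain ⟨u, hu⟩ := (mem_homImage φ x).1 hx
        exact (mem_homImage ψ x).2 ⟨_, (he u).trans hu⟩
    obtain ⟨e, he1, he2, he3⟩ : ∃ e : ↥(P ⊔ Q) ≃* ↥(P ⊔ homImage φ),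
        e.toMonoidHom ∈ F.Hom _ _ ∧ e.symm.toMonoidHom ∈ F.Hom _ _ ∧
          ∀ u, (e u : S) = ψ u := by
      rw [← himg]
      exact ⟨homImageEquiv ψ hψi, hfac.1, hfac.2, fun u => rfl⟩
    have hkey : (P.subgroupOf (P ⊔ Q)).map e.toMonoidHom = P.subgroupOf (P ⊔ homImage φ) := by
      ext x
      simp only [Subgroup.mem_map, Subgroup.mem_subgroupOf]
      constructor
      · rintro ⟨u, hu, rfl⟩
        change ((e u : S)) ∈ P
        rw [he3]
        exact hmapP u hu
      · intro hx
        obtain ⟨u, hu, hux⟩ := hsurP x hx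
        exact ⟨u, hu, Subtype.ext ((he3 u).trans hux)⟩
    refine ⟨homImage φ, homImage_le φ, homImageEquiv φ hinj, ⟨e.toMonoidHom, he1, hkey, ?_⟩,
      ⟨e.symm.toMonoidHom, he2, ?_, ?_⟩, homImageEquiv_comp φ hinj⟩
    · intro u
      exact (he3 _).trans (he u)
    · rw [← hkey, Subgroup.map_map]
      convert Subgroup.map_id _
      ext u
      simp
    · intro u
      obtain ⟨v, rfl⟩ := (homImageEquiv φ hinj).surjective u
      have h1 : Subgroup.inclusion le_sup_right (homImageEquiv φ hinj v) =
          e (Subgroup.inclusion le_sup_right v) :=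
        Subtype.ext (((he3 _).trans (he v)).symm)
      have h2 : (homImageEquiv φ hinj).symm.toMonoidHom (homImageEquiv φ hinj v) = v :=
        (homImageEquiv φ hinj).symm_apply_apply v
      have h3 : e.symm.toMonoidHom (e (Subgroup.inclusion le_sup_right v)) =
          Subgroup.inclusion le_sup_right v := e.symm_apply_apply _
      rw [h1, h2, h3]
      rfl

/-- The subsystem `N_F(S)`. -/
def normalizerTop (F : FusionSystem S) : FusionSystem S :=
  F.normalizer ⊤ inferInstance

/-- `P` is normal in `F`: `N_S(P) = S` and `F = N_F(P)`. -/
def IsNormal (F : FusionSystem S) (P : Subgroup S) : Prop :=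
  ∃ hP : P.Normal, F.normalizer P hP = F

/-- `O_p(F)`, the largest subgroup of `S` that is normal in `F` (for a finite `p`-group `S`, the
subgroup generated by the normal ones is itself normal in `F`). -/
def Op (F : FusionSystem S) : Subgroup S :=
  sSup {P | F.IsNormal P}

/-- Fully `F`-centralized subgroups. -/
def IsFullyCentralized (F : FusionSystem S) (P : Subgroup S) : Prop :=
  ∀ φ ∈ F.Hom P ⊤, Nat.card (Subgroup.centralizer (homImage φ : Set S)) ≤
    Nat.card (Subgroup.centralizer (P : Set S))

/-- Fully `F`-normalized subgroups. -/
def IsFullyNormalized (F : FusionSystem S) (P : Subgroup S) : Prop :=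
  ∀ φ ∈ F.Hom P ⊤, Nat.card (Subgroup.normalizer (homImage φ : Set S)) ≤
    Nat.card (Subgroup.normalizer (P : Set S))

/-- `F`-centric subgroups: `C_S(φ(P)) = Z(φ(P))` for all `φ ∈ Hom_F(P, S)`. -/
def IsCentric (F : FusionSystem S) (P : Subgroup S) : Prop :=
  ∀ φ ∈ F.Hom P ⊤, Subgroup.centralizer (homImage φ : Set S) =
    (Subgroup.center (homImage φ)).map (homImage φ).subtype

/-- `F` is constrained: `O_p(F)` is `F`-centric. -/
def IsConstrained (F : FusionSystem S) : Prop :=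
  F.IsCentric F.Op

/-- `P` and `Q` are `F`-conjugate. -/
def IsConj (F : FusionSystem S) (P Q : Subgroup S) : Prop :=
  ∃ φ ∈ F.Hom P ⊤, homImage φ = Q

theorem id_mem (F : FusionSystem S) (P : Subgroup S) : MonoidHom.id P ∈ F.Hom P P :=
  F.conj_mem 1 _ fun u => by simp

theorem symm_mem (F : FusionSystem S) {P : Subgroup S} (α : P ≃* P)
    (h : α.toMonoidHom ∈ F.Hom P P) : α.symm.toMonoidHom ∈ F.Hom P P := by
  obtain ⟨R, hR, e, he, he', hc⟩ := F.factor h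
  have hval : ∀ u : P, (α u : S) = e u := fun u => congrArg Subtype.val (DFunLike.congr_fun hc u)
  have hRP : R = P := by
    refine le_antisymm hR fun x hx => ?_
    have h1 := hval (α.symm ⟨x, hx⟩)
    rw [α.apply_symm_apply] at h1
    change x = _ at h1
    rw [h1]
    exact (e _).2
  subst hRP
  have hee : α = e := by
    ext u
    exact hval u
  rw [hee]
  exact he'

/-- The group `Aut_F(P)`. -/
def Aut (F : FusionSystem S) (P : Subgroup S) : Subgroup (MulAut P) where
  carrier := {α | α.toMonoidHom ∈ F.Hom P P}
  mul_mem' {α β} hα hβ := F.comp_mem (φ := β.toMonoidHom) (ψ := α.toMonoidHom) hβ hα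
  one_mem' := F.id_mem P
  inv_mem' {α} hα := F.symm_mem α hα

end FusionSystem

/-- The group `Aut_G(P)` of automorphisms of `P` induced by conjugation by elements of `N_G(P)`;
it is `N_G(P) / C_G(P)`. -/
def conjAut {G : Type*} [Group G] (P : Subgroup G) : Subgroup (MulAut P) :=
  P.normalizerMonoidHom.range

/-- `Inn(P)`. -/
def innAut (P : Type*) [Group P] : Subgroup (MulAut P) :=
  (MulAut.conj : P →* MulAut P).range

instance innAut_normal (P : Type*) [Group P] : (innAut P).Normal := by
  refine ⟨?_⟩
  rintro _ ⟨x, rfl⟩ α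
  refine ⟨α x, ?_⟩
  ext y
  simp [MulAut.conj_apply]

/-- `X` has a strongly `p`-embedded subgroup: a proper subgroup `M` that contains a Sylow
`p`-subgroup `Q ≠ 1` of `X` such that `Q` meets each of its conjugates by elements outside `M`
trivially. -/
def HasStronglyEmbedded (p : ℕ) (X : Type*) [Group X] : Prop :=
  ∃ (M : Subgroup X) (Q : Sylow p X), M ≠ ⊤ ∧ (Q : Subgroup X) ≤ M ∧ (Q : Subgroup X) ≠ ⊥ ∧
    ∀ x ∉ M, (Q : Subgroup X).map (MulAut.conj x).toMonoidHom ⊓ (Q : Subgroup X) = ⊥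

namespace FusionSystem

variable {S : Type*} [Group S]

/-- The group `Out_F(P) = Aut_F(P) / Inn(P)`. -/
abbrev Out (F : FusionSystem S) (P : Subgroup S) : Type _ :=
  F.Aut P ⧸ (innAut P).subgroupOf (F.Aut P)

/-- `F`-essential subgroups. -/
def IsEssential (p : ℕ) (F : FusionSystem S) (P : Subgroup S) : Prop :=
  F.IsCentric P ∧ HasStronglyEmbedded p (F.Out P)

/-- `F` has essential rank one: there is exactly one `F`-conjugacy class of `F`-essential
subgroups. -/
def HasEssentialRankOne (p : ℕ) (F : FusionSystem S) : Prop :=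
  (∃ E, F.IsEssential p E) ∧ ∀ E E', F.IsEssential p E → F.IsEssential p E' → F.IsConj E E'

/-- `N_φ = {x ∈ N_S(P) | φ ∘ c_x ∘ φ⁻¹ ∈ Aut_S(φ(P))}`. -/
def extender {P : Subgroup S} (φ : P →* (⊤ : Subgroup S)) : Subgroup S where
  carrier := {x | ∃ hx : x ∈ Subgroup.normalizer (P : Set S),
    ∃ y ∈ Subgroup.normalizer (homImage φ : Set S), ∀ u : P,
      (φ (P.normalizerMonoidHom ⟨x, hx⟩ u) : S) = y * φ u * y⁻¹}
  mul_mem' := by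
    rintro a b ⟨ha, y, hy, hya⟩ ⟨hb, z, hz, hzb⟩
    refine ⟨mul_mem ha hb, y * z, mul_mem hy hz, fun u => ?_⟩
    have h1 : P.normalizerMonoidHom ⟨a * b, mul_mem ha hb⟩ u =
        P.normalizerMonoidHom ⟨a, ha⟩ (P.normalizerMonoidHom ⟨b, hb⟩ u) := by
      have : (⟨a * b, mul_mem ha hb⟩ : Subgroup.normalizer (P : Set S)) = ⟨a, ha⟩ * ⟨b, hb⟩ := rfl
      rw [this, map_mul]
      rfl
    rw [h1, hya, hzb]
    group
  one_mem' := ⟨one_mem _, 1, one_mem _, fun u => by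
    have : (⟨1, one_mem _⟩ : Subgroup.normalizer (P : Set S)) = 1 := rfl
    rw [this, map_one]
    simp⟩
  inv_mem' := by
    rintro a ⟨ha, y, hy, hya⟩
    refine ⟨inv_mem ha, y⁻¹, inv_mem hy, fun u => ?_⟩
    have h1 : P.normalizerMonoidHom ⟨a, ha⟩ (P.normalizerMonoidHom ⟨a⁻¹, inv_mem ha⟩ u) = u := by
      have : (⟨a⁻¹, inv_mem ha⟩ : Subgroup.normalizer (P : Set S)) = ⟨a, ha⟩⁻¹ := rfl
      rw [this, map_inv]
      exact MulEquiv.apply_symm_apply _ _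
    have h2 := hya (P.normalizerMonoidHom ⟨a⁻¹, inv_mem ha⟩ u)
    rw [h1] at h2
    rw [h2]
    group

/-- Saturated fusion systems over a `p`-group `S`. -/
structure IsSaturated (p : ℕ) (F : FusionSystem S) : Prop where
  sylow : ∀ P : Subgroup S, F.IsFullyNormalized P → F.IsFullyCentralized P ∧
    ∃ Q : Sylow p (F.Aut P), (Q : Subgroup (F.Aut P)).map (F.Aut P).subtype = conjAut P
  extend : ∀ (P : Subgroup S) (φ : P →* (⊤ : Subgroup S)), φ ∈ F.Hom P ⊤ →
    F.IsFullyCentralized (homImage φ) →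
      ∃ ψ ∈ F.Hom (extender φ) ⊤, ∀ (u : S) (hu : u ∈ P) (hu' : u ∈ extender φ),
        ψ ⟨u, hu'⟩ = φ ⟨u, hu⟩

/-- The system `F_ij = ⟨F_i, F_j⟩` for an unordered pair `z = {i, j}`. -/
def pair {I : Type*} (Fi : I → FusionSystem S) (z : Sym2 I) : FusionSystem S :=
  generate (Fi '' {i | i ∈ z})

/-- If the morphisms common to `F₁` and `F₂` are those of `B`, then `B` contains every subsystem of
`F₁` and `F₂`. -/
theorem le_of_inter_eq {F₁ F₂ B E : FusionSystem S} (h : inter {F₁, F₂} = B) (h₁ : E ≤ F₁)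
    (h₂ : E ≤ F₂) : E ≤ B := by
  subst h
  intro P Q φ hφ
  refine ⟨E.injective hφ, fun F hF => ?_⟩
  rcases hF with rfl | rfl
  · exact h₁ P Q hφ
  · exact h₂ P Q hφ

/-- `(F_i)` is a family of parabolic subsystems of `F`, where `B = N_F(S)` is `normalizerTop`.
The condition `F_i ∩ F_j = B` is required in the sense that `B`, which is contained in `F_i` and
`F_j` by `lt`, contains every saturated constrained fusion system over `S` contained in both. By
`le_of_inter_eq` this follows if every morphism common to `F_i` and `F_j` lies in `B`; that stronger
condition already fails for the minimal parabolic subgroups of `GL_4(2)`. -/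
structure IsParabolicFamily (p : ℕ) {I : Type*} (F : FusionSystem S) (Fi : I → FusionSystem S) :
    Prop where
  saturated : ∀ i, (Fi i).IsSaturated p
  constrained : ∀ i, (Fi i).IsConstrained
  rank_one : ∀ i, (Fi i).HasEssentialRankOne p
  lt : ∀ i, F.normalizerTop ≤ Fi i ∧ F.normalizerTop ≠ Fi i
  generates : generate (Set.range Fi) = F
  minimal : ∀ J : Set I, J ≠ Set.univ → generate (Fi '' J) ≠ F
  inter_eq : ∀ i j, i ≠ j → ∀ E : FusionSystem S, E.IsSaturated p → E.IsConstrained →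
    E ≤ Fi i → E ≤ Fi j → E ≤ F.normalizerTop
  pair_saturated : ∀ z, (pair Fi z).IsSaturated p
  pair_constrained : ∀ z, (pair Fi z).IsConstrained

end FusionSystem

/-! ## Groups realizing fusion systems -/

/-- `O_p(X)` for a finite group `X`. -/
def pCore (p : ℕ) (X : Type*) [Group X] : Subgroup X :=
  sSup {N | N.Normal ∧ IsPGroup p N}

/-- The finite group `X`, into which `S` is embedded by `ι`, is a model of `F`: it is
`p'`-reduced and `p`-constrained, that is `C_X(O_p(X)) ≤ O_p(X)`, it has `S` as a Sylow
`p`-subgroup, and `F = F_S(X)`. -/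
structure IsModel (p : ℕ) {S X : Type*} [Group S] [Group X] (ι : S →* X) (F : FusionSystem S) :
    Prop where
  finite : Finite X
  constrained : Subgroup.centralizer (pCore p X : Set X) ≤ pCore p X
  sylow : ∃ Q : Sylow p X, (Q : Subgroup X) = ι.range
  realizes : ∃ hι : Function.Injective ι, F = FusionSystem.ofGroup ι hι

/-- `F` is realized by the (possibly infinite) group `G`, into which `S` is embedded by `ι`: `S` is
a Sylow `p`-subgroup of `G`, in the sense that it is a finite `p`-subgroup and every finite
`p`-subgroup of `G` is conjugate to a subgroup of `S`, and `F = F_S(G)`. -/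
structure IsRealizedBy (p : ℕ) {S G : Type*} [Group S] [Group G] (ι : S →* G)
    (F : FusionSystem S) : Prop where
  finite : Finite ι.range
  isPGroup : IsPGroup p ι.range
  sylow : ∀ P : Subgroup G, Finite P → IsPGroup p P →
    ∃ g : G, P.map (MulAut.conj g).toMonoidHom ≤ ι.range
  eq_ofGroup : ∃ hι : Function.Injective ι, F = FusionSystem.ofGroup ι hι

/-- A diagram of finite groups `B → G_i → G_ij` over the index set `I`. The groups `G_ij`, `i ≠ j`,
are indexed by the unordered pairs `z = {i, j}`. -/
structure GroupDiagram.{u, w} (I : Type u) where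
  B : Type w
  G₁ : I → Type w
  G₂ : {z : Sym2 I // ¬ z.IsDiag} → Type w
  [groupB : Group B]
  [group₁ : ∀ i, Group (G₁ i)]
  [group₂ : ∀ z, Group (G₂ z)]
  [finiteB : Finite B]
  [finite₁ : ∀ i, Finite (G₁ i)]
  [finite₂ : ∀ z, Finite (G₂ z)]
  τ₁ : ∀ i, B →* G₁ i
  τ₂ : ∀ (z : {z : Sym2 I // ¬ z.IsDiag}) (i : I), i ∈ z.1 → (G₁ i →* G₂ z)
  τ₁_injective : ∀ i, Function.Injective (τ₁ i)
  τ₂_injective : ∀ z i hi, Function.Injective (τ₂ z i hi)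
  comm : ∀ z i j (hi : i ∈ z.1) (hj : j ∈ z.1),
    (τ₂ z i hi).comp (τ₁ i) = (τ₂ z j hj).comp (τ₁ j)

attribute [instance] GroupDiagram.groupB GroupDiagram.group₁ GroupDiagram.group₂
  GroupDiagram.finiteB GroupDiagram.finite₁ GroupDiagram.finite₂

/-- A completion of a diagram of groups. -/
structure GroupDiagram.Completion {I : Type*} (A : GroupDiagram I) (G : Type*) [Group G] where
  φB : A.B →* G
  φ₁ : ∀ i, A.G₁ i →* G
  φ₂ : ∀ z, A.G₂ z →* G
  comm₁ : ∀ i, (φ₁ i).comp (A.τ₁ i) = φB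
  comm₂ : ∀ z i hi, (φ₂ z).comp (A.τ₂ z i hi) = φ₁ i

/-- A completion is faithful if all its homomorphisms are injective. -/
structure GroupDiagram.Completion.IsFaithful {I : Type*} {A : GroupDiagram I} {G : Type*} [Group G]
    (Φ : A.Completion G) : Prop where
  injB : Function.Injective Φ.φB
  inj₁ : ∀ i, Function.Injective (Φ.φ₁ i)
  inj₂ : ∀ z, Function.Injective (Φ.φ₂ z)

/-- `A` is a diagram of models of `N_F(S)`, `F_i` and `F_ij`, where `S` is embedded in `B` by `ι`
and in the groups `G_i` and `G_ij` through the homomorphisms of the diagram, which therefore all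
restrict to the identity of `S`. -/
structure IsModelDiagram (p : ℕ) {S I : Type*} [Group S] (F : FusionSystem S)
    (Fi : I → FusionSystem S) (A : GroupDiagram I) (ι : S →* A.B) : Prop where
  modelB : IsModel p ι F.normalizerTop
  model₁ : ∀ i, IsModel p ((A.τ₁ i).comp ι) (Fi i)
  model₂ : ∀ z i hi, IsModel p ((A.τ₂ z i hi).comp ((A.τ₁ i).comp ι)) (FusionSystem.pair Fi z.1)

/-! ## Chamber systems -/

/-- A chamber system over `I` on the set `C`: a family of equivalence relations. Non-emptiness is
part of `ChamberSystem.IsConnected`. -/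
structure ChamberSystem (I C : Type*) where
  adj : I → Setoid C

namespace ChamberSystem

variable {I C : Type*}

/-- A chamber system is connected if it is non-empty and any two chambers are joined by a
gallery. -/
def IsConnected (X : ChamberSystem I C) : Prop :=
  Nonempty C ∧ ∀ c d : C, Relation.ReflTransGen (fun a b => ∃ i, X.adj i a b) c d

/-- The chamber subsystem on a set of chambers. -/
def induce (X : ChamberSystem I C) (s : Set C) : ChamberSystem I s where
  adj i := (X.adj i).comap Subtype.val

/-- `K` acts on the chamber system by automorphisms. -/
def IsInvariant (K : Type*) [Group K] [MulAction K C] (X : ChamberSystem I C) : Prop :=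
  ∀ (k : K) (i : I) (c d : C), X.adj i c d → X.adj i (k • c) (k • d)

/-- The quotient chamber system `C / K`: two `K`-orbits are `i`-adjacent if they contain
`i`-adjacent chambers. -/
def quotient (K : Type*) [Group K] [MulAction K C] (X : ChamberSystem I C)
    (hX : X.IsInvariant K) : ChamberSystem I (MulAction.orbitRel.Quotient K C) where
  adj i :=
    { r := fun x y => ∃ c d : C, (Quotient.mk _ c : MulAction.orbitRel.Quotient K C) = x ∧
        (Quotient.mk _ d : MulAction.orbitRel.Quotient K C) = y ∧ X.adj i c d
      iseqv := by
        refine ⟨fun x => ?_, ?_, ?_⟩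
        · induction x using Quotient.inductionOn with
          | h c => exact ⟨c, c, rfl, rfl, (X.adj i).refl c⟩
        · rintro x y ⟨c, d, hc, hd, h⟩
          exact ⟨d, c, hd, hc, (X.adj i).symm h⟩
        · rintro x y w ⟨c, d, hc, hd, h⟩ ⟨d', e, hd', he, h'⟩
          obtain ⟨k, hk⟩ := Quotient.exact (hd.trans hd'.symm)
          refine ⟨c, k • e, hc, ?_, (X.adj i).trans h ?_⟩
          · rw [← he]
            exact Quotient.sound ⟨k, rfl⟩
          · have h2 := hX k i d' e h'
            change k • d' = d at hk
            rwa [hk] at h2 }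

end ChamberSystem

/-- The chamber system `C(G; B, G_i, i ∈ I)`: the chambers are the left cosets of `B` in `G`, and
`gB`, `hB` are `i`-adjacent if `gG_i = hG_i`. -/
def cosetSystem {G I : Type*} [Group G] (B : Subgroup G) (Gi : I → Subgroup G)
    (h : ∀ i, B ≤ Gi i) : ChamberSystem I (G ⧸ B) where
  adj i := Setoid.ker (Subgroup.quotientMapOfLE (h i))

theorem cosetSystem_invariant {G I : Type*} [Group G] (B : Subgroup G) (Gi : I → Subgroup G)
    (h : ∀ i, B ≤ Gi i) : (cosetSystem B Gi h).IsInvariant G := by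
  intro g i c d hcd
  induction c using QuotientGroup.induction_on with | H a => ?_
  induction d using QuotientGroup.induction_on with | H b => ?_
  change ((a : G) : G ⧸ Gi i) = (b : G) at hcd
  change ((g * a : G) : G ⧸ Gi i) = (g * b : G)
  rw [QuotientGroup.eq] at hcd ⊢
  simpa [mul_assoc] using hcd

/-- The chambers fixed by `P`. -/
abbrev fixedChambers {G : Type*} [Group G] (P : Subgroup G) (C : Type*) [MulAction G C] : Set C :=
  MulAction.fixedPoints P C

/-- `N_G(P)` acts on the set of chambers fixed by `P`. -/
instance normalizerFixedAction {G : Type*} [Group G] (P : Subgroup G) (C : Type*) [MulAction G C] :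
    MulAction (Subgroup.normalizer (P : Set G)) (fixedChambers P C) where
  smul n c := ⟨(n : G) • (c : C), by
    rintro ⟨x, hx⟩
    have h1 : (n : G)⁻¹ * x * n ∈ P := (Subgroup.mem_normalizer_iff''.1 n.2 x).1 hx
    have h2 : ((n : G)⁻¹ * x * n) • (c : C) = c := c.2 ⟨_, h1⟩
    change x • (n : G) • (c : C) = (n : G) • (c : C)
    rw [← smul_smul, ← smul_smul, inv_smul_eq_iff] at h2
    exact h2⟩
  one_smul c := Subtype.ext (one_smul G (c : C))
  mul_smul m n c := Subtype.ext (mul_smul (m : G) (n : G) (c : C))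

/-- `C_G(P)` as a subgroup of `N_G(P)`. -/
abbrev centralizerIn {G : Type*} [Group G] (P : Subgroup G) :
    Subgroup (Subgroup.normalizer (P : Set G)) :=
  (Subgroup.centralizer (P : Set G)).subgroupOf (Subgroup.normalizer (P : Set G))

namespace ChamberSystem

variable {G I C : Type*} [Group G] [MulAction G C]

/-- The fixed chamber system `C^P`. -/
def fixed (X : ChamberSystem I C) (P : Subgroup G) : ChamberSystem I (fixedChambers P C) :=
  X.induce (fixedChambers P C)

theorem fixed_invariant (X : ChamberSystem I C) (hX : X.IsInvariant G) (P : Subgroup G) :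
    (X.fixed P).IsInvariant (centralizerIn P) :=
  fun k i c d h => hX ((k : Subgroup.normalizer (P : Set G)) : G) i c d h

/-- The chamber system `C^P / C_G(P)`. -/
def fixedQuotient (X : ChamberSystem I C) (hX : X.IsInvariant G) (P : Subgroup G) :
    ChamberSystem I (MulAction.orbitRel.Quotient (centralizerIn P) (fixedChambers P C)) :=
  (X.fixed P).quotient (centralizerIn P) (X.fixed_invariant hX P)

/-- The chambers of `C^P / C_G(P)` fixed by the subgroup `R` of `Aut_G(P) = N_G(P) / C_G(P)`: the
`C_G(P)`-orbits that are mapped to themselves by every `n ∈ N_G(P)` whose conjugation action on `P`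
lies in `R`. -/
def fixedOrbits (P : Subgroup G) (C : Type*) [MulAction G C] (R : Subgroup (MulAut P)) :
    Set (MulAction.orbitRel.Quotient (centralizerIn P) (fixedChambers P C)) :=
  {x | ∀ (n : Subgroup.normalizer (P : Set G)) (c : fixedChambers P C),
    P.normalizerMonoidHom n ∈ R → Quotient.mk _ c = x → Quotient.mk _ (n • c) = x}

/-- The chamber system `(C^P / C_G(P))^R`. -/
def fixedQuotientFixed (X : ChamberSystem I C) (hX : X.IsInvariant G) (P : Subgroup G)
    (R : Subgroup (MulAut P)) : ChamberSystem I (fixedOrbits P C R) :=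
  (X.fixedQuotient hX P).induce (fixedOrbits P C R)

end ChamberSystem

theorem GroupDiagram.Completion.range_le {I : Type*} {A : GroupDiagram I} {G : Type*} [Group G]
    (Φ : A.Completion G) (i : I) : Φ.φB.range ≤ (Φ.φ₁ i).range := by
  rw [← Φ.comm₁ i]
  rintro _ ⟨b, rfl⟩
  exact ⟨A.τ₁ i b, rfl⟩

/-- The chamber system of a completion. -/
def GroupDiagram.Completion.chamberSystem {I : Type*} {A : GroupDiagram I} {G : Type*} [Group G]
    (Φ : A.Completion G) : ChamberSystem I (G ⧸ Φ.φB.range) :=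
  cosetSystem Φ.φB.range (fun i => (Φ.φ₁ i).range) Φ.range_le

theorem GroupDiagram.Completion.chamberSystem_invariant {I : Type*} {A : GroupDiagram I}
    {G : Type*} [Group G] (Φ : A.Completion G) : Φ.chamberSystem.IsInvariant G :=
  cosetSystem_invariant _ _ _

/-! Since `G` may be infinite, everything is read off from fixed chambers. The stabilizer of `gB` is
`gBg⁻¹`, and `S` is the unique Sylow `p`-subgroup of `B`, so a finite `p`-subgroup fixing `gB` lies
in `gSg⁻¹`. Non-emptiness of `𝒞^P` is therefore Sylow's theorem for `S` in `G`. The equality `F =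
F_S(G)` comes from galleries: `F ≤ F_S(G)` because the `F_i` generate `F`, and conversely a gallery
in `𝒞^P` from `B` to `g⁻¹B` writes conjugation by `g` on `P` as a composite of morphisms from
`N_F(S)` and the `F_i` (`ofGroup_le`).

Saturation is reduced to a Sylow property of every finite `p`-subgroup `P`, called `HasSylowLifts`:
`p`-subgroups of `N_G(P)/C_G(P)` lift to finite `p`-subgroups that are maximal up to
`C_G(P)`-conjugacy. Both saturation axioms follow by comparing such a lift with `N_S(P)` or `C_S(P)`
(`isSaturated_ofGroup`).

If every finite `p`-subgroup of `C_G(P)` lies in `P`, then `P` is, up to conjugacy, an `F`-centric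
subgroup of `S`, and hypothesis (b) applies. A chamber of `(𝒞^P/C_G(P))^R` has a stabilizer
containing a lift of `R`, and adjacent chambers have stabilizers in a common finite conjugate of
some `G_i`, where the ordinary Sylow theorem makes the lifts conjugate
(`hasSylowLifts_of_fixedQuotientFixed`).

The other `P` are handled by descending induction on `|P|`. For a maximal finite `p`-subgroup `U` of
`N_G(P)`, the group `T = P C_U(P)` is larger than `P` for a suitable `U` and is unique up to
`C_G(P)`-conjugacy (`exists_conj_centralizer`); a Frattini argument then carries the lifts of `T` to
`P`. Uniqueness is proved by enlarging intersections of maximal subgroups and by walking along a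
gallery in `𝒞^P`. Crossing a panel works because `O_p(G_i)`, suitably conjugated, cannot lie in `P`
(`not_le_of_not_selfCentralizing`), so both sides share more than `P`. -/

/-! ## Finite `p`-subgroups and conjugation -/

section ConjBy

variable {G : Type*} [Group G]

/-- The conjugate `g H g⁻¹` of a subgroup. -/
def conjBy (g : G) (H : Subgroup G) : Subgroup G :=
  H.map (MulAut.conj g).toMonoidHom

theorem mem_conjBy {g x : G} {H : Subgroup G} : x ∈ conjBy g H ↔ g⁻¹ * x * g ∈ H := by
  constructor
  · rintro ⟨y, hy, rfl⟩
    have : g⁻¹ * (g * y * g⁻¹) * g = y := by group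
    simpa [MulAut.conj_apply, this] using hy
  · intro h
    exact ⟨_, h, by simp [MulAut.conj_apply, mul_assoc]⟩

theorem conj_mem_conjBy {g x : G} {H : Subgroup G} (hx : x ∈ H) : g * x * g⁻¹ ∈ conjBy g H :=
  ⟨x, hx, rfl⟩

theorem conjBy_mul (g h : G) (H : Subgroup G) : conjBy (g * h) H = conjBy g (conjBy h H) := by
  ext x
  simp only [mem_conjBy, mul_inv_rev, mul_assoc]

theorem conjBy_one (H : Subgroup G) : conjBy 1 H = H := by
  ext x
  simp [mem_conjBy]

theorem conjBy_inv_conjBy (g : G) (H : Subgroup G) : conjBy g⁻¹ (conjBy g H) = H := by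
  rw [← conjBy_mul, inv_mul_cancel, conjBy_one]

theorem conjBy_conjBy_inv (g : G) (H : Subgroup G) : conjBy g (conjBy g⁻¹ H) = H := by
  rw [← conjBy_mul, mul_inv_cancel, conjBy_one]

theorem conjBy_mono (g : G) {H K : Subgroup G} (h : H ≤ K) : conjBy g H ≤ conjBy g K :=
  Subgroup.map_mono h

theorem conjBy_le_iff {g : G} {H K : Subgroup G} : conjBy g H ≤ K ↔ H ≤ conjBy g⁻¹ K := by
  constructor
  · intro h
    simpa only [conjBy_inv_conjBy] using conjBy_mono g⁻¹ h
  · intro h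
    simpa only [conjBy_conjBy_inv] using conjBy_mono g h

theorem conjBy_le_conjBy {g : G} {H K : Subgroup G} : conjBy g H ≤ conjBy g K ↔ H ≤ K := by
  rw [conjBy_le_iff, conjBy_inv_conjBy]

theorem conjBy_inf (g : G) (H K : Subgroup G) :
    conjBy g (H ⊓ K) = conjBy g H ⊓ conjBy g K := by
  ext x
  simp only [mem_conjBy, Subgroup.mem_inf]

theorem conjBy_sup (g : G) (H K : Subgroup G) :
    conjBy g (H ⊔ K) = conjBy g H ⊔ conjBy g K :=
  Subgroup.map_sup _ _ _

theorem mem_normalizer_iff_conjBy {g : G} {P : Subgroup G} :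
    g ∈ Subgroup.normalizer (P : Set G) ↔ conjBy g P = P :=
  Subgroup.mem_normalizer_iff_map_conj_eq

theorem conjBy_normalizer (g : G) (P : Subgroup G) :
    conjBy g (Subgroup.normalizer (P : Set G)) =
      Subgroup.normalizer ((conjBy g P : Subgroup G) : Set G) := by
  ext x
  rw [mem_conjBy, mem_normalizer_iff_conjBy, mem_normalizer_iff_conjBy, conjBy_mul, conjBy_mul]
  constructor
  · intro h
    simpa only [conjBy_conjBy_inv] using congrArg (conjBy g) h
  · intro h
    rw [h, conjBy_inv_conjBy]

theorem conjBy_centralizer (g : G) (P : Subgroup G) :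
    conjBy g (Subgroup.centralizer (P : Set G)) =
      Subgroup.centralizer ((conjBy g P : Subgroup G) : Set G) := by
  ext x
  rw [mem_conjBy, Subgroup.mem_centralizer_iff, Subgroup.mem_centralizer_iff]
  constructor
  · intro h y hy
    have h1 := h _ (mem_conjBy.1 hy)
    have h2 : g * (g⁻¹ * y * g * (g⁻¹ * x * g)) * g⁻¹ =
        g * (g⁻¹ * x * g * (g⁻¹ * y * g)) * g⁻¹ := by rw [h1]
    simpa [mul_assoc] using h2
  · intro h y hy
    have h1 := h _ (conj_mem_conjBy hy)
    have h2 : g⁻¹ * (g * y * g⁻¹ * x) * g = g⁻¹ * (x * (g * y * g⁻¹)) * g := by rw [h1]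
    simpa [mul_assoc] using h2

theorem conjBy_eq_self_of_mem {g : G} {H : Subgroup G} (hg : g ∈ H) : conjBy g H = H :=
  mem_normalizer_iff_conjBy.1 (Subgroup.le_normalizer hg)

theorem conjBy_eq_self_of_mem_centralizer {g : G} {H : Subgroup G}
    (hg : g ∈ Subgroup.centralizer (H : Set G)) : conjBy g H = H :=
  mem_normalizer_iff_conjBy.1 (Subgroup.centralizer_le_normalizer _ hg)

theorem card_conjBy (g : G) (H : Subgroup G) : Nat.card (conjBy g H) = Nat.card H :=
  (Nat.card_congr (H.equivMapOfInjective _ (MulAut.conj g).injective).toEquiv).symm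

theorem finite_conjBy (g : G) {H : Subgroup G} (h : Finite H) : Finite (conjBy g H) :=
  Finite.of_equiv _ (H.equivMapOfInjective _ (MulAut.conj g).injective).toEquiv

theorem lt_sup_of_not_le {V K : Subgroup G} (h : ¬ K ≤ V) : V < V ⊔ K :=
  lt_of_le_of_ne le_sup_left fun h' => h (h' ▸ le_sup_right)

theorem exists_mul_of_mem_sup {V K : Subgroup G}
    (h : K ≤ Subgroup.normalizer (V : Set G)) {x : G} (hx : x ∈ V ⊔ K) :
    ∃ v ∈ V, ∃ k ∈ K, v * k = x := by
  rw [← SetLike.mem_coe, Subgroup.coe_mul_of_right_le_normalizer_left V K h] at hx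
  exact hx

end ConjBy

/-- `U` is a finite `p`-subgroup. -/
structure FinP (p : ℕ) {G : Type*} [Group G] (U : Subgroup G) : Prop where
  fin : Finite U
  pgrp : IsPGroup p U

/-! ### Finite `p`-group theory and Sylow's theorem inside a possibly infinite group. -/

namespace FinP

variable {p : ℕ} {G : Type*} [Group G] {U V : Subgroup G}

theorem mono (hU : FinP p U) (h : V ≤ U) : FinP p V :=
  haveI := hU.fin
  ⟨Finite.of_injective _ (Subgroup.inclusion_injective h), hU.pgrp.to_le h⟩

theorem conj (hU : FinP p U) (g : G) : FinP p (conjBy g U) :=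
  ⟨finite_conjBy g hU.fin, hU.pgrp.map _⟩

theorem sup (hU : FinP p U) (hV : FinP p V) (h : V ≤ Subgroup.normalizer (U : Set G)) :
    FinP p (U ⊔ V) := by
  refine ⟨?_, hU.pgrp.to_sup_of_normal_left' hV.pgrp h⟩
  have := hU.fin
  have := hV.fin
  have h1 : ((U ⊔ V : Subgroup G) : Set G).Finite := by
    rw [Subgroup.coe_mul_of_right_le_normalizer_left U V h]
    exact (Set.toFinite _).mul (Set.toFinite _)
  exact h1.to_subtype

theorem eq_of_le_of_card_le (hU : FinP p U) (h : V ≤ U) (hc : Nat.card U ≤ Nat.card V) :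
    V = U :=
  haveI := hU.fin
  Subgroup.eq_of_le_of_card_ge h hc

theorem card_le (hU : FinP p U) (h : V ≤ U) : Nat.card V ≤ Nat.card U :=
  haveI := hU.fin
  Nat.card_le_card_of_injective _ (Subgroup.inclusion_injective h)

theorem card_lt (hU : FinP p U) (h : V < U) : Nat.card V < Nat.card U := by
  by_contra h'
  exact h.ne (hU.eq_of_le_of_card_le h.le (not_lt.1 h'))

/-- Normalizers grow in finite `p`-groups. -/
theorem lt_normalizer [Fact p.Prime] (hU : FinP p U) (h : V < U) :
    V < U ⊓ Subgroup.normalizer (V : Set G) := by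
  have := hU.fin
  have : Group.IsNilpotent U := hU.pgrp.isNilpotent
  have h1 : V.subgroupOf U < ⊤ := by
    rw [lt_top_iff_ne_top, Ne, Subgroup.subgroupOf_eq_top]
    exact h.not_ge
  have h2 := Group.normalizerCondition_of_isNilpotent (V.subgroupOf U) h1
  obtain ⟨x, hx, hxV⟩ := SetLike.exists_of_lt h2
  refine lt_of_le_of_ne (le_inf h.le Subgroup.le_normalizer) fun h3 => hxV ?_
  rw [Subgroup.mem_subgroupOf]
  rw [h3]
  refine ⟨x.2, ?_⟩
  rw [SetLike.mem_coe, Subgroup.mem_normalizer_iff] at *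
  intro y
  constructor
  · intro hy
    exact (hx ⟨y, h.le hy⟩).1 hy
  · intro hy
    have hyU : y ∈ U := by
      have := mul_mem (mul_mem (inv_mem x.2) (h.le hy)) x.2
      simpa [mul_assoc] using this
    exact (hx ⟨y, hyU⟩).2 hy

/-- If `U` is a finite `p`-subgroup containing `V` and `K ≤ U` is normalized by `V` but not
contained in it, then some element of `K` outside `V` normalizes `V`. -/
theorem exists_mem_normalizer [Fact p.Prime] (hU : FinP p U) {K : Subgroup G} (hV : V ≤ U)
    (hK : K ≤ U) (hn : V ≤ Subgroup.normalizer (K : Set G)) (h : ¬ K ≤ V) :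
    ∃ x ∈ K, x ∉ V ∧ x ∈ Subgroup.normalizer (V : Set G) := by
  have h1 := (hU.mono (sup_le hV hK)).lt_normalizer (lt_sup_of_not_le h)
  obtain ⟨x, ⟨hx, hxn⟩, hxV⟩ := SetLike.exists_of_lt h1
  rw [SetLike.mem_coe, sup_comm] at hx
  obtain ⟨k, hk, v, hv, rfl⟩ := exists_mul_of_mem_sup hn hx
  refine ⟨k, hk, fun h2 => hxV (mul_mem h2 hv), ?_⟩
  exact (Subgroup.mul_mem_cancel_right _ (Subgroup.le_normalizer hv)).1 hxn

/-- Sylow's theorem in a finite subgroup of a group. -/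
theorem exists_conj_of_finite [Fact p.Prime] (hU : FinP p U) (hV : FinP p V) {X : Subgroup G}
    (hX : Finite X) (hUX : U ≤ X) (hVX : V ≤ X) :
    ∃ x ∈ X, ∃ Y ≤ X, FinP p Y ∧ U ≤ Y ∧ conjBy x V ≤ Y := by
  have hU' : IsPGroup p (U.subgroupOf X) :=
    hU.pgrp.of_equiv (Subgroup.subgroupOfEquivOfLe hUX).symm
  have hV' : IsPGroup p (V.subgroupOf X) :=
    hV.pgrp.of_equiv (Subgroup.subgroupOfEquivOfLe hVX).symm
  obtain ⟨A, hA⟩ := hU'.exists_le_sylow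
  obtain ⟨A', hA'⟩ := hV'.exists_le_sylow
  obtain ⟨x, hx⟩ := MulAction.exists_smul_eq X A' A
  refine ⟨x, x.2, (A : Subgroup X).map X.subtype, ?_, ⟨?_, A.2.map _⟩, ?_, ?_⟩
  · rintro _ ⟨y, -, rfl⟩
    exact y.2
  · exact Finite.of_equiv _
      ((A : Subgroup X).equivMapOfInjective _ X.subtype_injective).toEquiv
  · intro u hu
    exact ⟨⟨u, hUX hu⟩, hA hu, rfl⟩
  · rintro _ ⟨v, hv, rfl⟩
    refine ⟨x * ⟨v, hVX hv⟩ * x⁻¹, ?_, rfl⟩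
    rw [← hx]
    have h1 : (⟨v, hVX hv⟩ : X) ∈ (A' : Subgroup X) := hA' hv
    exact Subgroup.smul_mem_pointwise_smul _ (MulAut.conj x) _ h1

/-- A Sylow `p`-subgroup of a finite group maps onto every quotient that is a `p`-group. -/
theorem exists_mul_of_sylow [Fact p.Prime] {A : Type*} [Group A] [Finite A] (D : Sylow p A)
    (K : Subgroup A) [K.Normal] (hK : ∀ a : A, ∃ n : ℕ, a ^ p ^ n ∈ K) (a : A) :
    ∃ d ∈ D, d⁻¹ * a ∈ K := by
  have h1 : IsPGroup p (A ⧸ K) := by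
    intro x
    obtain ⟨b, rfl⟩ := QuotientGroup.mk_surjective x
    obtain ⟨n, hn⟩ := hK b
    exact ⟨n, by rw [← QuotientGroup.mk_pow, QuotientGroup.eq_one_iff]; exact hn⟩
  -- The index of `DK` divides `|A/K|`, a power of `p`, and also the index of `D`, which is prime to
  -- `p`.
  have h3 : ((D : Subgroup A) ⊔ K).index = 1 := by
    obtain ⟨n, hn⟩ := IsPGroup.iff_card.1 h1
    have h4 : ((D : Subgroup A) ⊔ K).index ∣ p ^ n := by
      rw [← hn]
      exact Subgroup.index_dvd_of_le le_sup_right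
    have h5 : ((D : Subgroup A) ⊔ K).index ∣ (D : Subgroup A).index :=
      Subgroup.index_dvd_of_le le_sup_left
    obtain ⟨m, -, hm⟩ := (Nat.dvd_prime_pow (Fact.out : p.Prime)).1 h4
    rcases Nat.eq_zero_or_pos m with rfl | hm0
    · simpa using hm
    · exact absurd ((dvd_pow_self p hm0.ne').trans (hm ▸ h5)) D.not_dvd_index
  rw [Subgroup.index_eq_one] at h3
  have ha : a ∈ (D : Subgroup A) ⊔ K := h3 ▸ Subgroup.mem_top a
  obtain ⟨d, hd, k, hk, rfl⟩ := Subgroup.mem_sup_of_normal_right.1 ha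
  exact ⟨d, hd, by simpa using hk⟩

end FinP

/-! ## Lifting `p`-subgroups of automizers -/

section Lifts

variable {G : Type*} [Group G]

/-- For every subgroup `H / C_G(P)` of `N_G(P) / C_G(P)` that is a `p`-group, there is a finite
`p`-subgroup `W` of `H` that maps onto `H / C_G(P)` and contains a `C_G(P)`-conjugate of every finite
`p`-subgroup of `H`. -/
def HasSylowLifts (p : ℕ) (P : Subgroup G) : Prop :=
  ∀ H : Subgroup G, Subgroup.centralizer (P : Set G) ≤ H →
    H ≤ Subgroup.normalizer (P : Set G) →
    (∀ h ∈ H, ∃ n : ℕ, h ^ p ^ n ∈ Subgroup.centralizer (P : Set G)) →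
    ∃ W ≤ H, FinP p W ∧ (∀ h ∈ H, ∃ w ∈ W, w⁻¹ * h ∈ Subgroup.centralizer (P : Set G)) ∧
      ∀ U ≤ H, FinP p U → ∃ c ∈ Subgroup.centralizer (P : Set G), conjBy c U ≤ W

theorem HasSylowLifts.conj {p : ℕ} {P : Subgroup G} (h : HasSylowLifts p P) (g : G) :
    HasSylowLifts p (conjBy g P) := by
  intro H hC hN hp
  have hmem : ∀ {x : G}, x ∈ Subgroup.centralizer (P : Set G) ↔
      g * x * g⁻¹ ∈ Subgroup.centralizer ((conjBy g P : Subgroup G) : Set G) := by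
    intro x
    rw [← conjBy_centralizer, mem_conjBy]
    simp [mul_assoc]
  rw [← conjBy_centralizer] at hC
  rw [← conjBy_normalizer] at hN
  have hC' := conjBy_mono g⁻¹ hC
  have hN' := conjBy_mono g⁻¹ hN
  rw [conjBy_inv_conjBy] at hC' hN'
  obtain ⟨W, hWH, hW, hs, hconj⟩ := h (conjBy g⁻¹ H) hC' hN' (by
    intro x hx
    rw [mem_conjBy, inv_inv] at hx
    obtain ⟨n, hn⟩ := hp _ hx
    refine ⟨n, hmem.2 ?_⟩
    rwa [conj_pow] at hn)
  refine ⟨conjBy g W, ?_, hW.conj g, ?_, ?_⟩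
  · rwa [conjBy_le_iff]
  · intro x hx
    obtain ⟨w, hw, hwx⟩ := hs (g⁻¹ * x * g) (by
      rw [mem_conjBy, inv_inv]
      simpa [mul_assoc] using hx)
    refine ⟨g * w * g⁻¹, conj_mem_conjBy hw, ?_⟩
    have := hmem.1 hwx
    simpa [mul_assoc] using this
  · intro U hU hUp
    obtain ⟨c, hc, hcU⟩ := hconj (conjBy g⁻¹ U) (conjBy_mono _ hU) (hUp.conj _)
    refine ⟨g * c * g⁻¹, hmem.1 hc, ?_⟩
    rw [conjBy_mul, conjBy_mul]
    exact conjBy_mono g hcU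

/-- The Sylow theorems hold for `C_G(R) ≤ H ≤ N_G(R)` if `R` has Sylow lifts. -/
theorem HasSylowLifts.exists_sylow {p : ℕ} [Fact p.Prime] {R : Subgroup G}
    (hR : HasSylowLifts p R) [Finite R] {H : Subgroup G}
    (hC : Subgroup.centralizer (R : Set G) ≤ H) (hN : H ≤ Subgroup.normalizer (R : Set G)) :
    ∃ Y ≤ H, FinP p Y ∧ (∀ U ≤ H, FinP p U → ∃ h ∈ H, conjBy h U ≤ Y) ∧
      ∀ K : Subgroup G, Subgroup.centralizer (R : Set G) ≤ K → K ≤ H →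
        H ≤ Subgroup.normalizer (K : Set G) → (∀ h ∈ H, ∃ n : ℕ, h ^ p ^ n ∈ K) →
        ∀ h ∈ H, ∃ y ∈ Y, y⁻¹ * h ∈ K := by
  have : Finite (MulAut R) :=
    Finite.of_injective (fun e : MulAut R => (e : R → R)) DFunLike.coe_injective
  let f : H →* MulAut R := R.normalizerMonoidHom.comp (Subgroup.inclusion hN)
  have hker : ∀ x : H, f.rangeRestrict x = 1 ↔ (x : G) ∈ Subgroup.centralizer (R : Set G) := by
    intro x
    have h1 : f.rangeRestrict x = 1 ↔ Subgroup.inclusion hN x ∈ R.normalizerMonoidHom.ker := by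
      rw [MonoidHom.mem_ker, Subtype.ext_iff]
      rfl
    rw [h1, Subgroup.normalizerMonoidHom_ker, Subgroup.mem_subgroupOf]
    rfl
  have hsurj := f.rangeRestrict_surjective
  obtain ⟨D⟩ : Nonempty (Sylow p f.range) := inferInstance
  -- `H` need not induce a `p`-group on `R`, so the lifting property is applied to the preimage of a
  -- Sylow subgroup of the finite group it induces.
  let E : Subgroup G := ((D : Subgroup f.range).comap f.rangeRestrict).map H.subtype
  have hE : ∀ x : H, (x : G) ∈ E ↔ f.rangeRestrict x ∈ D := by
    intro x
    constructor
    · rintro ⟨y, hy, hyx⟩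
      have : y = x := Subtype.ext hyx
      rw [← this]
      exact hy
    · intro hx
      exact ⟨x, hx, rfl⟩
  have hEH : E ≤ H := by
    rintro _ ⟨y, -, rfl⟩
    exact y.2
  obtain ⟨W, hWE, hW, hs, hconj⟩ := hR E (by
      intro x hx
      rw [hE ⟨x, hC hx⟩, (hker _).2 hx]
      exact one_mem _) (hEH.trans hN) (by
      intro x hx
      obtain ⟨n, hn⟩ := D.2 ⟨_, (hE ⟨x, hEH hx⟩).1 hx⟩
      refine ⟨n, (hker (⟨x, hEH hx⟩ ^ p ^ n)).1 ?_⟩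
      rw [map_pow]
      exact congrArg Subtype.val hn)
  refine ⟨W, hWE.trans hEH, hW, ?_, ?_⟩
  · intro U hUH hU
    have hU' : IsPGroup p ((U.subgroupOf H).map f.rangeRestrict) :=
      (hU.pgrp.of_equiv (Subgroup.subgroupOfEquivOfLe hUH).symm).map _
    obtain ⟨D', hD'⟩ := hU'.exists_le_sylow
    -- Sylow's theorem in the finite image moves `U` into `E`; the lifting property then moves it
    -- into `W`.
    obtain ⟨a, ha⟩ := MulAction.exists_smul_eq f.range D' D
    obtain ⟨h, rfl⟩ := hsurj a
    obtain ⟨c, hc, hcU⟩ := hconj (conjBy (h : G) U) (by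
      rintro _ ⟨u, hu, rfl⟩
      refine (hE (h * ⟨u, hUH hu⟩ * h⁻¹)).2 ?_
      rw [map_mul, map_mul, map_inv, ← ha]
      have h1 : f.rangeRestrict ⟨u, hUH hu⟩ ∈ (D' : Subgroup f.range) := hD' ⟨_, hu, rfl⟩
      exact Subgroup.smul_mem_pointwise_smul _ (MulAut.conj _) _ h1) (hU.conj _)
    exact ⟨c * h, mul_mem (hC hc) h.2, by rwa [conjBy_mul]⟩
  · intro K hCK hKH hHK hp h hh
    let K' : Subgroup f.range := (K.subgroupOf H).map f.rangeRestrict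
    have hK' : ∀ x : H, f.rangeRestrict x ∈ K' → (x : G) ∈ K := by
      rintro x ⟨k, hk, hkx⟩
      have h1 : f.rangeRestrict (k⁻¹ * x) = 1 := by
        rw [map_mul, map_inv, hkx, inv_mul_cancel]
      have h2 := hCK ((hker _).1 h1)
      have h3 := mul_mem (show (k : G) ∈ K from hk) h2
      simpa using h3
    have hKn : (K.subgroupOf H).Normal := by
      refine ⟨fun k hk x => ?_⟩
      exact (Subgroup.mem_normalizer_iff.1 (hHK x.2) k).1 hk
    have : K'.Normal := hKn.map _ hsurj
    obtain ⟨d, hd, hdk⟩ := FinP.exists_mul_of_sylow D K' (by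
      intro a
      obtain ⟨x, rfl⟩ := hsurj a
      obtain ⟨n, hn⟩ := hp x x.2
      exact ⟨n, by rw [← map_pow]; exact ⟨_, hn, rfl⟩⟩) (f.rangeRestrict ⟨h, hh⟩)
    obtain ⟨x, rfl⟩ := hsurj d
    obtain ⟨w, hw, hwx⟩ := hs x ((hE x).2 hd)
    refine ⟨w, hw, hK' (⟨w, hEH (hWE hw)⟩⁻¹ * ⟨h, hh⟩) ?_⟩
    have h1 : f.rangeRestrict (⟨w, hEH (hWE hw)⟩⁻¹ * x) = 1 := (hker _).2 hwx
    rw [map_mul, map_inv, inv_mul_eq_one] at h1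
    rw [map_mul, map_inv, h1]
    exact hdk

/-- Both subgroups are conjugated into one `Y`, and conjugating back by the first conjugator returns
`U` to its place. -/
theorem HasSylowLifts.exists_conj {p : ℕ} [Fact p.Prime] {R : Subgroup G}
    (hR : HasSylowLifts p R) [Finite R] {H : Subgroup G}
    (hC : Subgroup.centralizer (R : Set G) ≤ H) (hN : H ≤ Subgroup.normalizer (R : Set G))
    {U V : Subgroup G} (hUH : U ≤ H) (hU : FinP p U) (hVH : V ≤ H) (hV : FinP p V) :
    ∃ h ∈ H, ∃ Y ≤ H, FinP p Y ∧ U ≤ Y ∧ conjBy h V ≤ Y := by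
  obtain ⟨Y, hYH, hY, hconj, -⟩ := hR.exists_sylow hC hN
  obtain ⟨g, hg, hgU⟩ := hconj U hUH hU
  obtain ⟨k, hk, hkV⟩ := hconj V hVH hV
  refine ⟨g⁻¹ * k, mul_mem (inv_mem hg) hk, conjBy g⁻¹ Y, ?_, hY.conj _, ?_, ?_⟩
  · rw [← conjBy_eq_self_of_mem (inv_mem hg)]
    exact conjBy_mono _ hYH
  · rwa [← conjBy_le_iff]
  · rw [conjBy_mul]
    exact conjBy_mono _ hkV

/-- Every finite `p`-subgroup of `C_G(P)` is contained in `P`. -/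
def SelfCentralizing (p : ℕ) (P : Subgroup G) : Prop :=
  ∀ U ≤ Subgroup.centralizer (P : Set G), FinP p U → U ≤ P

end Lifts

/-! ## Maximal finite `p`-subgroups of normalizers -/

section Panels

variable {G : Type*} [Group G] {p : ℕ}

theorem normalizer_le_normalizer_centralizer (P : Subgroup G) :
    Subgroup.normalizer (P : Set G) ≤
      Subgroup.normalizer ((Subgroup.centralizer (P : Set G) : Subgroup G) : Set G) := by
  intro g hg
  rw [mem_normalizer_iff_conjBy] at hg ⊢
  rw [conjBy_centralizer, hg]

theorem inf_normalizer_le_normalizer_inf (A B : Subgroup G) :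
    Subgroup.normalizer (A : Set G) ⊓ Subgroup.normalizer (B : Set G) ≤
      Subgroup.normalizer ((A ⊓ B : Subgroup G) : Set G) := by
  intro g hg
  rw [Subgroup.mem_inf, mem_normalizer_iff_conjBy, mem_normalizer_iff_conjBy] at hg
  obtain ⟨hA, hB⟩ := hg
  rw [mem_normalizer_iff_conjBy, conjBy_inf, hA, hB]

/-- `T` and `T'` are contained in a common finite subgroup `X` with a normal subgroup
`Q ≤ T ∩ T'` such that `C_X(Q) ≤ Q`. -/
def CoPanel (T T' : Subgroup G) : Prop :=
  ∃ X Q : Subgroup G, Finite X ∧ T ≤ X ∧ T' ≤ X ∧ X ≤ Subgroup.normalizer (Q : Set G) ∧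
    Q ≤ T ∧ Q ≤ T' ∧ Subgroup.centralizer (Q : Set G) ⊓ X ≤ Q

/-- Every finite `p`-subgroup `P` is contained in a conjugate of `S`, and the conjugates of `S` that
contain `P` are connected through panels. -/
structure IsSylowConnected (p : ℕ) (S : Subgroup G) : Prop where
  finP : FinP p S
  sylow : ∀ P : Subgroup G, FinP p P → ∃ g, P ≤ conjBy g S
  connected : ∀ P : Subgroup G, FinP p P → ∀ g h : G, P ≤ conjBy g S → P ≤ conjBy h S →
    Relation.ReflTransGen
      (fun T T' => P ≤ T ∧ P ≤ T' ∧ (∃ k, T = conjBy k S) ∧ (∃ k, T' = conjBy k S) ∧ CoPanel T T')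
      (conjBy g S) (conjBy h S)

/-- `M` is a maximal finite `p`-subgroup of `N`. -/
structure MaxFinP (p : ℕ) (N M : Subgroup G) : Prop where
  le : M ≤ N
  finP : FinP p M
  eq_of_le : ∀ V ≤ N, FinP p V → M ≤ V → V = M

theorem MaxFinP.conj {N M : Subgroup G} (h : MaxFinP p N M) {n : G} (hn : n ∈ N) :
    MaxFinP p N (conjBy n M) := by
  refine ⟨?_, h.finP.conj n, fun V hV hVp hMV => ?_⟩
  · rw [← conjBy_eq_self_of_mem hn]
    exact conjBy_mono n h.le
  · rw [conjBy_le_iff] at hMV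
    have h1 := h.eq_of_le (conjBy n⁻¹ V) (by
      rw [← conjBy_eq_self_of_mem (inv_mem hn)]
      exact conjBy_mono _ hV) (hVp.conj _) hMV
    rw [← h1, conjBy_conjBy_inv]

/-- `PM` is again a finite `p`-subgroup of `N_G(P)`, so maximality absorbs `P`. -/
theorem MaxFinP.le_of_normal {P M : Subgroup G} (hP : FinP p P)
    (h : MaxFinP p (Subgroup.normalizer (P : Set G)) M) : P ≤ M := by
  rw [← h.eq_of_le (P ⊔ M) (sup_le Subgroup.le_normalizer h.le) (hP.sup h.finP h.le) le_sup_right]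
  exact le_sup_left

/-! ### Conjugacy of maximal finite `p`-subgroups of `N_G(P)`, and descent to non-centric `P`. -/

namespace IsSylowConnected

variable {S : Subgroup G}

theorem card_le (hS : IsSylowConnected p S) {U : Subgroup G} (hU : FinP p U) :
    Nat.card U ≤ Nat.card S := by
  obtain ⟨g, hg⟩ := hS.sylow U hU
  rw [← card_conjBy g S]
  exact (hS.finP.conj g).card_le hg

/-- Orders of finite `p`-subgroups are bounded by `|S|`, so ascending chains stop even though `N`
may be infinite. -/
theorem exists_maxFinP (hS : IsSylowConnected p S) {N U : Subgroup G} (hUN : U ≤ N)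
    (hU : FinP p U) : ∃ M, U ≤ M ∧ MaxFinP p N M := by
  induction hk : Nat.card S - Nat.card U using Nat.strong_induction_on generalizing U with
  | _ k ih =>
    by_cases h : ∃ V ≤ N, FinP p V ∧ U < V
    · obtain ⟨V, hVN, hV, hUV⟩ := h
      have h1 := hV.card_lt hUV
      have h2 := hS.card_le hV
      obtain ⟨M, hVM, hM⟩ := ih _ (by omega) hVN hV rfl
      exact ⟨M, hUV.le.trans hVM, hM⟩
    · push Not at h
      refine ⟨U, le_rfl, hUN, hU, fun V hVN hV hUV => ?_⟩
      by_contra hne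
      exact h V hVN hV (lt_of_le_of_ne hUV (Ne.symm hne))

/-- To relate two maximal finite `p`-subgroups of `N_G(P)` that intersect in more than `P`, it
suffices to enlarge the intersection by passing to related subgroups. -/
theorem rel_of_lt_inf (hS : IsSylowConnected p S) {P : Subgroup G} (hP : FinP p P)
    {E : Subgroup G → Subgroup G → Prop} (hE : Equivalence E)
    (hstep : ∀ U U', MaxFinP p (Subgroup.normalizer (P : Set G)) U →
      MaxFinP p (Subgroup.normalizer (P : Set G)) U' → P < U ⊓ U' → U ⊓ U' < U → U ⊓ U' < U' →
      E U U' ∨ ∃ U₁ U₂, MaxFinP p (Subgroup.normalizer (P : Set G)) U₁ ∧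
        MaxFinP p (Subgroup.normalizer (P : Set G)) U₂ ∧ E U' U₁ ∧
        U ⊓ U' < U ⊓ U₂ ∧ Nat.card (U ⊓ U' : Subgroup G) < Nat.card (U₁ ⊓ U₂ : Subgroup G))
    {U U' : Subgroup G} (hU : MaxFinP p (Subgroup.normalizer (P : Set G)) U)
    (hU' : MaxFinP p (Subgroup.normalizer (P : Set G)) U') (h : P < U ⊓ U') : E U U' := by
  induction hk : Nat.card S - Nat.card (U ⊓ U' : Subgroup G) using Nat.strong_induction_on
    generalizing U U' with
  | _ k ih =>
    rcases (inf_le_left : U ⊓ U' ≤ U).eq_or_lt with h1 | h1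
    · rw [hU.eq_of_le U' hU'.le hU'.finP (inf_eq_left.1 h1)]
      exact hE.refl _
    rcases (inf_le_right : U ⊓ U' ≤ U').eq_or_lt with h2 | h2
    · rw [hU'.eq_of_le U hU.le hU.finP (inf_eq_right.1 h2)]
      exact hE.refl _
    rcases hstep U U' hU hU' h h1 h2 with h3 | ⟨U₁, U₂, hU₁, hU₂, h3, h4, h5⟩
    · exact h3
    have hcP := (hU.finP.mono inf_le_left).card_lt h
    have h6 := (hU.finP.mono inf_le_left).card_lt h4
    have h7 := hS.card_le (hU.finP.mono (inf_le_left : U ⊓ U₂ ≤ U))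
    have h8 := hS.card_le (hU₁.finP.mono (inf_le_left : U₁ ⊓ U₂ ≤ U₁))
    have h9 : P < U₁ ⊓ U₂ := by
      refine lt_of_le_of_ne (le_inf (hU₁.le_of_normal hP) (hU₂.le_of_normal hP)) fun h' => ?_
      rw [← h'] at h5
      omega
    -- Both new pairs meet in a subgroup of larger order, so the chain is `U ~ U₂ ~ U₁ ~ U'`.
    have e1 : E U U₂ := ih _ (by omega) hU hU₂ (h.trans h4) rfl
    have e2 : E U₁ U₂ := ih _ (by omega) hU₁ hU₂ h9 rfl
    exact hE.trans e1 (hE.trans (hE.symm e2) (hE.symm h3))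

theorem lt_inf_normalizer [Fact p.Prime] (hS : IsSylowConnected p S) {P T : Subgroup G}
    (hcard : Nat.card P < Nat.card S) (hT : ∃ k, T = conjBy k S) (hPT : P ≤ T) :
    P < T ⊓ Subgroup.normalizer (P : Set G) := by
  obtain ⟨k, rfl⟩ := hT
  refine (hS.finP.conj k).lt_normalizer (lt_of_le_of_ne hPT fun h => ?_)
  rw [h, card_conjBy] at hcard
  exact lt_irrefl _ hcard

/-- Maximal finite `p`-subgroups of `N_G(P)` are related if those that intersect in more than `P`
are, and the relation can be propagated along panels. -/
theorem rel_of_panels [Fact p.Prime] (hS : IsSylowConnected p S) {P : Subgroup G}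
    (hP : FinP p P) (hcard : Nat.card P < Nat.card S)
    {E : Subgroup G → Subgroup G → Prop} (hE : Equivalence E)
    (hinf : ∀ U U', MaxFinP p (Subgroup.normalizer (P : Set G)) U →
      MaxFinP p (Subgroup.normalizer (P : Set G)) U' → P < U ⊓ U' → E U U')
    (hpan : ∀ T T', P ≤ T → P ≤ T' → (∃ k, T = conjBy k S) → (∃ k, T' = conjBy k S) →
      CoPanel T T' → ∃ U U', MaxFinP p (Subgroup.normalizer (P : Set G)) U ∧
        MaxFinP p (Subgroup.normalizer (P : Set G)) U' ∧
        T ⊓ Subgroup.normalizer (P : Set G) ≤ U ∧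
        T' ⊓ Subgroup.normalizer (P : Set G) ≤ U' ∧ E U U')
    {U U' : Subgroup G} (hU : MaxFinP p (Subgroup.normalizer (P : Set G)) U)
    (hU' : MaxFinP p (Subgroup.normalizer (P : Set G)) U') : E U U' := by
  -- By maximality `V` equals `N_T(P)` for some conjugate `T` of `S`, which ties it to a vertex of
  -- the gallery.
  have hsub : ∀ V, MaxFinP p (Subgroup.normalizer (P : Set G)) V → ∃ g, P ≤ conjBy g S ∧
      conjBy g S ⊓ Subgroup.normalizer (P : Set G) ≤ V := by
    intro V hV
    obtain ⟨g, hg⟩ := hS.sylow V hV.finP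
    refine ⟨g, (hV.le_of_normal hP).trans hg, ?_⟩
    rw [hV.eq_of_le (conjBy g S ⊓ Subgroup.normalizer (P : Set G)) inf_le_right
      ((hS.finP.conj g).mono inf_le_left) (le_inf hg hV.le)]
  obtain ⟨g, hPg, hg⟩ := hsub U hU
  obtain ⟨k, hPk, hk⟩ := hsub U' hU'
  have key : ∀ T', Relation.ReflTransGen
      (fun T T' => P ≤ T ∧ P ≤ T' ∧ (∃ k, T = conjBy k S) ∧ (∃ k, T' = conjBy k S) ∧ CoPanel T T')
      (conjBy g S) T' → ∀ V, MaxFinP p (Subgroup.normalizer (P : Set G)) V →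
      T' ⊓ Subgroup.normalizer (P : Set G) ≤ V → E U V := by
    intro T' hT'
    induction hT' with
    | refl =>
      intro V hV hTV
      exact hinf U V hU hV
        ((hS.lt_inf_normalizer hcard ⟨g, rfl⟩ hPg).trans_le (le_inf hg hTV))
    | tail _ h2 ih =>
      intro V hV hTV
      obtain ⟨hPT, hPT', hT, hT', hpn⟩ := h2
      obtain ⟨U₁, U₂, hU₁, hU₂, h3, h4, h5⟩ := hpan _ _ hPT hPT' hT hT' hpn
      exact hE.trans (ih U₁ hU₁ h3) (hE.trans h5 (hinf U₂ V hU₂ hV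
        ((hS.lt_inf_normalizer hcard hT' hPT').trans_le (le_inf h4 hTV))))
  exact key _ (hS.connected P hP g k hPg hPk) U' hU' hk

/-- The Sylow theorem for `N_G(P)`. -/
theorem exists_conj_normalizer [Fact p.Prime] (hS : IsSylowConnected p S) {P : Subgroup G}
    (hP : FinP p P) (hcard : Nat.card P < Nat.card S)
    (hbig : ∀ T : Subgroup G, FinP p T → Nat.card P < Nat.card T → HasSylowLifts p T)
    {U U' : Subgroup G} (hU : MaxFinP p (Subgroup.normalizer (P : Set G)) U)
    (hU' : MaxFinP p (Subgroup.normalizer (P : Set G)) U') :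
    ∃ n ∈ Subgroup.normalizer (P : Set G), conjBy n U = U' := by
  let E : Subgroup G → Subgroup G → Prop :=
    fun U U' => ∃ n ∈ Subgroup.normalizer (P : Set G), conjBy n U = U'
  have hE : Equivalence E := by
    refine ⟨fun U => ⟨1, one_mem _, conjBy_one U⟩, ?_, ?_⟩
    · rintro U _ ⟨n, hn, rfl⟩
      exact ⟨n⁻¹, inv_mem hn, conjBy_inv_conjBy n U⟩
    · rintro U _ _ ⟨n, hn, rfl⟩ ⟨m, hm, rfl⟩
      exact ⟨m * n, mul_mem hm hn, conjBy_mul m n U⟩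
  refine hS.rel_of_panels (E := E) hP hcard hE (fun U U' hU hU' h => ?_) ?_ hU hU'
  · refine hS.rel_of_lt_inf hP hE ?_ hU hU' h
    intro U U' hU hU' hPV hVU hVU'
    right
    have hV : FinP p (U ⊓ U') := hU.finP.mono inf_le_left
    have hVl := hbig _ hV (hV.card_lt hPV)
    generalize hVdef : U ⊓ U' = V at *
    have := hV.fin
    -- As `V` is larger than `P`, the Sylow theorem holds in `N_G(P) ∩ N_G(V)`. It joins `N_U(V)` to
    -- a conjugate of `N_{U'}(V)`, and since normalizers grow both new intersections are larger than
    -- `V`.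
    obtain ⟨h, hh, Y, hYH, hY, hUY, hU'Y⟩ := hVl.exists_conj
      (H := Subgroup.normalizer (P : Set G) ⊓ Subgroup.normalizer (V : Set G))
      (le_inf ((Subgroup.centralizer_le hPV.le).trans (Subgroup.centralizer_le_normalizer _))
        (Subgroup.centralizer_le_normalizer _)) inf_le_right
      (U := U ⊓ Subgroup.normalizer (V : Set G)) (inf_le_inf_right _ hU.le)
      (hU.finP.mono inf_le_left)
      (V := U' ⊓ Subgroup.normalizer (V : Set G)) (inf_le_inf_right _ hU'.le)
      (hU'.finP.mono inf_le_left)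
    obtain ⟨U₂, hYU₂, hU₂⟩ := hS.exists_maxFinP (hYH.trans inf_le_left) hY
    refine ⟨conjBy h U', U₂, hU'.conj hh.1, hU₂, ⟨h, hh.1, rfl⟩, ?_, ?_⟩
    · exact (hU.finP.lt_normalizer hVU).trans_le (le_inf inf_le_left (hUY.trans hYU₂))
    · have h1 := (hU'.finP.mono inf_le_left).card_lt (hU'.finP.lt_normalizer hVU')
      rw [← card_conjBy h (U' ⊓ _)] at h1
      refine h1.trans_le ((hU₂.finP.mono inf_le_right).card_le
        (le_inf (conjBy_mono h inf_le_left) (hU'Y.trans hYU₂)))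
  · rintro T T' hPT hPT' ⟨k, rfl⟩ ⟨k', rfl⟩ ⟨X, Q, hX, hTX, hT'X, -⟩
    have : Finite (X ⊓ Subgroup.normalizer (P : Set G) : Subgroup G) :=
      Finite.of_injective _ (Subgroup.inclusion_injective inf_le_left)
    -- Across a panel the ordinary Sylow theorem in the finite group `N_X(P)` suffices.
    obtain ⟨x, hx, Y, hYX, hY, h1, h2⟩ := FinP.exists_conj_of_finite
      ((hS.finP.conj k).mono inf_le_left) ((hS.finP.conj k').mono inf_le_left) this
      (inf_le_inf_right (Subgroup.normalizer (P : Set G)) hTX)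
      (inf_le_inf_right (Subgroup.normalizer (P : Set G)) hT'X)
    obtain ⟨U, hYU, hU⟩ := hS.exists_maxFinP (hYX.trans inf_le_right) hY
    refine ⟨U, conjBy x⁻¹ U, hU, hU.conj (inv_mem hx.2), h1.trans hYU, ?_,
      x⁻¹, inv_mem hx.2, rfl⟩
    rw [← conjBy_le_iff]
    exact h2.trans hYU

/-- If `Q` is normal in `X` with `C_X(Q) ≤ Q` and `P` is a subgroup of a Sylow `p`-subgroup of `X`
that is not self-centralizing, then `Q` is not contained in `P`. -/
theorem not_le_of_not_selfCentralizing [Fact p.Prime] (hS : IsSylowConnected p S)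
    {P : Subgroup G} (hP : FinP p P) (hcard : Nat.card P < Nat.card S)
    (hbig : ∀ T : Subgroup G, FinP p T → Nat.card P < Nat.card T → HasSylowLifts p T)
    (hnc : ¬ SelfCentralizing p P) {T X Q : Subgroup G} (hT : ∃ k, T = conjBy k S) (hPT : P ≤ T)
    (hTX : T ≤ X) (hXQ : X ≤ Subgroup.normalizer (Q : Set G))
    (hQ : Subgroup.centralizer (Q : Set G) ⊓ X ≤ Q) : ¬ Q ≤ P := by
  intro hQP
  have hTp : FinP p T := by
    obtain ⟨k, rfl⟩ := hT
    exact hS.finP.conj k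
  have hTcard : Nat.card T = Nat.card S := by
    obtain ⟨k, rfl⟩ := hT
    exact card_conjBy k S
  -- Assuming `Q ≤ P`, this descends from `R = T`, where `TY` cannot have order above `|S|`. For
  -- smaller `R`, a bad `Y` yields an element of `C_G(Q)` outside `N_T(R)` that normalizes `N_T(R)`,
  -- refuting the case of the larger group `N_T(R)`.
  have key : ∀ R : Subgroup G, P < R → R ≤ T → ∀ Y : Subgroup G, FinP p Y →
      Y ≤ Subgroup.normalizer (R : Set G) → Y ≤ Subgroup.centralizer (Q : Set G) → Y ≤ R := by
    intro R hPR hRT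
    induction hk : Nat.card S - Nat.card R using Nat.strong_induction_on generalizing R with
    | _ k ih =>
      intro Y hY hYR hYQ
      rcases hRT.eq_or_lt with rfl | hlt
      · have h1 := hTp.sup hY hYR
        have h2 := h1.eq_of_le_of_card_le le_sup_left (hTcard ▸ hS.card_le h1)
        rw [h2]
        exact le_sup_right
      by_contra hYn
      have hR := hTp.mono hRT
      have := hR.fin
      have hR' := hTp.lt_normalizer hlt
      obtain ⟨h, hh, Y', hY'H, hY', hRY', hYY'⟩ :=
        (hbig R hR (hR.card_lt hPR)).exists_conj
          (H := Subgroup.normalizer (R : Set G) ⊓ Subgroup.normalizer (Q : Set G))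
          (le_inf (Subgroup.centralizer_le_normalizer _)
            ((Subgroup.centralizer_le (hQP.trans hPR.le)).trans
              (Subgroup.centralizer_le_normalizer _))) inf_le_left
          (U := T ⊓ Subgroup.normalizer (R : Set G)) (le_inf inf_le_right
            (inf_le_left.trans (hTX.trans hXQ))) (hTp.mono inf_le_left)
          (V := Y) (le_inf hYR (hYQ.trans (Subgroup.centralizer_le_normalizer _))) hY
      have hhR := mem_normalizer_iff_conjBy.1 hh.1
      have hhQ := mem_normalizer_iff_conjBy.1 hh.2
      have h1 : conjBy h Y ≤ Subgroup.centralizer (Q : Set G) := by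
        have h2 := conjBy_mono h hYQ
        rwa [conjBy_centralizer, hhQ] at h2
      -- Otherwise the conjugate of `Y` lies in `T ∩ C_G(Q) ≤ C_X(Q) ≤ Q ≤ R`; as `h` normalizes
      -- `R`, so does `Y` itself.
      have h2 : ¬ Y' ⊓ Subgroup.centralizer (Q : Set G) ≤
          T ⊓ Subgroup.normalizer (R : Set G) := by
        intro h3
        have h4 : conjBy h Y ≤ T := (le_inf hYY' h1).trans (h3.trans inf_le_left)
        have h5 : conjBy h Y ≤ R :=
          (le_inf h1 (h4.trans hTX)).trans (hQ.trans (hQP.trans hPR.le))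
        rw [← hhR, conjBy_le_conjBy] at h5
        exact hYn h5
      obtain ⟨x, hx, hxR, hxn⟩ := hY'.exists_mem_normalizer hRY' inf_le_left
        ((le_inf (hRY'.trans Subgroup.le_normalizer) ((hRY'.trans (hY'H.trans inf_le_right)).trans
          (normalizer_le_normalizer_centralizer Q))).trans
          (inf_normalizer_le_normalizer_inf _ _)) h2
      have h3 := (hTp.mono inf_le_left).card_lt hR'
      have h4 := hS.card_le (hTp.mono
        (inf_le_left : T ⊓ Subgroup.normalizer (R : Set G) ≤ T))
      exact hxR (ih _ (by omega) _ (hPR.trans hR') inf_le_left rfl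
        ((Y' ⊓ Subgroup.centralizer (Q : Set G)) ⊓ Subgroup.normalizer
          ((T ⊓ Subgroup.normalizer (R : Set G) : Subgroup G) : Set G))
        (hY'.mono (inf_le_left.trans inf_le_left)) inf_le_right
        (inf_le_left.trans inf_le_right) ⟨hx, hxn⟩)
  have hlt := hS.lt_inf_normalizer hcard hT hPT
  obtain ⟨U, hTU, hU⟩ := hS.exists_maxFinP inf_le_right
    (hTp.mono (inf_le_left : T ⊓ Subgroup.normalizer (P : Set G) ≤ T))
  -- A `p`-subgroup `Z` of `C_G(P)` outside `P` is moved by `N_G(P)` into a maximal subgroup above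
  -- `N_T(P)`. It cannot land in `N_T(P)`, again by `C_X(Q) ≤ Q ≤ P`, and this contradicts `key` for
  -- `R = N_T(P)`.
  simp only [SelfCentralizing, not_forall] at hnc
  obtain ⟨Z, hZC, hZ, hZP⟩ := hnc
  obtain ⟨U₁, hZU₁, hU₁⟩ := hS.exists_maxFinP
    (hZC.trans (Subgroup.centralizer_le_normalizer _)) hZ
  obtain ⟨n, hn, rfl⟩ := hS.exists_conj_normalizer hP hcard hbig hU₁ hU
  rw [mem_normalizer_iff_conjBy] at hn
  have h1 : ¬ conjBy n U₁ ⊓ Subgroup.centralizer (P : Set G) ≤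
      T ⊓ Subgroup.normalizer (P : Set G) := by
    intro h2
    have h3 : conjBy n Z ≤ Subgroup.centralizer (P : Set G) := by
      have h4 := conjBy_mono n hZC
      rwa [conjBy_centralizer, hn] at h4
    have h5 : conjBy n Z ≤ T := (le_inf (conjBy_mono n hZU₁) h3).trans (h2.trans inf_le_left)
    have h6 : conjBy n Z ≤ P :=
      (le_inf (h3.trans (Subgroup.centralizer_le hQP)) (h5.trans hTX)).trans (hQ.trans hQP)
    rw [← hn, conjBy_le_conjBy] at h6
    exact hZP h6
  obtain ⟨x, hx, hxT, hxn⟩ := hU.finP.exists_mem_normalizer hTU inf_le_left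
    ((le_inf (hTU.trans Subgroup.le_normalizer) (inf_le_right.trans
      (normalizer_le_normalizer_centralizer P))).trans (inf_normalizer_le_normalizer_inf _ _)) h1
  exact hxT (key _ hlt inf_le_left
    ((conjBy n U₁ ⊓ Subgroup.centralizer (P : Set G)) ⊓ Subgroup.normalizer
      ((T ⊓ Subgroup.normalizer (P : Set G) : Subgroup G) : Set G))
    (hU.finP.mono (inf_le_left.trans inf_le_left)) inf_le_right
    ((inf_le_left.trans inf_le_right).trans (Subgroup.centralizer_le hQP)) ⟨hx, hxn⟩)

/-- The subgroups `P C_U(P)`, for the maximal finite `p`-subgroups `U` of `N_G(P)`, are conjugate in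
`C_G(P)`. -/
theorem exists_conj_centralizer [Fact p.Prime] (hS : IsSylowConnected p S) {P : Subgroup G}
    (hP : FinP p P) (hcard : Nat.card P < Nat.card S)
    (hbig : ∀ T : Subgroup G, FinP p T → Nat.card P < Nat.card T → HasSylowLifts p T)
    (hnc : ¬ SelfCentralizing p P) {U U' : Subgroup G}
    (hU : MaxFinP p (Subgroup.normalizer (P : Set G)) U)
    (hU' : MaxFinP p (Subgroup.normalizer (P : Set G)) U') :
    ∃ c ∈ Subgroup.centralizer (P : Set G),
      conjBy c (P ⊔ (U ⊓ Subgroup.centralizer (P : Set G))) =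
        P ⊔ (U' ⊓ Subgroup.centralizer (P : Set G)) := by
  let E : Subgroup G → Subgroup G → Prop := fun U U' =>
    ∃ c ∈ Subgroup.centralizer (P : Set G),
      conjBy c (P ⊔ (U ⊓ Subgroup.centralizer (P : Set G))) =
        P ⊔ (U' ⊓ Subgroup.centralizer (P : Set G))
  have hE : Equivalence E := by
    refine ⟨fun U => ⟨1, one_mem _, conjBy_one _⟩, ?_, ?_⟩
    · rintro U U' ⟨n, hn, h⟩
      refine ⟨n⁻¹, inv_mem hn, ?_⟩
      rw [← h, conjBy_inv_conjBy]
    · rintro U U' U'' ⟨n, hn, h⟩ ⟨m, hm, h'⟩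
      refine ⟨m * n, mul_mem hm hn, ?_⟩
      rw [conjBy_mul, h, h']
  have hcardC : ∀ U U', MaxFinP p (Subgroup.normalizer (P : Set G)) U →
      MaxFinP p (Subgroup.normalizer (P : Set G)) U' →
      Nat.card (U' ⊓ Subgroup.centralizer (P : Set G) : Subgroup G) ≤
        Nat.card (U ⊓ Subgroup.centralizer (P : Set G) : Subgroup G) := by
    intro U U' hU hU'
    obtain ⟨n, hn, rfl⟩ := hS.exists_conj_normalizer hP hcard hbig hU' hU
    rw [mem_normalizer_iff_conjBy] at hn
    rw [← card_conjBy n (U' ⊓ _), conjBy_inf, conjBy_centralizer, hn]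
  have hinf : ∀ U U', MaxFinP p (Subgroup.normalizer (P : Set G)) U →
      MaxFinP p (Subgroup.normalizer (P : Set G)) U' → P < U ⊓ U' → E U U' := by
    intro U U' hU hU' h
    refine hS.rel_of_lt_inf hP hE ?_ hU hU' h
    intro U U' hU hU' hPV hVU hVU'
    -- If one centralizer part lies in the intersection, the two parts are nested and of equal
    -- order, hence equal.
    by_cases hCU : U ⊓ Subgroup.centralizer (P : Set G) ≤ U ⊓ U'
    · left
      refine ⟨1, one_mem _, ?_⟩
      rw [conjBy_one, (hU'.finP.mono inf_le_left).eq_of_le_of_card_le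
        (le_inf (hCU.trans inf_le_right) inf_le_right) (hcardC U U' hU hU')]
    by_cases hCU' : U' ⊓ Subgroup.centralizer (P : Set G) ≤ U ⊓ U'
    · left
      refine ⟨1, one_mem _, ?_⟩
      rw [conjBy_one, (hU.finP.mono inf_le_left).eq_of_le_of_card_le
        (le_inf (hCU'.trans inf_le_left) inf_le_right) (hcardC U' U hU' hU)]
    right
    have hV : FinP p (U ⊓ U') := hU.finP.mono inf_le_left
    have hVl := hbig _ hV (hV.card_lt hPV)
    generalize hVdef : U ⊓ U' = V at *
    have hVC : V ≤ Subgroup.normalizer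
        ((Subgroup.centralizer (P : Set G) : Subgroup G) : Set G) :=
      hVU.le.trans (hU.le.trans (normalizer_le_normalizer_centralizer P))
    obtain ⟨x, hx, hxV, hxn⟩ := hU.finP.exists_mem_normalizer hVU.le inf_le_left
      ((le_inf (hVU.le.trans Subgroup.le_normalizer) hVC).trans
        (inf_normalizer_le_normalizer_inf _ _)) hCU
    obtain ⟨y, hy, hyV, hyn⟩ := hU'.finP.exists_mem_normalizer hVU'.le inf_le_left
      ((le_inf (hVU'.le.trans Subgroup.le_normalizer) hVC).trans
        (inf_normalizer_le_normalizer_inf _ _)) hCU'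
    have := hV.fin
    -- The conjugator has to centralize `P`, so the Sylow argument runs in `C_G(P) ∩ N_G(V)` and
    -- sees only the centralizer parts. `V` is adjoined to `Y` afterwards, and `x` and `hyh⁻¹`
    -- witness that both intersections grew.
    obtain ⟨h, hh, Y, hYH, hY, hUY, hU'Y⟩ := hVl.exists_conj
      (H := Subgroup.centralizer (P : Set G) ⊓ Subgroup.normalizer (V : Set G))
      (le_inf (Subgroup.centralizer_le hPV.le) (Subgroup.centralizer_le_normalizer _))
      inf_le_right
      (U := (U ⊓ Subgroup.centralizer (P : Set G)) ⊓ Subgroup.normalizer (V : Set G))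
      (inf_le_inf_right _ inf_le_right) (hU.finP.mono (inf_le_left.trans inf_le_left))
      (V := (U' ⊓ Subgroup.centralizer (P : Set G)) ⊓ Subgroup.normalizer (V : Set G))
      (inf_le_inf_right _ inf_le_right) (hU'.finP.mono (inf_le_left.trans inf_le_left))
    have hhV := mem_normalizer_iff_conjBy.1 hh.2
    have hhN : h ∈ Subgroup.normalizer (P : Set G) := Subgroup.centralizer_le_normalizer _ hh.1
    have hVN : V ≤ Subgroup.normalizer (P : Set G) := hVU.le.trans hU.le
    obtain ⟨U₂, hYU₂, hU₂⟩ := hS.exists_maxFinP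
      (sup_le hVN ((hYH.trans inf_le_left).trans (Subgroup.centralizer_le_normalizer _)))
      (hV.sup hY (hYH.trans inf_le_right))
    have hxU₂ : x ∈ U₂ := hYU₂ (Subgroup.mem_sup_right (hUY ⟨hx, hxn⟩))
    have hyU₂ : h * y * h⁻¹ ∈ U₂ :=
      hYU₂ (Subgroup.mem_sup_right (hU'Y (conj_mem_conjBy ⟨hy, hyn⟩)))
    refine ⟨conjBy h U', U₂, hU'.conj hhN, hU₂, ⟨h, hh.1, ?_⟩, ?_, ?_⟩
    · rw [conjBy_sup, conjBy_inf, conjBy_centralizer, mem_normalizer_iff_conjBy.1 hhN]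
    · refine lt_of_le_of_ne (le_inf hVU.le (le_sup_left.trans hYU₂)) fun h1 => hxV ?_
      rw [h1]
      exact ⟨hx.1, hxU₂⟩
    · rw [← card_conjBy h V]
      refine (hU₂.finP.mono inf_le_right).card_lt (lt_of_le_of_ne
        (le_inf (conjBy_mono h hVU'.le) (hhV.le.trans (le_sup_left.trans hYU₂))) fun h1 => hyV ?_)
      have h2 : h * y * h⁻¹ ∈ conjBy h V := by
        rw [h1]
        exact ⟨conj_mem_conjBy hy.1, hyU₂⟩
      rw [mem_conjBy] at h2
      simpa [mul_assoc] using h2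
  refine hS.rel_of_panels (E := E) hP hcard hE hinf ?_ hU hU'
  rintro T T' hPT hPT' hT hT' ⟨X, Q, hX, hTX, hT'X, hXQ, hQT, hQT', hQ⟩
  have hQP := hS.not_le_of_not_selfCentralizing hP hcard hbig hnc hT hPT hTX hXQ hQ
  have hTp : FinP p T := by
    obtain ⟨k, rfl⟩ := hT
    exact hS.finP.conj k
  have hT'p : FinP p T' := by
    obtain ⟨k, rfl⟩ := hT'
    exact hS.finP.conj k
  obtain ⟨U, hTU, hU⟩ := hS.exists_maxFinP inf_le_right
    (hTp.mono (inf_le_left : T ⊓ Subgroup.normalizer (P : Set G) ≤ T))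
  obtain ⟨U', hTU', hU'⟩ := hS.exists_maxFinP inf_le_right
    (hT'p.mono (inf_le_left : T' ⊓ Subgroup.normalizer (P : Set G) ≤ T'))
  -- `PQ` lies in both `T` and `T'` and properly contains `P`, so `N_{PQ}(P)` is a common subgroup
  -- of `U` and `U'` larger than `P`.
  refine ⟨U, U', hU, hU', hTU, hTU', hinf U U' hU hU' ?_⟩
  exact ((hTp.mono (sup_le hPT hQT)).lt_normalizer (lt_sup_of_not_le hQP)).trans_le
    (le_inf ((inf_le_inf_right _ (sup_le hPT hQT)).trans hTU)
      ((inf_le_inf_right _ (sup_le hPT' hQT')).trans hTU'))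

/-- If all larger finite `p`-subgroups have Sylow lifts, so does a finite `p`-subgroup that is not
self-centralizing. -/
theorem hasSylowLifts_of_not_selfCentralizing [Fact p.Prime] (hS : IsSylowConnected p S)
    {P : Subgroup G} (hP : FinP p P) (hcard : Nat.card P < Nat.card S)
    (hbig : ∀ T : Subgroup G, FinP p T → Nat.card P < Nat.card T → HasSylowLifts p T)
    (hnc : ¬ SelfCentralizing p P) : HasSylowLifts p P := by
  intro H hCH hHN hHp
  have hconj := fun {U U' : Subgroup G} => hS.exists_conj_centralizer hP hcard hbig hnc
    (U := U) (U' := U')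
  have hnc' := hnc
  simp only [SelfCentralizing, not_forall] at hnc'
  obtain ⟨Z, hZC, hZ, hZP⟩ := hnc'
  obtain ⟨U, hZU, hU⟩ := hS.exists_maxFinP
    (hZC.trans (Subgroup.centralizer_le_normalizer _)) hZ
  generalize hCdef : Subgroup.centralizer (P : Set G) = C at *
  have hCN : C ≤ Subgroup.normalizer (P : Set G) :=
    hCdef ▸ Subgroup.centralizer_le_normalizer _
  have hNC : ∀ n ∈ Subgroup.normalizer (P : Set G), conjBy n C = C := by
    intro n hn
    rw [← hCdef, conjBy_centralizer, mem_normalizer_iff_conjBy.1 hn]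
  have hTp : FinP p (P ⊔ (U ⊓ C)) :=
    hP.sup (hU.finP.mono inf_le_left) (inf_le_left.trans hU.le)
  have hPT : P < P ⊔ (U ⊓ C) := lt_sup_of_not_le fun h => hZP ((le_inf hZU hZC).trans h)
  have hT := hbig _ hTp (hTp.card_lt hPT)
  have hnorm : ∀ {V}, MaxFinP p (Subgroup.normalizer (P : Set G)) V →
      V ≤ Subgroup.normalizer ((P ⊔ (V ⊓ C) : Subgroup G) : Set G) := by
    intro V hV v hv
    rw [mem_normalizer_iff_conjBy, conjBy_sup, conjBy_inf, conjBy_eq_self_of_mem hv,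
      mem_normalizer_iff_conjBy.1 (hV.le hv), hNC v (hV.le hv)]
  -- Frattini argument: the `n`-conjugate of `P C_U(P)` is the subgroup attached to the maximal
  -- subgroup `nUn⁻¹`, hence `C_G(P)`-conjugate to the original.
  have hfrat : ∀ n ∈ Subgroup.normalizer (P : Set G), ∃ c ∈ C,
      c⁻¹ * n ∈ Subgroup.normalizer ((P ⊔ (U ⊓ C) : Subgroup G) : Set G) := by
    intro n hn
    obtain ⟨c, hc, h⟩ := hconj hU (hU.conj hn)
    refine ⟨c, hc, ?_⟩
    have h1 : conjBy n (P ⊔ (U ⊓ C)) = P ⊔ (conjBy n U ⊓ C) := by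
      rw [conjBy_sup, conjBy_inf, hNC n hn, mem_normalizer_iff_conjBy.1 hn]
    rw [mem_normalizer_iff_conjBy, conjBy_mul, h1, ← h, conjBy_inv_conjBy]
  generalize hTdef : P ⊔ (U ⊓ C) = T at *
  have := hTp.fin
  have hCT : Subgroup.centralizer (T : Set G) ≤ C :=
    hCdef ▸ Subgroup.centralizer_le hPT.le
  obtain ⟨Y, hYH, hY, hYconj, hYsurj⟩ := hT.exists_sylow
    (H := H ⊓ Subgroup.normalizer (T : Set G))
    (le_inf (hCT.trans hCH) (Subgroup.centralizer_le_normalizer _)) inf_le_right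
  have hYC : ∀ h ∈ H ⊓ Subgroup.normalizer (T : Set G), ∃ y ∈ Y, y⁻¹ * h ∈ C := by
    intro h hh
    -- Modulo `C_G(P) ∩ N_G(T)`, the group `H ∩ N_G(T)` embeds in the `p`-group `H/C_G(P)`, so `Y`
    -- covers the quotient.
    obtain ⟨y, hy, hyh⟩ := hYsurj (C ⊓ Subgroup.normalizer (T : Set G))
      (le_inf hCT (Subgroup.centralizer_le_normalizer _)) (inf_le_inf_right _ hCH)
      (by
        intro x hx
        rw [mem_normalizer_iff_conjBy, conjBy_inf, hNC x (hHN hx.1),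
          conjBy_eq_self_of_mem hx.2])
      (by
        intro x hx
        obtain ⟨n, hn⟩ := hHp x hx.1
        exact ⟨n, hn, pow_mem hx.2 _⟩) h hh
    exact ⟨y, hy, hyh.1⟩
  refine ⟨Y, hYH.trans inf_le_left, hY, ?_, ?_⟩
  · intro h hh
    obtain ⟨c, hc, hcn⟩ := hfrat h (hHN hh)
    obtain ⟨y, hy, hyh⟩ := hYC (c⁻¹ * h)
      (Subgroup.mem_inf.2 ⟨mul_mem (inv_mem (hCH hc)) hh, hcn⟩)
    refine ⟨y, hy, ?_⟩
    have hyN : y ∈ Subgroup.normalizer (P : Set G) := hHN (hYH hy).1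
    have h1 : y⁻¹ * c * y ∈ C := by
      have h2 : c ∈ conjBy y C := by rwa [hNC y hyN]
      exact mem_conjBy.1 h2
    have h3 := mul_mem h1 hyh
    simpa [mul_assoc] using h3
  · intro V hVH hV
    -- A maximal `U'` above `V` normalizes `P C_{U'}(P)`, which a centralizing element carries to
    -- `T`; the conjugate of `V` therefore lands in `N_G(T)`.
    obtain ⟨U', hVU', hU'⟩ := hS.exists_maxFinP (hVH.trans hHN) hV
    obtain ⟨c, hc, h⟩ := hconj hU' hU
    rw [hTdef] at h
    have h1 : conjBy c V ≤ H ⊓ Subgroup.normalizer (T : Set G) := by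
      refine le_inf ?_ ?_
      · rw [← conjBy_eq_self_of_mem (hCH hc)]
        exact conjBy_mono c hVH
      · rw [← h, ← conjBy_normalizer]
        exact conjBy_mono c (hVU'.trans (hnorm hU'))
    obtain ⟨k, hk, hkV⟩ := hYconj _ h1 (hV.conj c)
    obtain ⟨y, hy, hyk⟩ := hYC k hk
    refine ⟨y⁻¹ * k * c, mul_mem hyk hc, ?_⟩
    rw [mul_assoc, conjBy_mul, conjBy_mul, ← conjBy_eq_self_of_mem (inv_mem hy)]
    exact conjBy_mono _ hkV

/-- All finite `p`-subgroups have Sylow lifts if the self-centralizing ones do. -/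
theorem hasSylowLifts [Fact p.Prime] (hS : IsSylowConnected p S)
    (hcent : ∀ P : Subgroup G, FinP p P → SelfCentralizing p P → HasSylowLifts p P)
    {P : Subgroup G} (hP : FinP p P) : HasSylowLifts p P := by
  induction hk : Nat.card S - Nat.card P using Nat.strong_induction_on generalizing P with
  | _ k ih =>
    by_cases hnc : SelfCentralizing p P
    · exact hcent P hP hnc
    -- When `|P| ≥ |S|`, a product `PU` with a `p`-subgroup `U` of `C_G(P)` cannot exceed `P`, so
    -- `P` is already self-centralizing.
    have hcard : Nat.card P < Nat.card S := by
      by_contra hle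
      refine hnc fun U hUC hU => ?_
      have h1 := hP.sup hU (hUC.trans (Subgroup.centralizer_le_normalizer _))
      rw [h1.eq_of_le_of_card_le le_sup_left ((hS.card_le h1).trans (not_lt.1 hle))]
      exact le_sup_right
    refine hS.hasSylowLifts_of_not_selfCentralizing hP hcard (fun T hT hPT => ?_) hnc
    have h1 := hS.card_le hT
    exact ih _ (by omega) hT rfl

end IsSylowConnected

end Panels

/-! ## Saturation from Sylow lifts -/

section Saturation

/-- `(cu)^k` is congruent to `u^k` modulo `C`, and `u` has `p`-power order. -/
theorem FinP.exists_pow_mem_of_mem_sup {p : ℕ} {G : Type*} [Group G] {U C : Subgroup G}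
    (hU : FinP p U) (hn : U ≤ Subgroup.normalizer (C : Set G)) {x : G} (hx : x ∈ C ⊔ U) :
    ∃ n : ℕ, x ^ p ^ n ∈ C := by
  obtain ⟨c, hc, u, hu, rfl⟩ := exists_mul_of_mem_sup hn hx
  have h1 : ∀ k : ℕ, (c * u) ^ k * (u ^ k)⁻¹ ∈ C := by
    intro k
    induction k with
    | zero => simp
    | succ k ih =>
      have h2 : u * ((c * u) ^ k * (u ^ k)⁻¹) * u⁻¹ ∈ C :=
        (Subgroup.mem_normalizer_iff.1 (hn hu) _).1 ih
      have h3 : (c * u) ^ (k + 1) * (u ^ (k + 1))⁻¹ =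
          c * (u * ((c * u) ^ k * (u ^ k)⁻¹) * u⁻¹) := by
        rw [pow_succ', pow_succ']
        group
      rw [h3]
      exact mul_mem hc h2
  obtain ⟨n, hn⟩ := hU.pgrp ⟨u, hu⟩
  have h4 : u ^ p ^ n = 1 := congrArg Subtype.val hn
  refine ⟨n, ?_⟩
  have h5 := h1 (p ^ n)
  rwa [h4, inv_one, mul_one] at h5

variable {p : ℕ} {G : Type*} [Group G]

/-- If `N_T(P)` is as large as possible among the conjugates of `P` in the Sylow subgroup `T`, then
`N_T(P)` itself can be taken as the lift. -/
theorem HasSylowLifts.of_fully_normalized {T P : Subgroup G} (hT : FinP p T)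
    (hsyl : ∀ U : Subgroup G, FinP p U → ∃ g, conjBy g U ≤ T) (hPT : P ≤ T)
    (hP : HasSylowLifts p P)
    (hmax : ∀ g, conjBy g P ≤ T →
      Nat.card (T ⊓ Subgroup.normalizer ((conjBy g P : Subgroup G) : Set G) : Subgroup G) ≤
        Nat.card (T ⊓ Subgroup.normalizer (P : Set G) : Subgroup G))
    {H : Subgroup G} (hCH : Subgroup.centralizer (P : Set G) ≤ H)
    (hHN : H ≤ Subgroup.normalizer (P : Set G))
    (hHp : ∀ h ∈ H, ∃ n : ℕ, h ^ p ^ n ∈ Subgroup.centralizer (P : Set G))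
    (hTH : T ⊓ Subgroup.normalizer (P : Set G) ≤ H) :
    (∀ h ∈ H, ∃ w ∈ T ⊓ Subgroup.normalizer (P : Set G),
      w⁻¹ * h ∈ Subgroup.centralizer (P : Set G)) ∧
      ∀ U ≤ H, FinP p U → ∃ c ∈ Subgroup.centralizer (P : Set G),
        conjBy c U ≤ T ⊓ Subgroup.normalizer (P : Set G) := by
  obtain ⟨W, hWH, hW, hs, hconj⟩ := hP H hCH hHN hHp
  obtain ⟨c, hc, hcW⟩ := hconj _ hTH (hT.mono inf_le_left)
  have hcP := conjBy_eq_self_of_mem_centralizer hc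
  have hcN : c ∈ Subgroup.normalizer (P : Set G) := Subgroup.centralizer_le_normalizer _ hc
  have hPW : P ≤ W := by
    rw [← hcP]
    exact (conjBy_mono c (le_inf hPT Subgroup.le_normalizer)).trans hcW
  obtain ⟨g, hg⟩ := hsyl W hW
  have h1 := hmax g ((conjBy_mono g hPW).trans hg)
  -- A conjugate of `W` lies in `N_T(gPg⁻¹)`, whose order is at most `|N_T(P)|`; the inclusion of a
  -- conjugate of `N_T(P)` in `W` is thus an equality.
  have h2 : Nat.card W ≤ Nat.card (T ⊓ Subgroup.normalizer (P : Set G) : Subgroup G) := by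
    refine le_trans ?_ h1
    rw [← card_conjBy g W]
    refine (hT.mono inf_le_left).card_le (le_inf hg ?_)
    rw [← conjBy_normalizer]
    exact conjBy_mono g (hWH.trans hHN)
  have h3 : conjBy c (T ⊓ Subgroup.normalizer (P : Set G)) = W :=
    hW.eq_of_le_of_card_le hcW (by rwa [card_conjBy])
  constructor
  · intro h hh
    obtain ⟨w, hw, hwh⟩ := hs h hh
    rw [← h3, mem_conjBy] at hw
    refine ⟨_, hw, ?_⟩
    have hwN : w ∈ Subgroup.normalizer (P : Set G) := by
      have h4 := mul_mem (mul_mem hcN hw.2) (inv_mem hcN)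
      simpa [mul_assoc] using h4
    have h5 : w⁻¹ * c * w ∈ Subgroup.centralizer (P : Set G) := by
      have h6 := conjBy_centralizer w P
      rw [mem_normalizer_iff_conjBy.1 hwN] at h6
      rw [← h6] at hc
      exact mem_conjBy.1 hc
    have h7 := mul_mem (inv_mem hc) (mul_mem h5 hwh)
    simpa [mul_assoc] using h7
  · intro U hU hUp
    obtain ⟨d, hd, hdU⟩ := hconj U hU hUp
    refine ⟨c⁻¹ * d, mul_mem (inv_mem hc) hd, ?_⟩
    rw [conjBy_mul, conjBy_le_iff, inv_inv, h3]
    exact hdU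

/-- If `C_T(P)` is as large as possible among the conjugates of `P` in the Sylow subgroup `T`, then
a subgroup of `N_T(P)` that maps onto `H / C_G(P)` and contains `C_T(P)` can be taken as the lift. -/
theorem HasSylowLifts.of_fully_centralized {T P : Subgroup G} (hT : FinP p T)
    (hsyl : ∀ U : Subgroup G, FinP p U → ∃ g, conjBy g U ≤ T) (hPT : P ≤ T)
    (hP : HasSylowLifts p P)
    (hmax : ∀ g, conjBy g P ≤ T →
      Nat.card (T ⊓ Subgroup.centralizer ((conjBy g P : Subgroup G) : Set G) : Subgroup G) ≤
        Nat.card (T ⊓ Subgroup.centralizer (P : Set G) : Subgroup G))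
    {H : Subgroup G} (hCH : Subgroup.centralizer (P : Set G) ≤ H)
    (hHN : H ≤ Subgroup.normalizer (P : Set G))
    (hHp : ∀ h ∈ H, ∃ n : ℕ, h ^ p ^ n ∈ Subgroup.centralizer (P : Set G))
    (hs : ∀ h ∈ H, ∃ k ∈ T ⊓ H, k⁻¹ * h ∈ Subgroup.centralizer (P : Set G)) :
    ∀ U ≤ H, FinP p U → ∃ c ∈ Subgroup.centralizer (P : Set G), conjBy c U ≤ T ⊓ H := by
  obtain ⟨W, hWH, hW, -, hconj⟩ := hP H hCH hHN hHp
  obtain ⟨c, hc, hcW⟩ := hconj (T ⊓ H) inf_le_right (hT.mono inf_le_left)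
  have hcC : conjBy c (Subgroup.centralizer (P : Set G)) = Subgroup.centralizer (P : Set G) :=
    conjBy_eq_self_of_mem hc
  have hWP : FinP p (P ⊔ W) := (hT.mono hPT).sup hW (hWH.trans hHN)
  obtain ⟨g, hg⟩ := hsyl _ hWP
  rw [conjBy_sup] at hg
  have h1 := hmax g (le_sup_left.trans hg)
  -- By maximality of `|C_T(P)|`, the lift `W` has no further centralizing elements. As `T ∩ H`
  -- already covers `H/C_G(P)`, it follows that `W` is no larger than the conjugate of `T ∩ H`.
  have h2 : conjBy c (T ⊓ Subgroup.centralizer (P : Set G)) =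
      W ⊓ Subgroup.centralizer (P : Set G) := by
    refine (hW.mono inf_le_left).eq_of_le_of_card_le (le_inf
      ((conjBy_mono c (inf_le_inf_left T hCH)).trans hcW) ?_) ?_
    · refine (conjBy_mono c inf_le_right).trans hcC.le
    · rw [card_conjBy]
      refine le_trans ?_ h1
      rw [← card_conjBy g (W ⊓ _)]
      refine (hT.mono inf_le_left).card_le (le_inf ?_ ?_)
      · exact (conjBy_mono g inf_le_left).trans (le_sup_right.trans hg)
      · rw [← conjBy_centralizer]
        exact conjBy_mono g inf_le_right
  have h3 : W ≤ conjBy c (T ⊓ H) := by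
    intro w hw
    have hcH := hCH hc
    have hw' : c⁻¹ * w * c ∈ H := mul_mem (mul_mem (inv_mem hcH) (hWH hw)) hcH
    obtain ⟨k, hk, hkw⟩ := hs _ hw'
    have h4 : c * k * c⁻¹ ∈ conjBy c (T ⊓ H) := conj_mem_conjBy hk
    have h5 : (c * k * c⁻¹)⁻¹ * w ∈ W ⊓ Subgroup.centralizer (P : Set G) := by
      refine Subgroup.mem_inf.2 ⟨mul_mem (inv_mem (hcW h4)) hw, ?_⟩
      have h6 := mul_mem (mul_mem hc hkw) (inv_mem hc)
      simpa [mul_assoc] using h6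
    rw [← h2] at h5
    have h7 := mul_mem h4 (conjBy_mono c (inf_le_inf_left T hCH) h5)
    simpa [mul_assoc] using h7
  intro U hU hUp
  obtain ⟨d, hd, hdU⟩ := hconj U hU hUp
  refine ⟨c⁻¹ * d, mul_mem (inv_mem hc) hd, ?_⟩
  rw [conjBy_mul, conjBy_le_iff, inv_inv]
  exact hdU.trans h3

/-! ### Transport between subgroups of `S` and their images in `G`, and the saturation axioms. -/

variable {S : Type*} [Group S]

theorem map_normalizer_of_injective {ι : S →* G} (hι : Function.Injective ι) (P : Subgroup S) :
    (Subgroup.normalizer (P : Set S)).map ι =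
      ι.range ⊓ Subgroup.normalizer ((P.map ι : Subgroup G) : Set G) := by
  ext x
  constructor
  · rintro ⟨n, hn, rfl⟩
    replace hn : conjBy n P = P := mem_normalizer_iff_conjBy.1 hn
    refine Subgroup.mem_inf.2 ⟨⟨n, rfl⟩, mem_normalizer_iff_conjBy.2 ?_⟩
    ext y
    rw [mem_conjBy]
    constructor
    · rintro ⟨u, hu, huy⟩
      refine ⟨n * u * n⁻¹, ?_, ?_⟩
      · rw [← hn]
        exact conj_mem_conjBy hu
      · rw [map_mul, map_mul, huy, map_inv]
        group
    · rintro ⟨u, hu, rfl⟩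
      rw [SetLike.mem_coe, ← hn, mem_conjBy] at hu
      exact ⟨_, hu, by simp⟩
  · rintro ⟨⟨n, rfl⟩, hn⟩
    refine ⟨n, ?_, rfl⟩
    refine Subgroup.mem_normalizer_iff.2 fun u => ?_
    have h1 := Subgroup.mem_normalizer_iff.1 hn (ι u)
    rwa [← map_inv, ← map_mul, ← map_mul, Subgroup.mem_map_iff_mem hι,
      Subgroup.mem_map_iff_mem hι] at h1

theorem map_centralizer_of_injective {ι : S →* G} (hι : Function.Injective ι) (P : Subgroup S) :
    (Subgroup.centralizer (P : Set S)).map ι =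
      ι.range ⊓ Subgroup.centralizer ((P.map ι : Subgroup G) : Set G) := by
  ext x
  constructor
  · rintro ⟨n, hn, rfl⟩
    refine ⟨⟨n, rfl⟩, ?_⟩
    rintro _ ⟨u, hu, rfl⟩
    rw [← map_mul, ← map_mul, hn u hu]
  · rintro ⟨⟨n, rfl⟩, hn⟩
    refine ⟨n, fun u hu => hι ?_, rfl⟩
    rw [map_mul, map_mul]
    exact hn _ ⟨u, hu, rfl⟩

theorem card_map_eq_of_injective {ι : S →* G} (hι : Function.Injective ι) (P : Subgroup S) :
    Nat.card (P.map ι) = Nat.card P :=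
  Nat.card_congr (P.equivMapOfInjective ι hι).toEquiv.symm

theorem map_homImage {ι : S →* G} {P Q : Subgroup S} {φ : P →* Q} {g : G}
    (hg : ∀ u : P, ι (φ u) = g * ι u * g⁻¹) : (homImage φ).map ι = conjBy g (P.map ι) := by
  ext x
  constructor
  · rintro ⟨y, hy, rfl⟩
    obtain ⟨u, rfl⟩ := (mem_homImage φ y).1 hy
    rw [hg]
    exact conj_mem_conjBy ⟨u, u.2, rfl⟩
  · rintro ⟨_, ⟨u, hu, rfl⟩, rfl⟩
    exact ⟨φ ⟨u, hu⟩, (mem_homImage φ _).2 ⟨_, rfl⟩, hg ⟨u, hu⟩⟩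

theorem exists_hom_of_conjBy_le {ι : S →* G} (hι : Function.Injective ι) {P Q : Subgroup S} {g : G}
    (hg : conjBy g (P.map ι) ≤ Q.map ι) :
    ∃ φ : P →* Q, ∀ u : P, ι (φ u) = g * ι u * g⁻¹ := by
  have h : ∀ u : P, ∃ v : Q, ι v = g * ι u * g⁻¹ := by
    intro u
    obtain ⟨v, hv, h⟩ := hg (conj_mem_conjBy ⟨u, u.2, rfl⟩)
    exact ⟨⟨v, hv⟩, h⟩
  choose f hf using h
  refine ⟨⟨⟨f, ?_⟩, ?_⟩, hf⟩
  · refine Subtype.ext (hι ?_)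
    rw [hf]
    simp
  · intro u v
    refine Subtype.ext (hι ?_)
    change ι (f (u * v)) = ι (f u * f v)
    rw [map_mul, hf, hf, hf]
    simp

variable {ι : S →* G}

theorem FinP.map_of_isPGroup [Finite S] (hS : IsPGroup p S) (ι : S →* G) (P : Subgroup S) :
    FinP p (P.map ι) :=
  ⟨Set.Finite.to_subtype ((Set.toFinite (P : Set S)).image ι), (hS.to_subgroup P).map ι⟩

theorem FinP.range_of_isPGroup [Finite S] (hS : IsPGroup p S) (ι : S →* G) : FinP p ι.range := by
  rw [MonoidHom.range_eq_map]
  exact FinP.map_of_isPGroup hS ι ⊤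

/-- The homomorphism `N_G(P) → Aut(P)` for a subgroup `P` of `S`. -/
noncomputable def normalizerToAut (hι : Function.Injective ι) (P : Subgroup S) :
    Subgroup.normalizer ((P.map ι : Subgroup G) : Set G) →* MulAut P :=
  (MulAut.congr (P.equivMapOfInjective ι hι).symm).toMonoidHom.comp
    (P.map ι).normalizerMonoidHom

theorem normalizerToAut_apply (hι : Function.Injective ι) (P : Subgroup S)
    (n : Subgroup.normalizer ((P.map ι : Subgroup G) : Set G)) (u : P) :
    ι (normalizerToAut hι P n u) = n * ι u * (n : G)⁻¹ := by
  have h := (P.equivMapOfInjective ι hι).apply_symm_apply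
    ((P.map ι).normalizerMonoidHom n (P.equivMapOfInjective ι hι u))
  exact congrArg Subtype.val h

theorem mem_centralizer_of_normalizerToAut_eq_one (hι : Function.Injective ι) {P : Subgroup S}
    {n : Subgroup.normalizer ((P.map ι : Subgroup G) : Set G)} (h : normalizerToAut hι P n = 1) :
    (n : G) ∈ Subgroup.centralizer ((P.map ι : Subgroup G) : Set G) := by
  rintro _ ⟨u, hu, rfl⟩
  have h1 := normalizerToAut_apply hι P n ⟨u, hu⟩
  rw [h] at h1
  exact eq_mul_inv_iff_mul_eq.1 h1

theorem normalizerToAut_eq_one_of_mem (hι : Function.Injective ι) {P : Subgroup S}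
    {n : Subgroup.normalizer ((P.map ι : Subgroup G) : Set G)}
    (h : (n : G) ∈ Subgroup.centralizer ((P.map ι : Subgroup G) : Set G)) :
    normalizerToAut hι P n = 1 := by
  ext u
  refine hι ?_
  rw [normalizerToAut_apply]
  exact mul_inv_eq_of_eq_mul (h _ ⟨u, u.2, rfl⟩).symm

theorem fully_normalized_conjBy (hι : Function.Injective ι) {P : Subgroup S}
    (hP : (FusionSystem.ofGroup ι hι).IsFullyNormalized P) (g : G)
    (hg : conjBy g (P.map ι) ≤ ι.range) :
    Nat.card (ι.range ⊓ Subgroup.normalizer ((conjBy g (P.map ι) : Subgroup G) : Set G) :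
        Subgroup G) ≤
      Nat.card (ι.range ⊓ Subgroup.normalizer ((P.map ι : Subgroup G) : Set G) : Subgroup G) := by
  rw [MonoidHom.range_eq_map] at hg
  obtain ⟨φ, hφ⟩ := exists_hom_of_conjBy_le hι hg
  rw [← map_homImage hφ, ← map_normalizer_of_injective hι, ← map_normalizer_of_injective hι,
    card_map_eq_of_injective hι, card_map_eq_of_injective hι]
  exact hP φ ⟨g, hφ⟩

theorem fully_centralized_conjBy (hι : Function.Injective ι) {P : Subgroup S}
    (hP : (FusionSystem.ofGroup ι hι).IsFullyCentralized P) (g : G)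
    (hg : conjBy g (P.map ι) ≤ ι.range) :
    Nat.card (ι.range ⊓ Subgroup.centralizer ((conjBy g (P.map ι) : Subgroup G) : Set G) :
        Subgroup G) ≤
      Nat.card (ι.range ⊓ Subgroup.centralizer ((P.map ι : Subgroup G) : Set G) :
        Subgroup G) := by
  rw [MonoidHom.range_eq_map] at hg
  obtain ⟨φ, hφ⟩ := exists_hom_of_conjBy_le hι hg
  rw [← map_homImage hφ, ← map_centralizer_of_injective hι, ← map_centralizer_of_injective hι,
    card_map_eq_of_injective hι, card_map_eq_of_injective hι]
  exact hP φ ⟨g, hφ⟩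

/-- The fusion system of a group is saturated if `S` is a Sylow `p`-subgroup and all finite
`p`-subgroups have Sylow lifts. -/
theorem isSaturated_ofGroup [Fact p.Prime] [Finite S] (hS : IsPGroup p S)
    (hι : Function.Injective ι)
    (hsyl : ∀ U : Subgroup G, FinP p U → ∃ g, conjBy g U ≤ ι.range)
    (hlift : ∀ U : Subgroup G, FinP p U → HasSylowLifts p U) :
    (FusionSystem.ofGroup ι hι).IsSaturated p := by
  have hT := FinP.range_of_isPGroup hS ι
  have hmapT : ∀ P : Subgroup S, P.map ι ≤ ι.range := fun P => Subgroup.map_le_range ι P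
  constructor
  · intro P hP
    have hPl := hlift _ (FinP.map_of_isPGroup hS ι P)
    have : Finite (MulAut P) :=
      Finite.of_injective (fun e : MulAut P => (e : P → P)) DFunLike.coe_injective
    have hconjAut : ∀ (x : S) (hx : x ∈ Subgroup.normalizer (P : Set S))
        (n : Subgroup.normalizer ((P.map ι : Subgroup G) : Set G)), ι x = n →
        P.normalizerMonoidHom ⟨x, hx⟩ = normalizerToAut hι P n := by
      intro x hx n hxn
      ext u
      refine hι ?_
      rw [normalizerToAut_apply, ← hxn]
      change ι (x * u * x⁻¹) = _
      simp
    have hle : conjAut P ≤ (FusionSystem.ofGroup ι hι).Aut P := by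
      rintro _ ⟨⟨x, hx⟩, rfl⟩
      exact (FusionSystem.ofGroup ι hι).conj_mem x _ fun u => rfl
    have hpg : IsPGroup p (conjAut P) := by
      rintro ⟨_, ⟨x, rfl⟩⟩
      obtain ⟨n, hn⟩ := hS.to_subgroup (Subgroup.normalizer (P : Set S)) x
      refine ⟨n, Subtype.ext ?_⟩
      change P.normalizerMonoidHom x ^ p ^ n = 1
      rw [← map_pow, hn, map_one]
    -- The Sylow subgroup is chosen above `Aut_S(P)`, so that its preimage `H` in `N_G(P)` contains
    -- `N_S(P)`; the lifting property then shows that `N_S(P)` already induces all of it.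
    obtain ⟨D, hD⟩ := (hpg.of_equiv (Subgroup.subgroupOfEquivOfLe hle).symm).exists_le_sylow
    let f := normalizerToAut hι P
    let E : Subgroup (MulAut P) :=
      (D : Subgroup _).map ((FusionSystem.ofGroup ι hι).Aut P).subtype
    have hEp : IsPGroup p E := D.2.map _
    let H : Subgroup G := (E.comap f).map (Subgroup.subtype _)
    have hHmem : ∀ n : Subgroup.normalizer ((P.map ι : Subgroup G) : Set G),
        (n : G) ∈ H ↔ f n ∈ E := by
      intro n
      constructor
      · rintro ⟨m, hm, hmn⟩
        have : m = n := Subtype.ext hmn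
        exact this ▸ hm
      · intro h
        exact ⟨n, h, rfl⟩
    have hHN : H ≤ Subgroup.normalizer ((P.map ι : Subgroup G) : Set G) := by
      rintro _ ⟨m, -, rfl⟩
      exact m.2
    have hCH : Subgroup.centralizer ((P.map ι : Subgroup G) : Set G) ≤ H := by
      intro x hx
      refine (hHmem ⟨x, Subgroup.centralizer_le_normalizer _ hx⟩).2 ?_
      have h1 : f ⟨x, Subgroup.centralizer_le_normalizer _ hx⟩ = 1 :=
        normalizerToAut_eq_one_of_mem hι hx
      rw [h1]
      exact one_mem _
    have hHp : ∀ h ∈ H, ∃ n : ℕ,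
        h ^ p ^ n ∈ Subgroup.centralizer ((P.map ι : Subgroup G) : Set G) := by
      rintro _ ⟨m, hm, rfl⟩
      obtain ⟨n, hn⟩ := hEp ⟨f m, hm⟩
      refine ⟨n, mem_centralizer_of_normalizerToAut_eq_one hι (n := m ^ p ^ n) ?_⟩
      rw [map_pow]
      exact congrArg Subtype.val hn
    have hTH : ι.range ⊓ Subgroup.normalizer ((P.map ι : Subgroup G) : Set G) ≤ H := by
      intro x hx
      have hxN := hx.2
      rw [← map_normalizer_of_injective hι] at hx
      obtain ⟨y, hy, rfl⟩ := hx
      refine (hHmem ⟨ι y, hxN⟩).2 ?_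
      have h1 := hconjAut y hy ⟨ι y, hxN⟩ rfl
      have h2 : P.normalizerMonoidHom ⟨y, hy⟩ ∈ conjAut P := ⟨_, rfl⟩
      change normalizerToAut hι P ⟨ι y, hxN⟩ ∈ E
      rw [← h1]
      exact ⟨⟨_, hle h2⟩, hD h2, rfl⟩
    obtain ⟨hs, hconj⟩ := hPl.of_fully_normalized hT hsyl (hmapT P)
      (fully_normalized_conjBy hι hP) hCH hHN hHp hTH
    refine ⟨?_, D, le_antisymm ?_ ?_⟩
    · rintro φ ⟨g, hg⟩
      -- Pulled back by `g`, the group `C_S(φ(P))` lies in `C_G(P)`, and an element of `C_G(P)`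
      -- moves it into `C_S(P)`.
      have h1 : (Subgroup.centralizer (homImage φ : Set S)).map ι ≤
          conjBy g (Subgroup.centralizer ((P.map ι : Subgroup G) : Set G)) := by
        rw [map_centralizer_of_injective hι, conjBy_centralizer, map_homImage hg]
        exact inf_le_right
      have h2 := FinP.map_of_isPGroup hS ι (Subgroup.centralizer (homImage φ : Set S))
      have h3 : conjBy g⁻¹ ((Subgroup.centralizer (homImage φ : Set S)).map ι) ≤
          Subgroup.centralizer ((P.map ι : Subgroup G) : Set G) := by
        rwa [conjBy_le_iff, inv_inv]
      obtain ⟨c, hc, hcU⟩ := hconj _ (h3.trans hCH) (h2.conj _)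
      have h4 : conjBy c (conjBy g⁻¹ ((Subgroup.centralizer (homImage φ : Set S)).map ι)) ≤
          (Subgroup.centralizer (P : Set S)).map ι := by
        rw [map_centralizer_of_injective hι P]
        refine le_inf (hcU.trans inf_le_left) ?_
        refine (conjBy_mono c h3).trans (conjBy_eq_self_of_mem hc).le
      have h5 := (FinP.map_of_isPGroup hS ι _).card_le h4
      rwa [card_conjBy, card_conjBy, card_map_eq_of_injective hι,
        card_map_eq_of_injective hι] at h5
    · rintro _ ⟨d, hd, rfl⟩
      obtain ⟨g, hg⟩ := d.2
      have hgN : g ∈ Subgroup.normalizer ((P.map ι : Subgroup G) : Set G) := by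
        rw [mem_normalizer_iff_conjBy, ← map_homImage hg]
        congr 1
        ext x
        rw [mem_homImage]
        constructor
        · rintro ⟨u, rfl⟩
          exact Subtype.property _
        · intro hx
          exact ⟨(d : MulAut P).symm ⟨x, hx⟩,
            congrArg Subtype.val ((d : MulAut P).apply_symm_apply ⟨x, hx⟩)⟩
      have hfg : f ⟨g, hgN⟩ = d := by
        ext u
        refine hι ?_
        rw [normalizerToAut_apply]
        exact (hg u).symm
      obtain ⟨w, hw, hwg⟩ := hs g ((hHmem ⟨g, hgN⟩).2 (by
        rw [hfg]
        exact ⟨d, hd, rfl⟩))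
      have hwN := hw.2
      rw [← map_normalizer_of_injective hι] at hw
      obtain ⟨y, hy, rfl⟩ := hw
      refine ⟨⟨y, hy⟩, ?_⟩
      rw [hconjAut y hy ⟨ι y, hwN⟩ rfl]
      have h1 : f (⟨ι y, hwN⟩⁻¹ * ⟨g, hgN⟩) = 1 := normalizerToAut_eq_one_of_mem hι hwg
      rw [map_mul, map_inv, inv_mul_eq_one] at h1
      change f ⟨ι y, hwN⟩ = d
      rw [h1, hfg]
    · intro d hd
      exact ⟨⟨d, hle hd⟩, hD hd, rfl⟩
  · rintro P φ ⟨g, hg⟩ hφ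
    have hP' := map_homImage hg
    set P' : Subgroup S := homImage φ with hP'def
    set C := Subgroup.centralizer ((P'.map ι : Subgroup G) : Set G) with hC
    set N := Subgroup.normalizer ((P'.map ι : Subgroup G) : Set G) with hN
    have hPl := hlift _ (FinP.map_of_isPGroup hS ι P')
    let U := conjBy g ((FusionSystem.extender φ).map ι)
    have hU : FinP p U := (FinP.map_of_isPGroup hS ι _).conj g
    -- This is the defining condition of `N_φ`: its `g`-conjugate acts on `φ(P)` through elements of
    -- `S`.
    have hUy : ∀ x ∈ U, ∃ y : G, y ∈ ι.range ∧ y ∈ N ∧ y⁻¹ * x ∈ C := by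
      rintro _ ⟨_, ⟨x, ⟨hx, y, hy, hxy⟩, rfl⟩, rfl⟩
      have hy' : ι y ∈ (Subgroup.normalizer (P' : Set S)).map ι := ⟨y, hy, rfl⟩
      rw [map_normalizer_of_injective hι] at hy'
      refine ⟨ι y, hy'.1, hy'.2, ?_⟩
      rw [hC, hP']
      rintro _ ⟨_, ⟨u, hu, rfl⟩, rfl⟩
      have h1 := congrArg ι (hxy ⟨u, hu⟩)
      rw [map_mul, map_mul, hg, hg, map_inv] at h1
      change g * ι (x * u * x⁻¹) * g⁻¹ = ι y * (g * ι u * g⁻¹) * (ι y)⁻¹ at h1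
      change g * ι u * g⁻¹ * ((ι y)⁻¹ * (g * ι x * g⁻¹)) =
        (ι y)⁻¹ * (g * ι x * g⁻¹) * (g * ι u * g⁻¹)
      rw [map_mul, map_mul, map_inv] at h1
      have h2 : g * ι u * g⁻¹ * ((ι y)⁻¹ * (g * ι x * g⁻¹)) =
          (ι y)⁻¹ * (ι y * (g * ι u * g⁻¹) * (ι y)⁻¹) * (g * ι x * g⁻¹) := by group
      rw [h2, ← h1]
      group
    have hCN : C ≤ N := Subgroup.centralizer_le_normalizer _
    have hUN : U ≤ N := by
      intro x hx
      obtain ⟨y, -, hy, hyx⟩ := hUy x hx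
      have h1 := mul_mem hy (hCN hyx)
      simpa using h1
    have hNC : N ≤ Subgroup.normalizer (C : Set G) := normalizer_le_normalizer_centralizer _
    have hlift' := hPl.of_fully_centralized hT hsyl (hmapT P') (fully_centralized_conjBy hι hφ)
      (H := C ⊔ U) le_sup_left (sup_le hCN hUN)
      (fun h hh => hU.exists_pow_mem_of_mem_sup (hUN.trans hNC) hh) (by
        intro h hh
        obtain ⟨c, hc, x, hx, rfl⟩ := exists_mul_of_mem_sup (hUN.trans hNC) hh
        obtain ⟨y, hyT, hyN, hyx⟩ := hUy x hx
        refine ⟨y, ⟨hyT, ?_⟩, ?_⟩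
        · have h1 : x * (y⁻¹ * x)⁻¹ = y := by group
          rw [← h1]
          exact mul_mem (Subgroup.mem_sup_right hx) (Subgroup.mem_sup_left (inv_mem hyx))
        · have h1 : y⁻¹ * c * y ∈ C := (Subgroup.mem_normalizer_iff''.1 (hNC hyN) c).1 hc
          have h2 := mul_mem h1 hyx
          have h3 : y⁻¹ * c * y * (y⁻¹ * x) = y⁻¹ * (c * x) := by group
          rwa [h3] at h2)
    -- Conjugation by `cg` maps `N_φ` into `S` and agrees with `φ` on `P`, because `c` centralizes
    -- `φ(P)`.
    obtain ⟨c, hc, hcU⟩ := hlift' U le_sup_right hU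
    have h1 : conjBy (c * g) ((FusionSystem.extender φ).map ι) ≤ (⊤ : Subgroup S).map ι := by
      rw [conjBy_mul, ← MonoidHom.range_eq_map]
      exact hcU.trans inf_le_left
    obtain ⟨ψ, hψ⟩ := exists_hom_of_conjBy_le hι h1
    refine ⟨ψ, ⟨c * g, hψ⟩, fun u hu hu' => Subtype.ext (hι ?_)⟩
    rw [hψ, hg]
    have h2 : g * ι u * g⁻¹ ∈ P'.map ι := by
      rw [hP']
      exact conj_mem_conjBy ⟨u, hu, rfl⟩
    have h3 := hc _ h2
    change c * g * ι u * (c * g)⁻¹ = g * ι u * g⁻¹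
    have h4 : c * g * ι u * (c * g)⁻¹ = c * (g * ι u * g⁻¹) * c⁻¹ := by group
    rw [h4, ← h3]
    group

end Saturation

/-! ## Lifts for self-centralizing subgroups -/

section FullLifts

variable {p : ℕ} {G : Type*} [Group G]

/-- `W` is a finite `p`-subgroup of `H` that contains `Z(P)` and maps onto `H / C_G(P)`. -/
structure IsFullLift (p : ℕ) (P H W : Subgroup G) : Prop where
  le : W ≤ H
  finP : FinP p W
  center_le : P ⊓ Subgroup.centralizer (P : Set G) ≤ W
  surj : ∀ h ∈ H, ∃ w ∈ W, w⁻¹ * h ∈ Subgroup.centralizer (P : Set G)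

variable {P H W W' : Subgroup G}

theorem IsFullLift.conj (hW : IsFullLift p P H W)
    (hC : Subgroup.centralizer (P : Set G) ≤ H) {c : G}
    (hc : c ∈ Subgroup.centralizer (P : Set G)) : IsFullLift p P H (conjBy c W) := by
  refine ⟨?_, hW.finP.conj c, ?_, ?_⟩
  · rw [← conjBy_eq_self_of_mem (hC hc)]
    exact conjBy_mono c hW.le
  · have h1 := conjBy_mono c hW.center_le
    rwa [conjBy_inf, conjBy_eq_self_of_mem hc, conjBy_eq_self_of_mem_centralizer hc] at h1
  · intro h hh
    have hcH := hC hc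
    obtain ⟨w, hw, hwh⟩ := hW.surj (c⁻¹ * h * c) (mul_mem (mul_mem (inv_mem hcH) hh) hcH)
    refine ⟨c * w * c⁻¹, conj_mem_conjBy hw, ?_⟩
    have h1 := mul_mem (mul_mem hc hwh) (inv_mem hc)
    simpa [mul_assoc] using h1

/-- Each `y ∈ Y` acts on `P` like some `w ∈ W`, and `w⁻¹y ∈ C_Y(P)` lies in `Z(P) ≤ W` by
self-centralization. -/
theorem IsFullLift.eq_of_le (hP : SelfCentralizing p P) (hW : IsFullLift p P H W) {Y : Subgroup G}
    (hY : FinP p Y) (hYH : Y ≤ H) (hWY : W ≤ Y) : Y = W := by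
  refine le_antisymm (fun y hy => ?_) hWY
  obtain ⟨w, hw, hwy⟩ := hW.surj y (hYH hy)
  have h1 : Y ⊓ Subgroup.centralizer (P : Set G) ≤ P := hP _ inf_le_right (hY.mono inf_le_left)
  have h2 : w⁻¹ * y ∈ Y ⊓ Subgroup.centralizer (P : Set G) :=
    Subgroup.mem_inf.2 ⟨mul_mem (inv_mem (hWY hw)) hy, hwy⟩
  have h3 := mul_mem hw (hW.center_le ⟨h1 h2, hwy⟩)
  simpa using h3

/-- Full lifts in a common finite subgroup are conjugate in `C_G(P)`. -/
theorem IsFullLift.exists_conj_of_finite [Fact p.Prime] (hP : SelfCentralizing p P)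
    (hC : Subgroup.centralizer (P : Set G) ≤ H)
    (hW : IsFullLift p P H W) (hW' : IsFullLift p P H W') {X : Subgroup G} (hX : Finite X)
    (hWX : W ≤ X) (hW'X : W' ≤ X) :
    ∃ c ∈ Subgroup.centralizer (P : Set G), conjBy c W' = W := by
  have hXH : Finite (X ⊓ H : Subgroup G) :=
    Finite.of_injective _ (Subgroup.inclusion_injective inf_le_left)
  obtain ⟨x, hx, Y, hYX, hY, h1, h2⟩ := hW.finP.exists_conj_of_finite hW'.finP hXH
    (le_inf hWX hW.le) (le_inf hW'X hW'.le)
  -- The Sylow conjugator `x` is corrected by an element of `W` with the same action on `P`; this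
  -- does not disturb `W` and leaves a conjugator in `C_G(P)`.
  obtain ⟨w, hw, hwx⟩ := hW.surj x hx.2
  rw [hW.eq_of_le hP hY (hYX.trans inf_le_right) h1] at h2
  refine ⟨w⁻¹ * x, hwx, ?_⟩
  have h3 : conjBy (w⁻¹ * x) W' ≤ W := by
    rw [conjBy_mul, ← conjBy_eq_self_of_mem (inv_mem hw)]
    exact conjBy_mono _ h2
  exact ((hW'.conj hC hwx).eq_of_le hP hW.finP hW.le h3).symm

/-- A finite subgroup `X` with `H = C_G(P) (X ∩ H)` and `Z(P) ≤ X` contains a full lift. -/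
theorem exists_isFullLift [Fact p.Prime] (hPf : FinP p P)
    (hC : Subgroup.centralizer (P : Set G) ≤ H) (hN : H ≤ Subgroup.normalizer (P : Set G))
    (hp : ∀ h ∈ H, ∃ n : ℕ, h ^ p ^ n ∈ Subgroup.centralizer (P : Set G)) {X : Subgroup G}
    (hX : Finite X) (hPX : P ≤ X)
    (hs : ∀ h ∈ H, ∃ k ∈ Subgroup.centralizer (P : Set G), k⁻¹ * h ∈ X) :
    ∃ W ≤ X, IsFullLift p P H W := by
  let A : Subgroup G := X ⊓ H
  have hA : Finite A := Finite.of_injective _ (Subgroup.inclusion_injective inf_le_left)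
  let Z : Subgroup G := P ⊓ Subgroup.centralizer (P : Set G)
  have hZA : Z ≤ A := le_inf (inf_le_left.trans hPX) (inf_le_right.trans hC)
  have hZ : IsPGroup p (Z.subgroupOf A) :=
    (hPf.mono inf_le_left).pgrp.of_equiv (Subgroup.subgroupOfEquivOfLe hZA).symm
  obtain ⟨D, hD⟩ := hZ.exists_le_sylow
  have hmap : ∀ d : A, d ∈ D → (d : G) ∈ (D : Subgroup A).map A.subtype :=
    fun d hd => ⟨d, hd, rfl⟩
  have hle : (D : Subgroup A).map A.subtype ≤ A := by
    rintro _ ⟨d, -, rfl⟩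
    exact d.2
  let K : Subgroup A := (Subgroup.centralizer (P : Set G)).subgroupOf A
  have hNC : ∀ h ∈ H, ∀ k, k ∈ Subgroup.centralizer (P : Set G) ↔
      h * k * h⁻¹ ∈ Subgroup.centralizer (P : Set G) := fun h hh =>
    Subgroup.mem_normalizer_iff.1 (normalizer_le_normalizer_centralizer P (hN hh))
  have hK : K.Normal := ⟨fun k hk a => (hNC a a.2.2 k).1 hk⟩
  refine ⟨(D : Subgroup A).map A.subtype, hle.trans inf_le_left, hle.trans inf_le_right,
    ⟨?_, D.2.map _⟩, fun z hz => hmap ⟨z, hZA hz⟩ (hD hz), fun h hh => ?_⟩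
  · exact Finite.of_injective _ (Subgroup.inclusion_injective hle)
  · obtain ⟨k, hk, hkh⟩ := hs h hh
    have hkA : k⁻¹ * h ∈ A := Subgroup.mem_inf.2 ⟨hkh, mul_mem (inv_mem (hC hk)) hh⟩
    obtain ⟨d, hd, hdk⟩ := FinP.exists_mul_of_sylow D K (fun a => hp a a.2.2) ⟨_, hkA⟩
    refine ⟨d, hmap d hd, ?_⟩
    have h1 : (d : G)⁻¹ * (k⁻¹ * h) ∈ Subgroup.centralizer (P : Set G) := hdk
    have h2 : (d : G)⁻¹ * k * (d : G) ∈ Subgroup.centralizer (P : Set G) := by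
      have h3 := (hNC _ (inv_mem d.2.2) k).1 hk
      simpa using h3
    have h3 := mul_mem h2 h1
    simpa [mul_assoc] using h3

/-- If full lifts exist and are conjugate in `C_G(P)`, then `P` has Sylow lifts. -/
theorem hasSylowLifts_of_isFullLift (hPf : FinP p P)
    (hex : ∀ H : Subgroup G, Subgroup.centralizer (P : Set G) ≤ H →
      H ≤ Subgroup.normalizer (P : Set G) →
      (∀ h ∈ H, ∃ n : ℕ, h ^ p ^ n ∈ Subgroup.centralizer (P : Set G)) →
      (∃ W, IsFullLift p P H W) ∧ ∀ W W', IsFullLift p P H W → IsFullLift p P H W' →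
        ∃ c ∈ Subgroup.centralizer (P : Set G), conjBy c W' = W) :
    HasSylowLifts p P := by
  intro H hC hN hp
  obtain ⟨⟨W, hW⟩, -⟩ := hex H hC hN hp
  refine ⟨W, hW.le, hW.finP, hW.surj, fun U hU hUp => ?_⟩
  have hNC := normalizer_le_normalizer_centralizer P
  have hUC : U ≤ Subgroup.normalizer ((Subgroup.centralizer (P : Set G) : Subgroup G) : Set G) :=
    hU.trans (hN.trans hNC)
  let C := Subgroup.centralizer (P : Set G)
  have hH₁ : C ⊔ U ≤ H := sup_le hC hU
  -- `U` need not cover `H/C_G(P)`, so uniqueness is used over `C_G(P)U`, where both `Z(P)U` and `W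
  -- ∩ C_G(P)U` are full lifts.
  obtain ⟨-, huniq⟩ := hex (C ⊔ U) le_sup_left (hH₁.trans hN)
    (fun h hh => hUp.exists_pow_mem_of_mem_sup hUC hh)
  have hZU : U ≤ Subgroup.normalizer ((P ⊓ C : Subgroup G) : Set G) :=
    (le_inf (hU.trans hN) hUC).trans (inf_normalizer_le_normalizer_inf _ _)
  have hU₁ : IsFullLift p P (C ⊔ U) ((P ⊓ C) ⊔ U) := by
    refine ⟨sup_le_sup_right inf_le_right U, (hPf.mono inf_le_left).sup hUp hZU, le_sup_left,
      fun h hh => ?_⟩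
    obtain ⟨c, hc, u, hu, rfl⟩ := exists_mul_of_mem_sup hUC hh
    refine ⟨u, Subgroup.mem_sup_right hu, ?_⟩
    have h1 := (Subgroup.mem_normalizer_iff''.1 (hUC hu) c).1 hc
    simpa [mul_assoc] using h1
  have hW₁ : IsFullLift p P (C ⊔ U) (W ⊓ (C ⊔ U)) := by
    refine ⟨inf_le_right, hW.finP.mono inf_le_left, le_inf hW.center_le
      (inf_le_right.trans le_sup_left), fun h hh => ?_⟩
    obtain ⟨w, hw, hwh⟩ := hW.surj h (hH₁ hh)
    refine ⟨w, Subgroup.mem_inf.2 ⟨hw, ?_⟩, hwh⟩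
    have h1 : h * (w⁻¹ * h)⁻¹ = w := by group
    rw [← h1]
    exact mul_mem hh (inv_mem (Subgroup.mem_sup_left hwh))
  obtain ⟨c, hc, h⟩ := huniq _ _ hW₁ hU₁
  exact ⟨c, hc, (conjBy_mono c le_sup_right).trans (h.le.trans inf_le_left)⟩

end FullLifts

/-! ## Coset chamber systems -/

section CosetSystem

variable {p : ℕ} {G I : Type*} [Group G] {B T : Subgroup G} {Gi : I → Subgroup G}

theorem smul_coset_eq_iff {g x : G} : x • (g : G ⧸ B) = (g : G ⧸ B) ↔ x ∈ conjBy g B := by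
  change ((x * g : G) : G ⧸ B) = (g : G) ↔ _
  rw [eq_comm, QuotientGroup.eq, mem_conjBy, mul_assoc]

theorem coset_mem_fixedChambers_iff {g : G} {P : Subgroup G} :
    (g : G ⧸ B) ∈ fixedChambers P (G ⧸ B) ↔ P ≤ conjBy g B := by
  constructor
  · intro h x hx
    exact smul_coset_eq_iff.1 (h ⟨x, hx⟩)
  · rintro h ⟨x, hx⟩
    exact smul_coset_eq_iff.2 (h hx)

theorem cosetSystem_adj_iff {h : ∀ i, B ≤ Gi i} {i : I} {a b : G} :
    (cosetSystem B Gi h).adj i (a : G ⧸ B) (b : G ⧸ B) ↔ a⁻¹ * b ∈ Gi i := by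
  change ((a : G) : G ⧸ Gi i) = (b : G) ↔ _
  rw [QuotientGroup.eq]

/-- With `K = B` it makes the conjugate of `T` attached to a chamber independent of the
representative; with `K = G_i` it gives adjacent chambers the same conjugates of `G_i` and of its
normal subgroup `Q`. -/
theorem conjBy_eq_of_inv_mul_mem {H K : Subgroup G} (hK : K ≤ Subgroup.normalizer (H : Set G))
    {a b : G} (h : a⁻¹ * b ∈ K) : conjBy a H = conjBy b H := by
  have h1 := mem_normalizer_iff_conjBy.1 (hK h)
  rw [conjBy_mul] at h1
  rw [← h1, conjBy_conjBy_inv, h1]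

/-- The group-theoretic form of the connectedness of the fixed chamber systems. -/
theorem isSylowConnected_of_cosetSystem (hB : ∀ i, B ≤ Gi i) (hfin : ∀ i, Finite (Gi i))
    (hT : FinP p T) (hTB : T ≤ B) (hBT : B ≤ Subgroup.normalizer (T : Set G))
    (hmax : ∀ U ≤ B, FinP p U → U ≤ T)
    (hQ : ∀ i, ∃ Q ≤ T, Gi i ≤ Subgroup.normalizer (Q : Set G) ∧
      Subgroup.centralizer (Q : Set G) ⊓ Gi i ≤ Q)
    (ha : ∀ P : Subgroup G, FinP p P → ((cosetSystem B Gi hB).fixed P).IsConnected) :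
    IsSylowConnected p T := by
  have hfix : ∀ {P : Subgroup G}, FinP p P → ∀ {g : G}, P ≤ conjBy g B → P ≤ conjBy g T := by
    intro P hP g h
    have h1 : conjBy g⁻¹ P ≤ B := by rwa [conjBy_le_iff, inv_inv]
    have h2 := hmax _ h1 (hP.conj _)
    rwa [conjBy_le_iff, inv_inv] at h2
  refine ⟨hT, fun P hP => ?_, fun P hP g h hg hh => ?_⟩
  · obtain ⟨⟨⟨c, hc⟩⟩, -⟩ := ha P hP
    induction c using QuotientGroup.induction_on with | H g => ?_
    exact ⟨g, hfix hP (coset_mem_fixedChambers_iff.1 hc)⟩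
  · have hg' : (g : G ⧸ B) ∈ fixedChambers P (G ⧸ B) :=
      coset_mem_fixedChambers_iff.2 (hg.trans (conjBy_mono g hTB))
    have hh' : (h : G ⧸ B) ∈ fixedChambers P (G ⧸ B) :=
      coset_mem_fixedChambers_iff.2 (hh.trans (conjBy_mono h hTB))
    let f : fixedChambers P (G ⧸ B) → Subgroup G := fun c => conjBy (Quotient.out (c : G ⧸ B)) T
    have hout : ∀ g : G, conjBy (Quotient.out (g : G ⧸ B)) T = conjBy g T := fun g =>
      conjBy_eq_of_inv_mul_mem hBT (QuotientGroup.eq.1 (QuotientGroup.out_eq' (g : G ⧸ B)))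
    have hconn := (ha P hP).2 ⟨g, hg'⟩ ⟨h, hh'⟩
    rw [← hout g, ← hout h]
    refine hconn.lift f ?_
    rintro ⟨a, ha⟩ ⟨b, hb⟩ ⟨i, hab⟩
    induction a using QuotientGroup.induction_on with | H a => ?_
    induction b using QuotientGroup.induction_on with | H b => ?_
    have hab' : a⁻¹ * b ∈ Gi i := (cosetSystem_adj_iff (h := hB)).1 hab
    rw [Function.onFun, show f ⟨(a : G ⧸ B), ha⟩ = conjBy a T from hout a,
      show f ⟨(b : G ⧸ B), hb⟩ = conjBy b T from hout b]
    rw [coset_mem_fixedChambers_iff] at ha hb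
    obtain ⟨Q, hQT, hQn, hQc⟩ := hQ i
    have hX : conjBy a (Gi i) = conjBy b (Gi i) :=
      conjBy_eq_of_inv_mul_mem Subgroup.le_normalizer hab'
    refine ⟨hfix hP ha, hfix hP hb, ⟨a, rfl⟩, ⟨b, rfl⟩, conjBy a (Gi i), conjBy a Q,
      finite_conjBy a (hfin i), conjBy_mono a (hTB.trans (hB i)), ?_, ?_, conjBy_mono a hQT, ?_, ?_⟩
    · rw [hX]
      exact conjBy_mono b (hTB.trans (hB i))
    · rw [← conjBy_normalizer]
      exact conjBy_mono a hQn
    · rw [conjBy_eq_of_inv_mul_mem hQn hab']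
      exact conjBy_mono b hQT
    · rw [← conjBy_centralizer, ← conjBy_inf]
      exact conjBy_mono a hQc

theorem smul_eq_iff_of_smul_eq {C : Type*} [MulAction G C] {W : Subgroup G} {k : G} {c d : C}
    (h : k • c = d) : (∀ w ∈ W, w • d = d) ↔ ∀ w ∈ conjBy k⁻¹ W, w • c = c := by
  subst h
  constructor
  · intro h w hw
    rw [mem_conjBy, inv_inv] at hw
    have h1 := h _ hw
    rw [smul_smul, inv_mul_cancel_right, mul_smul] at h1
    exact smul_left_cancel k h1
  · intro h w hw
    have h1 := h (k⁻¹ * w * k) (by rw [mem_conjBy]; simpa [mul_assoc] using hw)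
    rw [mul_smul, mul_smul, inv_smul_eq_iff] at h1
    exact h1

/-- A `C_G(P)`-orbit of chambers fixed by `P` is fixed by `H / C_G(P)` if and only if it is
`H`-invariant. -/
theorem mk_mem_fixedOrbits_iff {P H : Subgroup G}
    (hC : Subgroup.centralizer (P : Set G) ≤ H) (hN : H ≤ Subgroup.normalizer (P : Set G))
    {C : Type*} [MulAction G C] (c : fixedChambers P C) :
    (Quotient.mk _ c : MulAction.orbitRel.Quotient (centralizerIn P) (fixedChambers P C)) ∈
      ChamberSystem.fixedOrbits P C
        ((H.subgroupOf (Subgroup.normalizer (P : Set G))).map P.normalizerMonoidHom) ↔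
      ∀ h ∈ H, ∃ k ∈ Subgroup.centralizer (P : Set G), h • (c : C) = k • (c : C) := by
  constructor
  · intro hc h hh
    have h1 := hc ⟨h, hN hh⟩ c ⟨_, hh, rfl⟩ rfl
    obtain ⟨k, hk⟩ := Quotient.exact h1
    exact ⟨((k : Subgroup.normalizer (P : Set G)) : G), k.2, (congrArg Subtype.val hk).symm⟩
  · rintro hc n d ⟨m, hm, hmn⟩ hd
    have hnH : (n : G) ∈ H := by
      have h1 : m⁻¹ * n ∈ P.normalizerMonoidHom.ker := by
        rw [MonoidHom.mem_ker, map_mul, map_inv, hmn, inv_mul_cancel]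
      rw [Subgroup.normalizerMonoidHom_ker] at h1
      have h2 := mul_mem (show (m : G) ∈ H from hm) (hC h1)
      simpa using h2
    obtain ⟨k, hk⟩ := Quotient.exact hd
    have hk' : ((k : Subgroup.normalizer (P : Set G)) : G) • (c : C) = d := congrArg Subtype.val hk
    obtain ⟨k', hk'C, hk'c⟩ := hc _ (mul_mem hnH (hC k.2))
    refine Quotient.sound ⟨⟨⟨k', Subgroup.centralizer_le_normalizer _ hk'C⟩, hk'C⟩,
      Subtype.ext ?_⟩
    change k' • (c : C) = (n : G) • (d : C)
    rw [← hk'c, ← hk', mul_smul]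
    rfl

/-- Self-centralizing subgroups have Sylow lifts if the chamber systems `(C^P / C_G(P))^R` are
connected. -/
theorem hasSylowLifts_of_fixedQuotientFixed [Fact p.Prime] (hB : ∀ i, B ≤ Gi i)
    (hBfin : Finite B) (hfin : ∀ i, Finite (Gi i))
    (hsyl : ∀ P : Subgroup G, FinP p P → ∃ g, P ≤ conjBy g B)
    {P : Subgroup G} (hPf : FinP p P) (hP : SelfCentralizing p P)
    (hb : ∀ R : Subgroup (MulAut P), R ≤ conjAut P → IsPGroup p R →
      ((cosetSystem B Gi hB).fixedQuotientFixed (cosetSystem_invariant B Gi hB) P R).IsConnected) :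
    HasSylowLifts p P := by
  refine hasSylowLifts_of_isFullLift hPf fun H hC hN hp => ?_
  let f := P.normalizerMonoidHom
  let R : Subgroup (MulAut P) := (H.subgroupOf (Subgroup.normalizer (P : Set G))).map f
  have hRle : R ≤ conjAut P := by
    rintro _ ⟨n, -, rfl⟩
    exact ⟨n, rfl⟩
  have hRp : IsPGroup p R := by
    rintro ⟨_, ⟨n, hn, rfl⟩⟩
    obtain ⟨k, hk⟩ := hp n hn
    refine ⟨k, Subtype.ext ?_⟩
    change f n ^ p ^ k = 1
    rw [← map_pow, ← MonoidHom.mem_ker, Subgroup.normalizerMonoidHom_ker]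
    exact hk
  obtain ⟨⟨⟨x₀, hx₀⟩⟩, hconn⟩ := hb R hRle hRp
  have hstab : ∀ g : G, Finite (conjBy g B) := fun g => finite_conjBy g hBfin
  have hex : ∀ c : fixedChambers P (G ⧸ B),
      (Quotient.mk _ c : MulAction.orbitRel.Quotient (centralizerIn P) (fixedChambers P (G ⧸ B))) ∈
        ChamberSystem.fixedOrbits P (G ⧸ B) R →
      ∃ W, IsFullLift p P H W ∧ ∀ w ∈ W, w • (c : G ⧸ B) = c := by
    rintro ⟨c, hcP⟩ hc
    rw [mk_mem_fixedOrbits_iff hC hN] at hc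
    induction c using QuotientGroup.induction_on with | H g => ?_
    -- That the orbit is fixed means `H = C_G(P)(H ∩ gBg⁻¹)`, so a Sylow subgroup of the finite
    -- group `H ∩ gBg⁻¹` can serve as a full lift.
    obtain ⟨W, hWX, hW⟩ := exists_isFullLift hPf hC hN hp (hstab g)
      (coset_mem_fixedChambers_iff.1 hcP) (by
        intro h hh
        obtain ⟨k, hk, hkh⟩ := hc h hh
        refine ⟨k, hk, smul_coset_eq_iff.1 ?_⟩
        rw [mul_smul, inv_smul_eq_iff]
        exact hkh)
    exact ⟨W, hW, fun w hw => smul_coset_eq_iff.2 (hWX hw)⟩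
  refine ⟨?_, fun W W' hW hW' => ?_⟩
  · induction x₀ using Quotient.inductionOn with | h c => ?_
    obtain ⟨W, hW, -⟩ := hex c hx₀
    exact ⟨W, hW⟩
  have hchamber : ∀ W, IsFullLift p P H W → ∃ c : fixedChambers P (G ⧸ B),
      (Quotient.mk _ c : MulAction.orbitRel.Quotient (centralizerIn P) (fixedChambers P (G ⧸ B))) ∈
        ChamberSystem.fixedOrbits P (G ⧸ B) R ∧ ∀ w ∈ W, w • (c : G ⧸ B) = c := by
    intro W hW
    obtain ⟨g, hg⟩ := hsyl _ (hPf.sup hW.finP (hW.le.trans hN))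
    have hWg : ∀ w ∈ W, w • (g : G ⧸ B) = g := fun w hw =>
      smul_coset_eq_iff.2 (hg (Subgroup.mem_sup_right hw))
    refine ⟨⟨g, coset_mem_fixedChambers_iff.2 (le_sup_left.trans hg)⟩, ?_, hWg⟩
    rw [mk_mem_fixedOrbits_iff hC hN]
    intro h hh
    obtain ⟨w, hw, hwh⟩ := hW.surj h hh
    refine ⟨w * (w⁻¹ * h) * w⁻¹, (Subgroup.mem_normalizer_iff.1
      (normalizer_le_normalizer_centralizer P (hN (hW.le hw))) _).1 hwh, ?_⟩
    have h1 : h = w * (w⁻¹ * h) * w⁻¹ * w := by group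
    conv_lhs => rw [h1]
    rw [mul_smul, hWg w hw]
  obtain ⟨c, hc, hWc⟩ := hchamber W hW
  obtain ⟨d, hd, hWd⟩ := hchamber W' hW'
  have key : ∀ y : ChamberSystem.fixedOrbits P (G ⧸ B) R,
      Relation.ReflTransGen (fun a b => ∃ i, ((cosetSystem B Gi hB).fixedQuotientFixed
        (cosetSystem_invariant B Gi hB) P R).adj i a b) ⟨_, hc⟩ y →
      ∀ d : fixedChambers P (G ⧸ B), Quotient.mk _ d = y.1 → ∀ W', IsFullLift p P H W' →
        (∀ w ∈ W', w • (d : G ⧸ B) = d) →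
        ∃ k ∈ Subgroup.centralizer (P : Set G), conjBy k W' = W := by
    -- An element of `C_G(P)` moves the chamber fixed by `W'` to the representative `e`, which
    -- brings `W'` into the finite group `X` beside `V`.
    have hmove : ∀ (X : Subgroup G), Finite X → ∀ V W' : Subgroup G, IsFullLift p P H V →
        V ≤ X → IsFullLift p P H W' → ∀ (e d : fixedChambers P (G ⧸ B)),
        (Quotient.mk _ d :
          MulAction.orbitRel.Quotient (centralizerIn P) (fixedChambers P (G ⧸ B))) =
            Quotient.mk _ e → (∀ x : G, x • (e : G ⧸ B) = e → x ∈ X) →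
        (∀ w ∈ W', w • (d : G ⧸ B) = d) →
        ∃ k ∈ Subgroup.centralizer (P : Set G), conjBy k W' = V := by
      intro X hX V W' hV hVX hW' e d hde heX hW'd
      obtain ⟨k, hk⟩ := Quotient.exact hde
      have hk' : ((k : Subgroup.normalizer (P : Set G)) : G) • (e : G ⧸ B) = d :=
        congrArg Subtype.val hk
      have hkC : ((k : Subgroup.normalizer (P : Set G)) : G)⁻¹ ∈
          Subgroup.centralizer (P : Set G) := inv_mem k.2
      obtain ⟨m, hm, h⟩ := hV.exists_conj_of_finite hP hC (hW'.conj hC hkC) hX hVX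
        (fun w hw => heX w ((smul_eq_iff_of_smul_eq hk').1 hW'd w hw))
      exact ⟨_, mul_mem hm hkC, by rw [conjBy_mul, h]⟩
    intro y hy
    induction hy with
    | refl =>
      rintro d hd W' hW' hW'd
      obtain ⟨c, hcP⟩ := c
      induction c using QuotientGroup.induction_on with | H c => ?_
      exact hmove (conjBy c B) (hstab c) W W' hW (fun w hw => smul_coset_eq_iff.1 (hWc w hw)) hW'
        _ d hd (fun x hx => smul_coset_eq_iff.1 hx) hW'd
    | @tail y z _ hyz ih =>
      rintro d hd W' hW' hW'd
      obtain ⟨i, a, b, ha, hb, hab⟩ := hyz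
      have haR : (Quotient.mk _ a :
          MulAction.orbitRel.Quotient (centralizerIn P) (fixedChambers P (G ⧸ B))) ∈
          ChamberSystem.fixedOrbits P (G ⧸ B) R := by
        rw [ha]
        exact y.2
      -- A full lift fixing `a` links the two sides: induction relates it to `W`, and the conjugate
      -- of `G_i` containing the stabilizers of `a` and `b` relates it to `W'`.
      obtain ⟨V, hV, hVa⟩ := hex a haR
      obtain ⟨k, hk, hkV⟩ := ih a ha V hV hVa
      obtain ⟨a, haP⟩ := a
      obtain ⟨b, hbP⟩ := b
      induction a using QuotientGroup.induction_on with | H a => ?_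
      induction b using QuotientGroup.induction_on with | H b => ?_
      have hab' : a⁻¹ * b ∈ Gi i := (cosetSystem_adj_iff (h := hB)).1 hab
      have hX : conjBy a (Gi i) = conjBy b (Gi i) :=
        conjBy_eq_of_inv_mul_mem Subgroup.le_normalizer hab'
      obtain ⟨m, hm, hmV⟩ := hmove (conjBy a (Gi i)) (finite_conjBy a (hfin i)) V W' hV
        (fun w hw => conjBy_mono a (hB i) (smul_coset_eq_iff.1 (hVa w hw))) hW' _ d
        (hd.trans hb.symm)
        (fun x hx => by
          rw [hX]
          exact conjBy_mono b (hB i) (smul_coset_eq_iff.1 hx)) hW'd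
      exact ⟨k * m, mul_mem hk hm, by rw [conjBy_mul, hmV, hkV]⟩
  exact key ⟨_, hd⟩ (hconn _ _) d rfl W' hW' hWd

end CosetSystem

/-! ## Models and the fusion system of a completion -/

namespace FusionSystem

variable {S : Type*} [Group S]

theorem inclusion_mem (F : FusionSystem S) {P Q : Subgroup S} (h : P ≤ Q) :
    Subgroup.inclusion h ∈ F.Hom P Q :=
  F.conj_mem 1 _ fun u => by simp

/-- Membership in a fusion system does not depend on the codomain. -/
theorem mem_of_coe_eq (F : FusionSystem S) {P Q R : Subgroup S} {φ : P →* Q} {ψ : P →* R}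
    (hφ : φ ∈ F.Hom P Q) (h : ∀ u, (φ u : S) = ψ u) : ψ ∈ F.Hom P R := by
  obtain ⟨T, hT, e, he, -, hc⟩ := F.factor hφ
  have hval : ∀ u : P, (ψ u : S) = e u := fun u => by
    rw [← h, hc]
    rfl
  have hTR : T ≤ R := by
    intro x hx
    have h1 := hval (e.symm ⟨x, hx⟩)
    rw [e.apply_symm_apply] at h1
    change _ = x at h1
    rw [← h1]
    exact (ψ _).2
  have h2 : ψ = (Subgroup.inclusion hTR).comp e.toMonoidHom := by
    ext u
    exact hval u
  rw [h2]
  exact F.comp_mem he (F.inclusion_mem hTR)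

theorem normalizerTop_le (F : FusionSystem S) : F.normalizerTop ≤ F := by
  rintro P Q φ ⟨ψ, hψ, -, h⟩
  exact F.mem_of_coe_eq (F.comp_mem (F.inclusion_mem le_sup_right) hψ) h

theorem le_generate {𝓔 : Set (FusionSystem S)} {E : FusionSystem S} (hE : E ∈ 𝓔) :
    E ≤ generate 𝓔 :=
  fun P Q _ hφ => ⟨E.injective hφ, fun _ hF => hF E hE P Q hφ⟩

theorem generate_le {𝓔 : Set (FusionSystem S)} {F : FusionSystem S} (h : ∀ E ∈ 𝓔, E ≤ F) :
    generate 𝓔 ≤ F :=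
  fun _ _ _ hφ => hφ.2 F h

/-- A morphism of `N_F(S)` is the restriction of a morphism `S → S` of `N_F(S)`. -/
theorem exists_top_extension (F : FusionSystem S) {P Q : Subgroup S} {φ : P →* Q}
    (hφ : φ ∈ F.normalizerTop.Hom P Q) :
    ∃ χ ∈ F.normalizerTop.Hom ⊤ ⊤, ∀ u : P, (χ ⟨u, Subgroup.mem_top _⟩ : S) = φ u := by
  obtain ⟨ψ, hψ, hmap, h⟩ := hφ
  let i₁ : (⊤ : Subgroup S) →* ↥((⊤ : Subgroup S) ⊔ P) := Subgroup.inclusion le_sup_left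
  let i₂ : ↥((⊤ : Subgroup S) ⊔ Q) →* (⊤ : Subgroup S) := Subgroup.inclusion le_top
  let j₁ : ↥((⊤ : Subgroup S) ⊔ ⊤) →* (⊤ : Subgroup S) := Subgroup.inclusion le_top
  let j₂ : (⊤ : Subgroup S) →* ↥((⊤ : Subgroup S) ⊔ ⊤) := Subgroup.inclusion le_sup_left
  have hχ : (i₂.comp ψ).comp i₁ ∈ F.Hom ⊤ ⊤ :=
    F.comp_mem (F.inclusion_mem _) (F.comp_mem hψ (F.inclusion_mem _))
  refine ⟨(i₂.comp ψ).comp i₁, ⟨(j₂.comp ((i₂.comp ψ).comp i₁)).comp j₁,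
    F.comp_mem (F.inclusion_mem _) (F.comp_mem hχ (F.inclusion_mem _)), ?_, fun u => rfl⟩,
    fun u => h u⟩
  ext x
  simp only [Subgroup.mem_map, Subgroup.mem_subgroupOf, Subgroup.mem_top, iff_true, true_and]
  have h1 : (⟨x, Subgroup.mem_sup_left (Subgroup.mem_top _)⟩ : ↥((⊤ : Subgroup S) ⊔ Q)) ∈
      ((⊤ : Subgroup S).subgroupOf (⊤ ⊔ P)).map ψ := by
    rw [hmap]
    exact Subgroup.mem_top _
  obtain ⟨y, -, hy⟩ := h1
  refine ⟨⟨y, Subgroup.mem_sup_left (Subgroup.mem_top _)⟩, Subtype.ext ?_⟩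
  have h2 : (ψ y : S) = x := congrArg Subtype.val hy
  exact h2

end FusionSystem

section Models

variable {p : ℕ} {S X : Type*} [Group S] [Group X] {ι : S →* X}

theorem pCore_normal (p : ℕ) (X : Type*) [Group X] : (pCore p X).Normal :=
  Subgroup.sSup_normal _ fun _ h => h.1

theorem IsModel.pCore_le_range {F : FusionSystem S} (h : IsModel p ι F) :
    pCore p X ≤ ι.range := by
  obtain ⟨Q, hQ⟩ := h.sylow
  rw [← hQ]
  refine sSup_le fun N hN => ?_
  have := hN.1
  exact hN.2.le_sylow_of_normal Q

/-- In a model of `N_F(S)`, the Sylow subgroup `S` is normal. -/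
theorem IsModel.normal_range [Finite S] {F : FusionSystem S}
    (h : IsModel p ι F.normalizerTop) : ι.range.Normal := by
  obtain ⟨hι, hF⟩ := h.realizes
  have hcore := pCore_normal p X
  rw [← Subgroup.normalizer_eq_top_iff, eq_top_iff]
  intro b _
  let P := (pCore p X).comap ι
  have hP : P.map ι = pCore p X := by
    rw [Subgroup.map_comap_eq]
    exact inf_eq_right.2 h.pCore_le_range
  have hbP : conjBy b (P.map ι) ≤ P.map ι := by
    rw [hP]
    exact (mem_normalizer_iff_conjBy.1 (Subgroup.normalizer_eq_top (pCore p X) ▸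
      Subgroup.mem_top b)).le
  obtain ⟨φ, hφ⟩ := exists_hom_of_conjBy_le hι hbP
  have hφF : φ ∈ F.normalizerTop.Hom P P := by
    rw [hF]
    exact ⟨b, hφ⟩
  -- The action of `b` on `O_p(X)` extends to `S`, where some `b'` normalizing `S` induces it; then
  -- `b'⁻¹b` centralizes `O_p(X)`, hence lies in `O_p(X) ≤ S`.
  obtain ⟨χ, hχ, hχφ⟩ := F.exists_top_extension hφF
  rw [hF] at hχ
  obtain ⟨b', hb'⟩ := hχ
  have hle : conjBy b' ι.range ≤ ι.range := by
    rintro _ ⟨_, ⟨s, rfl⟩, rfl⟩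
    exact ⟨_, hb' ⟨s, Subgroup.mem_top s⟩⟩
  have hfin : Finite ι.range := Finite.of_surjective _ ι.rangeRestrict_surjective
  have hb'N : b' ∈ Subgroup.normalizer (ι.range : Set X) :=
    mem_normalizer_iff_conjBy.2 (Subgroup.eq_of_le_of_card_ge hle (card_conjBy b' _).ge)
  have hcent : b'⁻¹ * b ∈ pCore p X := by
    refine h.constrained fun x hx => ?_
    rw [SetLike.mem_coe, ← hP] at hx
    obtain ⟨s, hs, rfl⟩ := hx
    have h1 : b' * ι s * b'⁻¹ = b * ι s * b⁻¹ := by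
      rw [← hφ ⟨s, hs⟩, ← hχφ ⟨s, hs⟩, hb']
    have h2 : b'⁻¹ * b * ι s = b'⁻¹ * (b * ι s * b⁻¹) * b := by group
    rw [h2, ← h1]
    group
  have h3 := mul_mem hb'N (Subgroup.le_normalizer (h.pCore_le_range hcent))
  simpa using h3

end Models

/-! ### The embedded diagram and the equality of `F` with `F_S(G)`. -/

namespace GroupDiagram.Completion

variable {p : ℕ} {S I : Type*} [Group S] {F : FusionSystem S} {Fi : I → FusionSystem S}
  {A : GroupDiagram I} {ι : S →* A.B} {G : Type*} [Group G] {Φ : A.Completion G}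

theorem comp_apply (i : I) (s : S) : Φ.φ₁ i (((A.τ₁ i).comp ι) s) = (Φ.φB.comp ι) s := by
  rw [← Φ.comm₁ i]
  rfl

theorem injective_comp (hA : IsModelDiagram p F Fi A ι) (hΦ : Φ.IsFaithful) :
    Function.Injective (Φ.φB.comp ι) := by
  obtain ⟨hι, -⟩ := hA.modelB.realizes
  exact hΦ.injB.comp hι

theorem range_le_normalizer [Finite S] (hA : IsModelDiagram p F Fi A ι) :
    Φ.φB.range ≤ Subgroup.normalizer ((Φ.φB.comp ι).range : Set G) := by
  have hn := hA.modelB.normal_range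
  rintro _ ⟨b, rfl⟩
  rw [mem_normalizer_iff_conjBy]
  refine le_antisymm ?_ ?_
  · rintro _ ⟨_, ⟨s, rfl⟩, rfl⟩
    obtain ⟨t, ht⟩ := hn.conj_mem (ι s) ⟨s, rfl⟩ b
    refine ⟨t, ?_⟩
    change Φ.φB (ι t) = Φ.φB b * Φ.φB (ι s) * (Φ.φB b)⁻¹
    rw [ht]
    simp
  · rintro _ ⟨s, rfl⟩
    rw [mem_conjBy]
    obtain ⟨t, ht⟩ := hn.conj_mem (ι s) ⟨s, rfl⟩ b⁻¹
    refine ⟨t, ?_⟩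
    change Φ.φB (ι t) = (Φ.φB b)⁻¹ * Φ.φB (ι s) * Φ.φB b
    rw [ht]
    simp

theorem le_range_of_finP [Fact p.Prime] [Finite S] (hA : IsModelDiagram p F Fi A ι)
    (hΦ : Φ.IsFaithful) (U : Subgroup G) (hU : U ≤ Φ.φB.range) (hUp : FinP p U) :
    U ≤ (Φ.φB.comp ι).range := by
  have hn := hA.modelB.normal_range
  obtain ⟨Q, hQ⟩ := hA.modelB.sylow
  have hQn : (Q : Subgroup A.B).Normal := by
    rw [hQ]
    exact hn
  have := Sylow.unique_of_normal Q hQn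
  have hU' : IsPGroup p (U.comap Φ.φB) := hUp.pgrp.comap_of_injective _ hΦ.injB
  obtain ⟨Q', hQ'⟩ := hU'.exists_le_sylow
  rw [Subsingleton.elim Q' Q, hQ] at hQ'
  intro x hx
  obtain ⟨b, rfl⟩ := hU hx
  obtain ⟨s, rfl⟩ := hQ' (show b ∈ U.comap Φ.φB from hx)
  exact ⟨s, rfl⟩

/-- The image of `O_p(G_i)` serves, by the constraint condition on the model. -/
theorem exists_panel_core (hA : IsModelDiagram p F Fi A ι) (hΦ : Φ.IsFaithful) (i : I) :
    ∃ Q ≤ (Φ.φB.comp ι).range, (Φ.φ₁ i).range ≤ Subgroup.normalizer (Q : Set G) ∧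
      Subgroup.centralizer (Q : Set G) ⊓ (Φ.φ₁ i).range ≤ Q := by
  have hm := hA.model₁ i
  have hn := pCore_normal p (A.G₁ i)
  refine ⟨(pCore p (A.G₁ i)).map (Φ.φ₁ i), ?_, ?_, ?_⟩
  · rintro _ ⟨x, hx, rfl⟩
    obtain ⟨s, rfl⟩ := hm.pCore_le_range hx
    exact ⟨s, (comp_apply i s).symm⟩
  · rintro _ ⟨x, rfl⟩
    refine Subgroup.le_normalizer_map _ ⟨x, ?_, rfl⟩
    rw [Subgroup.normalizer_eq_top]
    exact Subgroup.mem_top x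
  · rintro _ ⟨hx, ⟨x, rfl⟩⟩
    refine ⟨x, hm.constrained fun y hy => hΦ.inj₁ i ?_, rfl⟩
    rw [map_mul, map_mul]
    exact hx _ ⟨y, hy, rfl⟩

/-- `F` is contained in `F_S(G)`. -/
theorem le_ofGroup (hF : F.IsParabolicFamily p Fi) (hA : IsModelDiagram p F Fi A ι)
    (hκ : Function.Injective (Φ.φB.comp ι)) : F ≤ FusionSystem.ofGroup (Φ.φB.comp ι) hκ := by
  rw [← hF.generates]
  refine FusionSystem.generate_le ?_
  rintro _ ⟨i, rfl⟩
  obtain ⟨hι, hi⟩ := (hA.model₁ i).realizes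
  rw [hi]
  rintro P Q φ ⟨g, hg⟩
  refine ⟨Φ.φ₁ i g, fun u => ?_⟩
  have h1 := congrArg (Φ.φ₁ i) (hg u)
  rw [map_mul, map_mul, map_inv, comp_apply, comp_apply] at h1
  exact h1

/-- `F_S(G)` is contained in `F`, by following galleries in the fixed chamber systems. -/
theorem ofGroup_le [Fact p.Prime] [Finite S] (hS : IsPGroup p S) (hF : F.IsParabolicFamily p Fi)
    (hA : IsModelDiagram p F Fi A ι) (hΦ : Φ.IsFaithful)
    (hκ : Function.Injective (Φ.φB.comp ι))
    (ha : ∀ P : Subgroup G, FinP p P → (Φ.chamberSystem.fixed P).IsConnected) :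
    FusionSystem.ofGroup (Φ.φB.comp ι) hκ ≤ F := by
  rintro P Q φ ⟨g, hg⟩
  set κ := Φ.φB.comp ι with hκdef
  have hPκ : FinP p (P.map κ) := FinP.map_of_isPGroup hS κ P
  have hκB : κ.range ≤ Φ.φB.range := by
    rintro _ ⟨s, rfl⟩
    exact ⟨ι s, rfl⟩
  have hfix : ∀ {h : G}, P.map κ ≤ conjBy h Φ.φB.range →
      conjBy h⁻¹ (P.map κ) ≤ (⊤ : Subgroup S).map κ := by
    intro h hh
    rw [← MonoidHom.range_eq_map]
    refine le_range_of_finP hA hΦ _ ?_ (hPκ.conj _)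
    rwa [conjBy_le_iff, inv_inv]
  have h₀ : ((1 : G) : G ⧸ Φ.φB.range) ∈ fixedChambers (P.map κ) (G ⧸ Φ.φB.range) := by
    rw [coset_mem_fixedChambers_iff, conjBy_one]
    exact (Subgroup.map_le_range κ P).trans hκB
  have h₁ : ((g⁻¹ : G) : G ⧸ Φ.φB.range) ∈ fixedChambers (P.map κ) (G ⧸ Φ.φB.range) := by
    rw [coset_mem_fixedChambers_iff, ← conjBy_le_iff, ← map_homImage hg]
    exact (Subgroup.map_le_range κ _).trans hκB
  -- A chamber `hB` fixed by `P` encodes conjugation by `h⁻¹` from `P` into `S`: `B` itself gives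
  -- morphisms of `N_F(S)`, an `i`-adjacency changes the morphism by one of `F_i`, and `g⁻¹B` gives
  -- `φ`.
  have key : ∀ c : fixedChambers (P.map κ) (G ⧸ Φ.φB.range),
      Relation.ReflTransGen (fun a b => ∃ i, (Φ.chamberSystem.fixed (P.map κ)).adj i a b)
        ⟨_, h₀⟩ c → ∀ h : G, (h : G ⧸ Φ.φB.range) = c →
      ∀ ψ : P →* (⊤ : Subgroup S), (∀ u : P, κ (ψ u) = h⁻¹ * κ u * h) → ψ ∈ F.Hom P ⊤ := by
    intro c hc
    induction hc with
    | refl =>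
      intro h hh ψ hψ
      obtain ⟨b, hb⟩ : h⁻¹ ∈ Φ.φB.range := by
        have h1 := QuotientGroup.eq.1 hh
        rwa [mul_one] at h1
      obtain ⟨hι, hB⟩ := hA.modelB.realizes
      refine F.normalizerTop_le P ⊤ ?_
      rw [hB]
      refine ⟨b, fun u => hΦ.injB ?_⟩
      rw [map_mul, map_mul, map_inv, hb, inv_inv]
      exact hψ u
    | @tail c d _ hcd ih =>
      intro h hh ψ hψ
      obtain ⟨i, hcd⟩ := hcd
      obtain ⟨c, hcP⟩ := c
      induction c using QuotientGroup.induction_on with | H k => ?_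
      obtain ⟨ψ', hψ'⟩ := exists_hom_of_conjBy_le hκ (hfix (coset_mem_fixedChambers_iff.1 hcP))
      simp only [inv_inv] at hψ'
      have hψ'F := ih k rfl ψ' hψ'
      have hψ'i := F.injective hψ'F
      have hkh : k⁻¹ * h ∈ (Φ.φ₁ i).range := by
        refine (cosetSystem_adj_iff (h := Φ.range_le)).1 ?_
        rw [hh]
        exact hcd
      obtain ⟨x, hx⟩ := inv_mem hkh
      obtain ⟨hι, hi⟩ := (hA.model₁ i).realizes
      have hval : ∀ u : P, κ (ψ u) = Φ.φ₁ i x * κ (ψ' u) * (Φ.φ₁ i x)⁻¹ := by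
        intro u
        rw [hψ, hψ', hx]
        group
      let e := homImageEquiv ψ' hψ'i
      have he := F.factor_image hψ'F hψ'i
      have hχ : ψ.comp e.symm.toMonoidHom ∈ F.Hom (homImage ψ') ⊤ := by
        rw [← hF.generates]
        refine FusionSystem.le_generate (Set.mem_range_self i) _ _ ?_
        rw [hi]
        refine ⟨x, fun v => hΦ.inj₁ i ?_⟩
        obtain ⟨u, rfl⟩ := e.surjective v
        rw [map_mul, map_mul, map_inv, comp_apply, comp_apply]
        have h1 : (ψ.comp e.symm.toMonoidHom) (e u) = ψ u :=
          congrArg ψ (e.symm_apply_apply u)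
        rw [h1]
        exact hval u
      refine F.mem_of_coe_eq (F.comp_mem he.1 hχ) fun u => ?_
      exact congrArg (fun v => (ψ v : S)) (e.symm_apply_apply u)
  have hψ : (Subgroup.inclusion (le_top : Q ≤ ⊤)).comp φ ∈ F.Hom P ⊤ := by
    refine key _ ((ha _ hPκ).2 ⟨_, h₀⟩ ⟨_, h₁⟩) g⁻¹ rfl _ fun u => ?_
    rw [inv_inv]
    exact hg u
  exact F.mem_of_coe_eq hψ fun u => rfl

/-- Conjugating `C_S(φ(P))` back gives a finite `p`-subgroup of `C_G(P)`, hence of `P`. This is what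
makes hypothesis (b) available. -/
theorem isCentric_ofGroup_of_selfCentralizing [Finite S] (hS : IsPGroup p S) {κ : S →* G}
    (hκ : Function.Injective κ) {P : Subgroup S} (hP : SelfCentralizing p (P.map κ)) :
    (FusionSystem.ofGroup κ hκ).IsCentric P := by
  rintro φ ⟨g, hg⟩
  have himg := map_homImage hg
  refine le_antisymm (fun x hx => ?_) ?_
  · have hmem : x ∈ homImage φ := by
      have h1 : (Subgroup.centralizer (homImage φ : Set S)).map κ ≤
          conjBy g (Subgroup.centralizer ((P.map κ : Subgroup G) : Set G)) := by
        rw [map_centralizer_of_injective hκ, conjBy_centralizer, himg]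
        exact inf_le_right
      have h2 : conjBy g⁻¹ ((Subgroup.centralizer (homImage φ : Set S)).map κ) ≤ P.map κ := by
        refine hP _ ?_ ((FinP.map_of_isPGroup hS κ _).conj _)
        rwa [conjBy_le_iff, inv_inv]
      rw [conjBy_le_iff, inv_inv, ← himg, Subgroup.map_le_map_iff_of_injective hκ] at h2
      exact h2 hx
    refine ⟨⟨x, hmem⟩, ?_, rfl⟩
    rw [SetLike.mem_coe, Subgroup.mem_center_iff]
    intro y
    exact Subtype.ext (hx y y.2)
  · rintro _ ⟨x, hx, rfl⟩ y hy
    exact congrArg Subtype.val (Subgroup.mem_center_iff.1 hx ⟨y, hy⟩)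

end GroupDiagram.Completion

theorem SelfCentralizing.conj {p : ℕ} {G : Type*} [Group G] {P : Subgroup G}
    (hP : SelfCentralizing p P) (g : G) : SelfCentralizing p (conjBy g P) := by
  intro U hU hUp
  rw [← conjBy_centralizer, ← inv_inv g, ← conjBy_le_iff] at hU
  have h1 := hP _ hU (hUp.conj _)
  rwa [conjBy_le_iff, inv_inv] at h1

theorem theorem5p7 {p : ℕ} [Fact p.Prime] {S : Type*} [Group S] [Finite S] (hS : IsPGroup p S)
    {I : Type*} [Finite I] (F : FusionSystem S) (Fi : I → FusionSystem S)
    (hOp : F.Op = ⊥) (hF : F.IsParabolicFamily p Fi)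
    (A : GroupDiagram I) (ι : S →* A.B) (hA : IsModelDiagram p F Fi A ι)
    {G : Type*} [Group G] (Φ : A.Completion G) (hΦ : Φ.IsFaithful)
    (ha : ∀ P : Subgroup G, Finite P → IsPGroup p P → (Φ.chamberSystem.fixed P).IsConnected)
    (hb : ∀ P : Subgroup S, F.IsCentric P →
      ∀ R : Subgroup (MulAut (P.map (Φ.φB.comp ι))),
        R ≤ conjAut (P.map (Φ.φB.comp ι)) → IsPGroup p R →
          (Φ.chamberSystem.fixedQuotientFixed Φ.chamberSystem_invariant
            (P.map (Φ.φB.comp ι)) R).IsConnected) :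
    IsRealizedBy p (Φ.φB.comp ι) F ∧ F.IsSaturated p := by
  have hκ := GroupDiagram.Completion.injective_comp hA hΦ
  have ha' : ∀ P : Subgroup G, FinP p P → (Φ.chamberSystem.fixed P).IsConnected :=
    fun P hP => ha P hP.fin hP.pgrp
  have hFG : F = FusionSystem.ofGroup (Φ.φB.comp ι) hκ := by
    ext P Q φ
    exact ⟨fun h => GroupDiagram.Completion.le_ofGroup hF hA hκ P Q h,
      fun h => GroupDiagram.Completion.ofGroup_le hS hF hA hΦ hκ ha' P Q h⟩
  have hTB : (Φ.φB.comp ι).range ≤ Φ.φB.range := by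
    rintro _ ⟨s, rfl⟩
    exact ⟨ι s, rfl⟩
  have hfin : ∀ i, Finite (Φ.φ₁ i).range := fun i =>
    Finite.of_surjective _ (Φ.φ₁ i).rangeRestrict_surjective
  have hBfin : Finite Φ.φB.range := Finite.of_surjective _ Φ.φB.rangeRestrict_surjective
  have hconn : IsSylowConnected p (Φ.φB.comp ι).range :=
    isSylowConnected_of_cosetSystem Φ.range_le hfin (FinP.range_of_isPGroup hS _) hTB
      (GroupDiagram.Completion.range_le_normalizer hA)
      (GroupDiagram.Completion.le_range_of_finP hA hΦ)
      (GroupDiagram.Completion.exists_panel_core hA hΦ) ha'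
  have hsyl : ∀ U : Subgroup G, FinP p U → ∃ g, conjBy g U ≤ (Φ.φB.comp ι).range := by
    intro U hU
    obtain ⟨g, hg⟩ := hconn.sylow U hU
    exact ⟨g⁻¹, by rwa [conjBy_le_iff, inv_inv]⟩
  -- Hypothesis (b) concerns subgroups of `S`, so `P` is first conjugated into `S` and the lifts are
  -- conjugated back.
  have hcent : ∀ P : Subgroup G, FinP p P → SelfCentralizing p P → HasSylowLifts p P := by
    intro P hP hPc
    obtain ⟨g, hg⟩ := hsyl P hP
    have hmap : (((conjBy g P).comap (Φ.φB.comp ι)).map (Φ.φB.comp ι)) = conjBy g P := by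
      rw [Subgroup.map_comap_eq]
      exact inf_eq_right.2 hg
    have hPc' := hPc.conj g
    have hP' := hP.conj g
    rw [← hmap] at hPc' hP'
    have h1 : F.IsCentric ((conjBy g P).comap (Φ.φB.comp ι)) := by
      rw [hFG]
      exact GroupDiagram.Completion.isCentric_ofGroup_of_selfCentralizing hS hκ hPc'
    have h2 := hasSylowLifts_of_fixedQuotientFixed Φ.range_le hBfin hfin
      (fun U hU => (hconn.sylow U hU).imp fun k hk => hk.trans (conjBy_mono k hTB)) hP' hPc'
      (hb _ h1)
    rw [hmap] at h2
    have h3 := h2.conj g⁻¹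
    rwa [conjBy_inv_conjBy] at h3
  have hT := FinP.range_of_isPGroup hS (Φ.φB.comp ι)
  refine ⟨⟨hT.fin, hT.pgrp, fun P hPf hPp => hsyl P ⟨hPf, hPp⟩, hκ, hFG⟩, ?_⟩
  rw [hFG]
  exact isSaturated_ofGroup hS hκ hsyl fun U hU => hconn.hasSylowLifts hcent hU
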